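/- Let $\ell\ge 1$ be an integer and $m\in\mathbb C\setminus\{0,1\}$. Put $g_2=\tfrac43(m^2-m+1)$, $g_3=\tfrac4{27}(m-2)(2m-1)(m+1)$, and let $E_{g_2,g_3}$ be the elliptic curve $y^2=4x^3-g_2x-g_3$. Let $\mathsf L_\ell(B)=\mathsf L_\ell(B;g_2,g_3)$ be the full Lamé spectral polynomial (monic of degree $2\ell+1$ in $B$; its roots, with multiplicity, are the values of $B$ for which $\{(y\,d/dx)^2-[\ell(\ell+1)x+B]\}\Psi=0$ has a Lamé polynomial solution), and let $\Gamma_\ell$ be the curve $\nu^2=\mathsf L_\ell(B)$; a point $(B',\nu')\in\Gamma_1$ is identified with $(x_0,y_0)=(B',2\nu')\in E_{g_2,g_3}$. An Hermite–Krichever solution of the Lamé equation $\{(y\,d/dx)^2-[\ell(\ell+1)x+B]\}\Psi=0$ on $E_{g_2,g_3}$, with parameters $(x_0,y_0)\in E_{g_2,g_3}\setminus\{\infty\}$ and $\kappa\in\mathbb C$, is a nonzero solution of the form $[\mathcal A(x)\Phi+2\mathcal B(x)\,(y\,d/dx)\Phi]\exp[\kappa\int dx/y]$ with polynomials $\mathcal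 A,\mathcal B$, where $\Phi=\exp\bigl[\tfrac12\int\frac{y+y_0}{x-x_0}\frac{dx}y\bigr]$. Suppose that there are functions $B_\ell(B;g_2,g_3)$, $\nu_\ell(B,\nu;g_2,g_3)$, $\hat\kappa_\ell(B;g_2,g_3)$ such that, for all but finitely many $B$ (the exceptional set being $S$) and all $(B,\nu)\in\Gamma_\ell$ over such $B$, there is an Hermite–Krichever solution with $(x_0,y_0)=(B_\ell(B),2\nu_\ell(B,\nu))\in E_{g_2,g_3}$ and $\kappa=\hat\kappa_\ell(B)\nu$. Let $\mathsf K=\mathsf K(m)$ be the first complete elliptic integral and $\mathrm H,\Theta,\mathrm Z=\Theta'/\Theta,\mathrm{sn},\mathrm{cn},\mathrm{dn}$ the Jacobi functions with parameter $m$, and consider the Jacobi form $[-d^2/d\alpha^2+\ell(\ell+1)m\,\mathrm{sn}^2(\alpha|m)]\Psi=E\Psi$, with $B=-E+\tfrac13\ell(\ell+1)(m+1)$. Let $\widetilde\Gamma_\ell$ be the curve $\tilde\nu^2=\widetilde{\mathsf L}_\ell(E|m):=-\mathsf L_\ell(B)$, with $\nu=\mathrm i\tilde\nu$. To a point $(E,\tilde\nu)\in\widetilde\Gamma_\ell$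 are attached the nonzero solutions of the Jacobi form with energy $E$ that have the form $[\widetilde{\mathcal A}(\mathrm{sn}^2\alpha)\widetilde\Phi+2\widetilde{\mathcal B}(\mathrm{sn}^2\alpha)\widetilde\Phi']e^{\kappa\alpha}$ with polynomials $\widetilde{\mathcal A},\widetilde{\mathcal B}$, where $\widetilde\Phi(\alpha)=\frac{\mathrm H(\alpha-\alpha_0)}{\Theta(\alpha)}e^{\alpha\mathrm Z(\alpha_0)}$, $B_\ell(B)=m\,\mathrm{sn}^2\alpha_0-\tfrac13(m+1)$, $\nu_\ell(B,\mathrm i\tilde\nu)=m\,\mathrm{sn}\,\alpha_0\,\mathrm{cn}\,\alpha_0\,\mathrm{dn}\,\alpha_0$ and $\kappa=\hat\kappa_\ell(B)\mathrm i\tilde\nu$. A number $k$ is a crystal momentum of $\Psi$ if $\Psi(\alpha+2\mathsf K)=e^{\mathrm ik(2\mathsf K)}\Psi(\alpha)$. Let $k_\ell(E,\tilde\nu|m)$ denote the (multi-valued) crystal momentum of the solutions attached to $(E,\tilde\nu)$, and let $k_1(E',\tilde\nu'|m)=-\mathrm i\,\mathrm Z(\alpha_0|m)+\pi/2\mathsf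 K$ modulo $\pi/\mathsf K$, where $\mathrm{dn}^2(\alpha_0|m)=E'-m$ and $m\,\mathrm{sn}\,\alpha_0\,\mathrm{cn}\,\alpha_0\,\mathrm{dn}\,\alpha_0=\mathrm i\tilde\nu'$. Then for every $(E,\tilde\nu)\in\widetilde\Gamma_\ell$ with $B=-E+\tfrac13\ell(\ell+1)(m+1)\notin S$, one has, as an equality of multi-valued quantities, $$k_\ell(E,\tilde\nu|m)=k_1\bigl(\mathcal E_\ell(E|m),\tilde\nu_\ell(E,\tilde\nu|m)\bigm|m\bigr)+\hat\kappa_\ell(E|m)\,\tilde\nu,$$ $$\mathcal E_\ell(E|m)=-B_\ell(B;g_2,g_3)+\tfrac23(m+1),\quad \tilde\nu_\ell(E,\tilde\nu|m)=-\mathrm i\,\nu_\ell(B,\mathrm i\tilde\nu;g_2,g_3),\quad \hat\kappa_\ell(E|m)=\hat\kappa_\ell(B;g_2,g_3).$$ The set of values of $k_\ell(E,\tilde\nu|m)$ is a single (nonempty) coset of $(\pi/\mathsf K)\mathbb Z$. Moreover this is the dispersion relation: a number is a crystal momentum of some nonzero solution of the Jacobi form with energy $E$, analytic and single-valued off the poles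 of the potential, if and only if it or its negative is a value of $k_\ell(E,\tilde\nu|m)$. -/

import Mathlib

noncomputable section

namespace Lame

open Complex Polynomial

/-! ## Lamé spectral polynomials and spectral curves

All four families of coefficients are computed downwards from a leading coefficient `1` by a
recurrence `p j * a j + q j * a (j+1) + r j * a (j+2) + s j * a (j+3) = 0`.
The coefficients are polynomials in the accessory parameter `B`, which is the variable `X`. -/

/-- The triple `(a (N-n), a (N-n+1), a (N-n+2))`, where `a N = 1`, `a j = 0` for `j > N`, and
`p j * a j + q j * a (j+1) + r j * a (j+2) + s j * a (j+3) = 0` for `j < N`. -/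
def descend (p : ℤ → ℂ) (q r s : ℤ → ℂ[X]) (N : ℕ) : ℕ → ℂ[X] × ℂ[X] × ℂ[X]
  | 0 => (1, 0, 0)
  | n + 1 =>
    let t := descend p q r s N n
    let j : ℤ := (N : ℤ) - n - 1
    (C (-(p j)⁻¹) * (q j * t.1 + r j * t.2.1 + s j * t.2.2), t.1, t.2.1)

/-- The coefficient `a (-1)` of the downward recurrence started at `a N = 1`. -/
def coeffNegOne (p : ℤ → ℂ) (q r s : ℤ → ℂ[X]) (N : ℕ) : ℂ[X] :=
  (descend p q r s N (N + 1)).1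

/-- The monic polynomial proportional to `P` (for `P ≠ 0`). -/
def monicize (P : ℂ[X]) : ℂ[X] := C (P.leadingCoeff)⁻¹ * P

/-- `c_{-1}` for solutions `C(x)`, `ℓ` even, `deg C = ℓ/2`. -/
def cNegOne (ℓ : ℕ) (g₂ g₃ : ℂ) : ℂ[X] :=
  coeffNegOne (fun j => (2 * j - ℓ) * (2 * j + ℓ + 1))
    (fun _ => -X)
    (fun j => C (-((j + 2) * (j + 3 / 2) * g₂)))
    (fun j => C (-((j + 2) * (j + 3) * g₃))) (ℓ / 2)

/-- `d_{-1}` for solutions `D(x) y`, `ℓ ≥ 3` odd, `deg D = (ℓ-3)/2`. -/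
def dNegOne (ℓ : ℕ) (g₂ g₃ : ℂ) : ℂ[X] :=
  coeffNegOne (fun j => (2 * j - ℓ + 3) * (2 * j + ℓ + 4))
    (fun _ => -X)
    (fun j => C (-((j + 2) * (j + 5 / 2) * g₂)))
    (fun j => C (-((j + 2) * (j + 3) * g₃))) ((ℓ - 3) / 2)

/-- `e_{-1}` for solutions `E(x) √(x-e)`, `ℓ` odd, `deg E = (ℓ-1)/2`. -/
def eNegOne (ℓ : ℕ) (e g₂ g₃ : ℂ) : ℂ[X] :=
  coeffNegOne (fun j => (2 * j - ℓ + 1) * (2 * j + ℓ + 2))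
    (fun j => C ((4 * j + 5) * e) - X)
    (fun j => C ((-(j + 5 / 2) * g₂ + 4 * e ^ 2) * (j + 2)))
    (fun j => C (-((j + 2) * (j + 3) * g₃))) ((ℓ - 1) / 2)

/-- `f_{-1}` for solutions `F(x) y / √(x-e)`, `ℓ ≥ 2` even, `deg F = (ℓ-2)/2`. -/
def fNegOne (ℓ : ℕ) (e g₂ g₃ : ℂ) : ℂ[X] :=
  coeffNegOne (fun j => (2 * j - ℓ + 2) * (2 * j + ℓ + 3))
    (fun j => C (-(4 * j + 7) * e) - X)
    (fun j => C ((-(j + 3 / 2) * g₂ - 4 * e ^ 2) * (j + 2)))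
    (fun j => C (-((j + 2) * (j + 3) * g₃))) ((ℓ - 2) / 2)

/-- Type-I Lamé spectral polynomial. -/
def specI (ℓ : ℕ) (g₂ g₃ : ℂ) : ℂ[X] :=
  if ℓ = 1 then 1
  else if Even ℓ then monicize (cNegOne ℓ g₂ g₃) else monicize (dNegOne ℓ g₂ g₃)

/-- Type-II Lamé spectral polynomial associated with the finite branch point `e`. -/
def specII (ℓ : ℕ) (e g₂ g₃ : ℂ) : ℂ[X] :=
  if Even ℓ then monicize (fNegOne ℓ e g₂ g₃) else monicize (eNegOne ℓ e g₂ g₃)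

/-- The cubic `4x³ - g₂x - g₃ = 4(x-e₁)(x-e₂)(x-e₃)`. -/
def cubic (g₂ g₃ : ℂ) : ℂ[X] := C 4 * X ^ 3 - C g₂ * X - C g₃

/-- The full Lamé spectral polynomial: the Type-I polynomial times the product of the three
Type-II polynomials over the roots `e₁, e₂, e₃` of the cubic. -/
def specFull (ℓ : ℕ) (g₂ g₃ : ℂ) : ℂ[X] :=
  specI ℓ g₂ g₃ * ((cubic g₂ g₃).roots.map fun e => specII ℓ e g₂ g₃).prod

/-- `(B, ν)` is a finite point of the `ℓ`-th Lamé spectral curve `Γ_ℓ(g₂, g₃)`. -/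
def OnSpectralCurve (ℓ : ℕ) (g₂ g₃ B ν : ℂ) : Prop := ν ^ 2 = (specFull ℓ g₂ g₃).eval B

/-! ## Hermite–Krichever solutions on the elliptic curve `y² = 4x³ - g₂x - g₃` -/

/-- `y` is an analytic branch of `√(4x³ - g₂x - g₃)` on the open set `U`, the function `I₁` is an
antiderivative of `½ (y+y₀)/(x-x₀) dx/y` and `I₀` is an antiderivative of `dx/y` on `U`. -/
structure IsBranch (g₂ g₃ x₀ y₀ : ℂ) (U : Set ℂ) (y I₁ I₀ : ℂ → ℂ) : Prop where
  isOpen : IsOpen U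
  ne_x₀ : ∀ x ∈ U, x ≠ x₀
  y_ne : ∀ x ∈ U, y x ≠ 0
  y_diff : DifferentiableOn ℂ y U
  y_sq : ∀ x ∈ U, y x ^ 2 = 4 * x ^ 3 - g₂ * x - g₃
  deriv_I₁ : ∀ x ∈ U, HasDerivAt I₁ (1 / 2 * ((y x + y₀) / (x - x₀)) / y x) x
  deriv_I₀ : ∀ x ∈ U, HasDerivAt I₀ (1 / y x) x

/-- The operator `y d/dx`. -/
def yD (y f : ℂ → ℂ) : ℂ → ℂ := fun x => y x * deriv f x

/-- A branch of `[𝒜(x) Φ + 2 ℬ(x) Φ⁽¹⁾] exp[κ ∫ dx/y]`, where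
`Φ = exp[½ ∫ (y+y₀)/(x-x₀) dx/y]` and `Φ⁽¹⁾ = (y d/dx) Φ`. -/
def hkFun (κ : ℂ) (A₀ B₀ : ℂ[X]) (y I₁ I₀ : ℂ → ℂ) : ℂ → ℂ := fun x =>
  (A₀.eval x * exp (I₁ x) + 2 * B₀.eval x * yD y (fun t => exp (I₁ t)) x) * exp (κ * I₀ x)

/-- The Lamé equation `{(y d/dx)² - [ℓ(ℓ+1)x + B]} Ψ = 0` on the elliptic curve has a nonzero
Hermite–Krichever solution with parametrization point `(x₀, y₀)` (a finite point of the curve),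
exponent `κ` and polynomials `A₀`, `B₀`.  Being a solution is tested on all analytic branches. -/
structure IsHKSolution (ℓ : ℕ) (g₂ g₃ B x₀ y₀ κ : ℂ) (A₀ B₀ : ℂ[X]) : Prop where
  ne_zero : A₀ ≠ 0 ∨ B₀ ≠ 0
  on_curve : y₀ ^ 2 = 4 * x₀ ^ 3 - g₂ * x₀ - g₃
  solves : ∀ (U : Set ℂ) (y I₁ I₀ : ℂ → ℂ), IsBranch g₂ g₃ x₀ y₀ U y I₁ I₀ →
    ∀ x ∈ U, yD y (yD y (hkFun κ A₀ B₀ y I₁ I₀)) x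
      = ((ℓ : ℂ) * (ℓ + 1) * x + B) * hkFun κ A₀ B₀ y I₁ I₀ x

/-- The integration of the degree-`ℓ` Lamé equation on the elliptic curve is accomplished, for all
values of `B` outside the finite set `S`, in the framework of the Hermite–Krichever Ansatz by the
maps `(B, ν) ↦ (Bmap B, νmap B ν)` from `Γ_ℓ` to `Γ₁` and `(B, ν) ↦ κhat B * ν`.
A point `(B', ν')` of `Γ₁` stands for the point `(x₀, y₀) = (B', 2ν')` of the elliptic curve. -/
def HKIntegrates (ℓ : ℕ) (g₂ g₃ : ℂ) (Bmap : ℂ → ℂ) (νmap : ℂ → ℂ → ℂ) (κhat : ℂ → ℂ)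
    (S : Finset ℂ) : Prop :=
  ∀ B ν : ℂ, B ∉ S → OnSpectralCurve ℓ g₂ g₃ B ν →
    ∃ A₀ B₀ : ℂ[X], IsHKSolution ℓ g₂ g₃ B (Bmap B) (2 * νmap B ν) (κhat B * ν) A₀ B₀

/-! ## Jacobi elliptic and theta functions with parameter `m` -/

/-- First complete elliptic integral `K(m) = ∫₀^{π/2} (1 - m sin²θ)^{-1/2} dθ`
(principal branch). -/
def ellK (m : ℂ) : ℂ :=
  ∫ θ in (0 : ℝ)..(Real.pi / 2), (1 - m * (Real.sin θ : ℂ) ^ 2) ^ (-(1 / 2) : ℂ)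

/-- `τ = i K(1-m) / K(m)`, so that the nome is `exp (π i τ)`. -/
def ellTau (m : ℂ) : ℂ := I * ellK (1 - m) / ellK m

/-- Jacobi theta function `Θ(α|m) = θ₄(πα/2K) = ∑ (-1)ⁿ q^{n²} e^{2inπα/2K}`. -/
def Theta (m α : ℂ) : ℂ := jacobiTheta₂ (α / (2 * ellK m) + 1 / 2) (ellTau m)

/-- Jacobi eta function
`H(α|m) = θ₁(πα/2K) = -i ∑ (-1)ⁿ q^{(n+1/2)²} e^{i(2n+1)πα/2K}`. -/
def Eta (m α : ℂ) : ℂ :=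
  -I * exp (Real.pi * I * (α / (2 * ellK m)) + Real.pi * I * ellTau m / 4) *
    jacobiTheta₂ (α / (2 * ellK m) + 1 / 2 + ellTau m / 2) (ellTau m)

/-- `Θ₁(α|m) = Θ(α+K|m)`. -/
def Theta₁ (m α : ℂ) : ℂ := Theta m (α + ellK m)

/-- `H₁(α|m) = H(α+K|m)`. -/
def Eta₁ (m α : ℂ) : ℂ := Eta m (α + ellK m)

/-- Jacobi zeta function `Z = Θ'/Θ`. -/
def Zeta (m α : ℂ) : ℂ := deriv (Theta m) α / Theta m α

/-- `sn(α|m)`. -/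
def sn (m α : ℂ) : ℂ := Theta₁ m 0 / Eta₁ m 0 * (Eta m α / Theta m α)

/-- `cn(α|m)`. -/
def cn (m α : ℂ) : ℂ := Theta m 0 / Eta₁ m 0 * (Eta₁ m α / Theta m α)

/-- `dn(α|m)`. -/
def dn (m α : ℂ) : ℂ := Theta m 0 / Theta₁ m 0 * (Theta₁ m α / Theta m α)

/-! ## The Jacobi form of the Lamé equation

The poles of the potential `ℓ(ℓ+1) m sn²(α|m)` are exactly the zeros of `Θ(α|m)`. -/

/-- `Ψ` is a nonzero solution of `[-d²/dα² + ℓ(ℓ+1) m sn²(α|m)] Ψ = E Ψ`, analytic and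
single-valued on the complex plane with the poles of the potential removed. -/
structure IsLameSolution (ℓ : ℕ) (m E : ℂ) (Ψ : ℂ → ℂ) : Prop where
  analytic : ∀ α, Theta m α ≠ 0 → AnalyticAt ℂ Ψ α
  solves : ∀ α, Theta m α ≠ 0 →
    -deriv (deriv Ψ) α + (ℓ : ℂ) * (ℓ + 1) * m * sn m α ^ 2 * Ψ α = E * Ψ α
  nonzero : ∃ α, Theta m α ≠ 0 ∧ Ψ α ≠ 0

/-- `Ψ(α + 2K) = exp(i k (2K)) Ψ(α)`: the number `k` is a crystal momentum of `Ψ`. -/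
def HasMomentum (m : ℂ) (Ψ : ℂ → ℂ) (k : ℂ) : Prop :=
  ∀ α, Theta m α ≠ 0 → Ψ (α + 2 * ellK m) = exp (I * k * (2 * ellK m)) * Ψ α

/-- `Φ̃(α; α₀|m) = H(α-α₀|m)/Θ(α|m) · exp[α Z(α₀|m)]`. -/
def PhiJ (m α₀ : ℂ) : ℂ → ℂ := fun α =>
  Eta m (α - α₀) / Theta m α * exp (α * Zeta m α₀)

/-- `[𝒜̃(sn²) Φ̃(α;α₀|m) + 2 ℬ̃(sn²) Φ̃'(α;α₀|m)] exp(κα)`. -/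
def hkFunJ (m α₀ κ : ℂ) (A₀ B₀ : ℂ[X]) : ℂ → ℂ := fun α =>
  (A₀.eval (sn m α ^ 2) * PhiJ m α₀ α + 2 * B₀.eval (sn m α ^ 2) * deriv (PhiJ m α₀) α)
    * exp (κ * α)

/-! ## Conversion between the elliptic-curve form and the Jacobi form -/

/-- `g₂(m)`, in the normalization `e₁ - e₃ = 1`. -/
def g2J (m : ℂ) : ℂ := 4 * (m ^ 2 - m + 1) / 3

/-- `g₃(m)`, in the normalization `e₁ - e₃ = 1`. -/
def g3J (m : ℂ) : ℂ := 4 * (m - 2) * (2 * m - 1) * (m + 1) / 27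

/-- `B = -E + ⅓ ℓ(ℓ+1)(m+1)`. -/
def accB (ℓ : ℕ) (m E : ℂ) : ℂ := -E + 1 / 3 * ℓ * (ℓ + 1) * (m + 1)

/-- The Jacobi-form spectral polynomial `L̃_ℓ(E|m) = -L_ℓ(B; g₂(m), g₃(m))`. -/
def specJ (ℓ : ℕ) (m : ℂ) : ℂ[X] :=
  -(specFull ℓ (g2J m) (g3J m)).comp (C (1 / 3 * ℓ * (ℓ + 1) * (m + 1)) - X)

/-- `(E, ν̃)` is a finite point of the `ℓ`-th Jacobi-form spectral curve `Γ̃_ℓ(m)`.  It corresponds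
to the point `(B, ν) = (accB ℓ m E, iν̃)` of `Γ_ℓ`. -/
def OnSpectralCurveJ (ℓ : ℕ) (m E νt : ℂ) : Prop := νt ^ 2 = (specJ ℓ m).eval E

/-- The multi-valued `ℓ = 1` crystal momentum `k₁(E, ν̃|m) = -i Z(α₀|m) + π/2K`, modulo `π/K`,
where `dn²(α₀|m) = E - m` and `m sn(α₀|m) cn(α₀|m) dn(α₀|m) = iν̃`. -/
def kOne (m E νt : ℂ) : Set ℂ :=
  {k | ∃ (α₀ : ℂ) (n : ℤ), Theta m α₀ ≠ 0 ∧ dn m α₀ ^ 2 = E - m ∧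
    m * sn m α₀ * cn m α₀ * dn m α₀ = I * νt ∧
    k = -I * Zeta m α₀ + Real.pi / (2 * ellK m) + n * (Real.pi / ellK m)}

/-- `Ψ` is a Jacobi-form Hermite–Krichever solution, with energy `E`, attached to the point
`(E, ν̃)` of `Γ̃_ℓ(m)` by the maps `(B, ν) ↦ (x₀, y₀/2) = (Bmap B, νmap B ν)` and
`(B, ν) ↦ κ = κhat B * ν`.  The parametrization point `α₀` is related to `(x₀, y₀)` by
`x₀ = m sn²(α₀|m) - ⅓(m+1)` and `y₀ = 2m sn(α₀|m) cn(α₀|m) dn(α₀|m)`. -/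
def IsHKSolutionJ (ℓ : ℕ) (m : ℂ) (Bmap : ℂ → ℂ) (νmap : ℂ → ℂ → ℂ) (κhat : ℂ → ℂ)
    (E νt : ℂ) (Ψ : ℂ → ℂ) : Prop :=
  IsLameSolution ℓ m E Ψ ∧
  ∃ (α₀ : ℂ) (A₀ B₀ : ℂ[X]), Theta m α₀ ≠ 0 ∧
    Bmap (accB ℓ m E) = m * sn m α₀ ^ 2 - 1 / 3 * (m + 1) ∧
    2 * νmap (accB ℓ m E) (I * νt) = 2 * m * sn m α₀ * cn m α₀ * dn m α₀ ∧
    Ψ = hkFunJ m α₀ (κhat (accB ℓ m E) * (I * νt)) A₀ B₀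

/-- The multi-valued crystal momentum `k_ℓ(E, ν̃|m)`: all crystal momenta of the Hermite–Krichever
solutions attached to the point `(E, ν̃)`. -/
def kEll (ℓ : ℕ) (m : ℂ) (Bmap : ℂ → ℂ) (νmap : ℂ → ℂ → ℂ) (κhat : ℂ → ℂ) (E νt : ℂ) : Set ℂ :=
  {k | ∃ Ψ, IsHKSolutionJ ℓ m Bmap νmap κhat E νt Ψ ∧ HasMomentum m Ψ k}

/-- `𝓔_ℓ(E|m) = -B_ℓ(B; g₂(m), g₃(m)) + ⅔(m+1)`. -/
def redE (ℓ : ℕ) (Bmap : ℂ → ℂ → ℂ → ℂ) (E m : ℂ) : ℂ :=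
  -Bmap (accB ℓ m E) (g2J m) (g3J m) + 2 / 3 * (m + 1)

/-- `ν̃_ℓ(E, ν̃|m) = -i ν_ℓ(B, iν̃; g₂(m), g₃(m))`. -/
def redNu (ℓ : ℕ) (νmap : ℂ → ℂ → ℂ → ℂ → ℂ) (E νt m : ℂ) : ℂ :=
  -I * νmap (accB ℓ m E) (I * νt) (g2J m) (g3J m)

/-- `κ̂_ℓ(E|m) = κ̂_ℓ(B; g₂(m), g₃(m))`. -/
def redKappa (ℓ : ℕ) (κhat : ℂ → ℂ → ℂ → ℂ) (E m : ℂ) : ℂ :=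
  κhat (accB ℓ m E) (g2J m) (g3J m)

end Lame

end

/-!
The dispersion relation is read off from the Floquet multiplier of the Hermite–Krichever solutions.
The parameter `α` uniformizes the curve `y² = 4x³ - g₂x - g₃` by `x = m sn² α - (m+1)/3`,
`y = dx/dα`, so that `y d/dx` becomes `d/dα`, and `Φ̃` has the logarithmic derivative
`½ (y+y₀)/(x-x₀)` with respect to `α` (`deriv_PhiJ`), that is, `Φ̃` is a branch of `Φ`.  Hence a
Hermite–Krichever solution on the curve pulls back to a solution of the Jacobi form: the equation
is transported at the points where `x` is a local coordinate, and extends to the remaining ones by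
continuity (`isLameSolution_hkFunJ`).  As `sn²` and `Θ` have the period `2K` and
`H(α+2K) = -H(α)`, the solution is multiplied by `-exp (2K (Z(α₀) + κ))` under `α ↦ α + 2K`
(`hkFunJ_add_two_ellK`), and its crystal momenta are `-iZ(α₀) + π/2K - iκ` modulo `π/K`.  With
`κ = κ̂ i ν̃` this is `k₁ + κ̂ ν̃`.

The set of values is nonempty because every finite point of the curve has a parameter `α₀`
(`exists_jX_eq_jY_eq`).  It is a single coset because two parameters of one point differ by an
element `2K (j + nτ)` of the period lattice (`exists_int_of_jX_eq_jY_eq`), which changes `-iZ(α₀)`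
by `-nπ/K` (`Zeta_add_lattice`).

If `Ψ` is any solution with a crystal momentum and `Ψ'` an attached one, the Wronskian of the two is
constant on the plane without the poles of the potential, which is connected, and it has the product
of the two multipliers as its multiplier.  So either this product is `1`, and the momenta are
opposite modulo `π/K`, or the Wronskian vanishes and the solutions are proportional
(`momentum_eq_or_eq_neg`).  Conversely `Ψ(-α)` solves the same equation with the opposite momentum.

The facts on Jacobi functions used here have to hold for every complex `m ≠ 0, 1`, where `K(m)` is an
integral with the principal branch of the root and `τ = i K(1-m)/K(m)`.
* The integrands of `K(1-m)` and `K(m)` always enclose an angle of at most `π/2`, whence `K(m) ≠ 0`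
  and `Im τ > 0` (`ellK_re_pos`, `ellTau_im_pos`).
* All theta relations follow from one addition formula (`th3_add_mul_th3_sub`).  The zeros of `θ₁`
  are located by it: a zero `z₁` makes the orders of vanishing at `x + n z₁` an arithmetic
  progression in `n`, which forces `z₁` to be a quasi-period (`exists_int_of_th1_eq_zero`).
* The theta functions of nome `exp (π i τ)` have parameter `m` and quarter period `K(m)`
  (`jacobi_inversion`).  For imaginary `τ` the function `sn` inverts the real elliptic integral, and
  the transformation `τ ↦ -1/τ` gives `K(1-m)`; the identities continue analytically to the plane
  cut along `(-∞, 0]` and `[1, ∞)`, and by one-sided continuity of `K` to the cuts.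
-/

namespace Lame

open Complex Polynomial Filter Topology MeasureTheory
open scoped ComplexConjugate

/-! ### Theta functions and the basic addition formula -/

/-- The theta function `θ₃(z|τ)` with periods normalized to `1` and `τ`, as a function of `z`. -/
noncomputable def th3 (τ z : ℂ) : ℂ := jacobiTheta₂ z τ

/-- The theta function `θ₄(z|τ)`, so that `Theta m α = th4 (ellTau m) (α / (2 * ellK m))`. -/
noncomputable def th4 (τ z : ℂ) : ℂ := jacobiTheta₂ (z + 1 / 2) τ

/-- The theta function `θ₂(z|τ)`. -/
noncomputable def th2 (τ z : ℂ) : ℂ :=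
  exp (Real.pi * I * z + Real.pi * I * τ / 4) * jacobiTheta₂ (z + τ / 2) τ

/-- The theta function `θ₁(z|τ)`, so that `Eta m α = th1 (ellTau m) (α / (2 * ellK m))`. -/
noncomputable def th1 (τ z : ℂ) : ℂ :=
  -I * exp (Real.pi * I * z + Real.pi * I * τ / 4) * jacobiTheta₂ (z + 1 / 2 + τ / 2) τ

/-- `θ₃(2x|2τ)`, the first of two functions spanning the even theta functions of order two. -/
noncomputable def thA (τ x : ℂ) : ℂ := jacobiTheta₂ (2 * x) (2 * τ)

/-- `θ₂(2x|2τ)`, the second of two functions spanning the even theta functions of order two. -/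
noncomputable def thB (τ x : ℂ) : ℂ :=
  exp (2 * Real.pi * I * x + Real.pi * I * τ / 2) * jacobiTheta₂ (2 * x + τ) (2 * τ)

lemma summable_norm_jacobiTheta₂_term (z : ℂ) {τ : ℂ} (hτ : 0 < τ.im) :
    Summable fun n : ℤ => ‖jacobiTheta₂_term n z τ‖ := by
  exact ((summable_jacobiTheta₂_term_iff z τ).2 hτ).norm

lemma hasSum_jacobiTheta₂_mul (z w : ℂ) {τ : ℂ} (hτ : 0 < τ.im) :
    HasSum (fun p : ℤ × ℤ => jacobiTheta₂_term p.1 z τ * jacobiTheta₂_term p.2 w τ)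
      (jacobiTheta₂ z τ * jacobiTheta₂ w τ) := by
  have h1 := summable_norm_jacobiTheta₂_term z hτ
  have h2 := summable_norm_jacobiTheta₂_term w hτ
  rw [jacobiTheta₂, jacobiTheta₂, tsum_mul_tsum_of_summable_norm h1 h2]
  exact (summable_mul_of_summable_norm h1 h2).hasSum

/-- The basic addition formula, from which all other theta relations follow: in the double series
for the left side, the pairs of summation indices of even and of odd sum are collected. -/
theorem th3_add_mul_th3_sub {τ : ℂ} (hτ : 0 < τ.im) (x y : ℂ) :
    th3 τ (x + y) * th3 τ (x - y) = thA τ x * thA τ y + thB τ x * thB τ y := by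
  have hτ2 : 0 < (2 * τ).im := by simpa using hτ
  set f : ℤ × ℤ → ℂ :=
    fun p => jacobiTheta₂_term p.1 (x + y) τ * jacobiTheta₂_term p.2 (x - y) τ with hf
  let s : Set (ℤ × ℤ) := {p | Even (p.1 + p.2)}
  let e0 : ℤ × ℤ → ℤ × ℤ := fun p => (p.1 + p.2, p.1 - p.2)
  let e1 : ℤ × ℤ → ℤ × ℤ := fun p => (p.1 + p.2 + 1, p.1 - p.2)
  have i0 : Function.Injective e0 := by
    rintro ⟨a, b⟩ ⟨c, d⟩ h
    simp only [e0, Prod.mk.injEq] at h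
    ext <;> simp <;> omega
  have i1 : Function.Injective e1 := by
    rintro ⟨a, b⟩ ⟨c, d⟩ h
    simp only [e1, Prod.mk.injEq] at h
    ext <;> simp <;> omega
  have hc : IsCompl (Set.range e0) (Set.range e1) := by
    rw [isCompl_iff]
    constructor
    · rw [Set.disjoint_iff]
      rintro p ⟨⟨⟨a, b⟩, rfl⟩, ⟨⟨c, d⟩, h⟩⟩
      simp only [e0, e1, Prod.mk.injEq] at h
      omega
    · rw [codisjoint_iff_le_sup]
      rintro ⟨a, b⟩ -
      rcases Int.even_or_odd' (a + b) with ⟨c, h | h⟩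
      · left
        exact ⟨(c, a - c), by simp only [e0, Prod.mk.injEq]; omega⟩
      · right
        exact ⟨(c, a - c - 1), by simp only [e1, Prod.mk.injEq]; omega⟩
  have h0 : HasSum (f ∘ e0) (thA τ x * thA τ y) := by
    refine (hasSum_jacobiTheta₂_mul (2 * x) (2 * y) hτ2).congr_fun ?_
    rintro ⟨r, q⟩
    simp only [hf, e0, Function.comp, jacobiTheta₂_term, ← Complex.exp_add]
    congr 1
    push_cast
    ring
  have h1 : HasSum (f ∘ e1) (thB τ x * thB τ y) := by
    have := (hasSum_jacobiTheta₂_mul (2 * x + τ) (2 * y + τ) hτ2).mul_left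
      (exp (2 * Real.pi * I * x + Real.pi * I * τ / 2) *
        exp (2 * Real.pi * I * y + Real.pi * I * τ / 2))
    convert! this using 1
    · ext ⟨r, q⟩
      simp only [hf, e1, Function.comp, jacobiTheta₂_term, ← Complex.exp_add]
      congr 1
      push_cast
      ring
    · simp only [thB]; ring
  have := HasSum.add_isCompl hc (i0.hasSum_range_iff.2 h0) (i1.hasSum_range_iff.2 h1)
  exact (hasSum_jacobiTheta₂_mul (x + y) (x - y) hτ).unique this

/-! ### Quasi-periodicity and parity -/

lemma thA_add_half (τ x : ℂ) : thA τ (x + 1 / 2) = thA τ x := by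
  rw [thA, thA, ← jacobiTheta₂_add_left (2 * x)]; congr 1; ring

lemma thB_add_half (τ x : ℂ) : thB τ (x + 1 / 2) = -thB τ x := by
  rw [thB, thB, show 2 * (x + 1 / 2) + τ = 2 * x + τ + 1 by ring, jacobiTheta₂_add_left,
    show 2 * Real.pi * I * (x + 1 / 2) + Real.pi * I * τ / 2 =
      2 * Real.pi * I * x + Real.pi * I * τ / 2 + Real.pi * I by ring, Complex.exp_add,
    Complex.exp_pi_mul_I]
  ring

lemma thA_add_tau_half (τ x : ℂ) :
    thA τ (x + τ / 2) = exp (-(2 * Real.pi * I * x) - Real.pi * I * τ / 2) * thB τ x := by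
  rw [thA, thB, ← mul_assoc, ← Complex.exp_add, show 2 * (x + τ / 2) = 2 * x + τ by ring]
  ring_nf
  simp

lemma thB_add_tau_half (τ x : ℂ) :
    thB τ (x + τ / 2) = exp (-(2 * Real.pi * I * x) - Real.pi * I * τ / 2) * thA τ x := by
  rw [thA, thB, show 2 * (x + τ / 2) + τ = 2 * x + 2 * τ by ring, jacobiTheta₂_add_left',
    ← mul_assoc, ← Complex.exp_add]
  congr 2
  ring

lemma thA_neg (τ x : ℂ) : thA τ (-x) = thA τ x := by
  rw [thA, thA, ← jacobiTheta₂_neg_left]; congr 1; ring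

lemma thA_add_one (τ x : ℂ) : thA τ (x + 1) = thA τ x := by
  rw [show x + 1 = x + 1 / 2 + 1 / 2 by ring, thA_add_half, thA_add_half]

lemma thB_add_one (τ x : ℂ) : thB τ (x + 1) = thB τ x := by
  rw [show x + 1 = x + 1 / 2 + 1 / 2 by ring, thB_add_half, thB_add_half, neg_neg]

lemma thA_add_tau (τ x : ℂ) :
    thA τ (x + τ) = exp (-(4 * Real.pi * I * x) - 2 * Real.pi * I * τ) * thA τ x := by
  rw [show x + τ = x + τ / 2 + τ / 2 by ring, thA_add_tau_half, thB_add_tau_half, ← mul_assoc,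
    ← Complex.exp_add]
  congr 2
  ring

lemma thB_add_tau (τ x : ℂ) :
    thB τ (x + τ) = exp (-(4 * Real.pi * I * x) - 2 * Real.pi * I * τ) * thB τ x := by
  rw [show x + τ = x + τ / 2 + τ / 2 by ring, thB_add_tau_half, thA_add_tau_half, ← mul_assoc,
    ← Complex.exp_add]
  congr 2
  ring

lemma th3_add_half (τ z : ℂ) : th3 τ (z + 1 / 2) = th4 τ z := rfl

lemma th4_add_half (τ z : ℂ) : th4 τ (z + 1 / 2) = th3 τ z := by
  rw [th4, th3, ← jacobiTheta₂_add_left z]; congr 1; ring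

lemma th1_add_half (τ z : ℂ) : th1 τ (z + 1 / 2) = th2 τ z := by
  rw [th1, th2, show z + 1 / 2 + 1 / 2 + τ / 2 = z + τ / 2 + 1 by ring, jacobiTheta₂_add_left,
    show Real.pi * I * (z + 1 / 2) + Real.pi * I * τ / 4 =
      Real.pi * I * z + Real.pi * I * τ / 4 + Real.pi / 2 * I by ring, Complex.exp_add,
    Complex.exp_pi_div_two_mul_I]
  ring_nf
  simp

lemma th1_add_one (τ z : ℂ) : th1 τ (z + 1) = -th1 τ z := by
  rw [th1, th1, show z + 1 + 1 / 2 + τ / 2 = z + 1 / 2 + τ / 2 + 1 by ring, jacobiTheta₂_add_left,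
    show Real.pi * I * (z + 1) + Real.pi * I * τ / 4 =
      Real.pi * I * z + Real.pi * I * τ / 4 + Real.pi * I by ring, Complex.exp_add,
    Complex.exp_pi_mul_I]
  ring

lemma th4_add_one (τ z : ℂ) : th4 τ (z + 1) = th4 τ z := by
  rw [show z + 1 = z + 1 / 2 + 1 / 2 by ring, th4_add_half, th3_add_half]

lemma th2_add_half (τ z : ℂ) : th2 τ (z + 1 / 2) = -th1 τ z := by
  rw [← th1_add_half, ← th1_add_one]; congr 1; ring

lemma th1_add_tau (τ z : ℂ) :
    th1 τ (z + τ) = -exp (-(2 * Real.pi * I * z) - Real.pi * I * τ) * th1 τ z := by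
  have e : exp (Real.pi * I * (z + τ) + Real.pi * I * τ / 4) *
      exp (-Real.pi * I * (τ + 2 * (z + 1 / 2 + τ / 2))) =
      -(exp (-(2 * Real.pi * I * z) - Real.pi * I * τ) *
        exp (Real.pi * I * z + Real.pi * I * τ / 4)) := by
    rw [← Complex.exp_add, ← Complex.exp_add, ← Complex.exp_sub_pi_mul_I]
    congr 1
    ring
  rw [th1, th1, show z + τ + 1 / 2 + τ / 2 = z + 1 / 2 + τ / 2 + τ by ring, jacobiTheta₂_add_left']
  linear_combination (-I * jacobiTheta₂ (z + 1 / 2 + τ / 2) τ) * e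

lemma th4_add_tau (τ z : ℂ) :
    th4 τ (z + τ) = -exp (-(2 * Real.pi * I * z) - Real.pi * I * τ) * th4 τ z := by
  rw [th4, th4, show z + τ + 1 / 2 = z + 1 / 2 + τ by ring, jacobiTheta₂_add_left',
    show -Real.pi * I * (τ + 2 * (z + 1 / 2)) =
      (-(2 * Real.pi * I * z) - Real.pi * I * τ) + (-(Real.pi * I))
      by ring, Complex.exp_add, Complex.exp_neg (Real.pi * I),
      Complex.exp_pi_mul_I]
  norm_num

lemma th4_add_tau_half (τ z : ℂ) :
    th4 τ (z + τ / 2) = I * exp (-(Real.pi * I * z) - Real.pi * I * τ / 4) * th1 τ z := by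
  have : exp (-(Real.pi * I * z) - Real.pi * I * τ / 4) *
      exp (Real.pi * I * z + Real.pi * I * τ / 4) = 1 := by
    rw [← Complex.exp_add, ← Complex.exp_zero]
    congr 1
    ring
  rw [th4, th1, show z + τ / 2 + 1 / 2 = z + 1 / 2 + τ / 2 by ring]
  linear_combination (-jacobiTheta₂ (z + 1 / 2 + τ / 2) τ) * this +
    jacobiTheta₂ (z + 1 / 2 + τ / 2) τ * exp (-(Real.pi * I * z) - Real.pi * I * τ / 4) *
      exp (Real.pi * I * z + Real.pi * I * τ / 4) * (I_sq)

lemma th3_neg (τ z : ℂ) : th3 τ (-z) = th3 τ z := jacobiTheta₂_neg_left z τ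

lemma th4_neg (τ z : ℂ) : th4 τ (-z) = th4 τ z := by
  rw [th4, th4, ← jacobiTheta₂_neg_left, ← jacobiTheta₂_add_left]
  congr 1
  ring

lemma th2_neg (τ z : ℂ) : th2 τ (-z) = th2 τ z := by
  rw [th2, th2, ← jacobiTheta₂_neg_left, show z + τ / 2 = -(-z + τ / 2) + τ by ring,
    jacobiTheta₂_add_left', ← mul_assoc, ← Complex.exp_add]
  congr 2
  ring

lemma th1_neg (τ z : ℂ) : th1 τ (-z) = -th1 τ z := by
  have h := th2_neg τ (z + 1 / 2)
  have h1 := th1_add_one τ (-z - 1)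
  rw [show -(z + 1 / 2) = -z - 1 + 1 / 2 by ring, th2_add_half, th2_add_half] at h
  rw [sub_add_cancel] at h1
  rw [h1, h]

lemma th1_zero (τ : ℂ) : th1 τ 0 = 0 := by
  have := th1_neg τ 0
  rw [neg_zero] at this
  exact self_eq_neg.1 this

/-! ### Addition formulas -/

lemma th4_add_mul_th4_sub {τ : ℂ} (hτ : 0 < τ.im) (x y : ℂ) :
    th4 τ (x + y) * th4 τ (x - y) = thA τ x * thA τ y - thB τ x * thB τ y := by
  rw [← th3_add_half, ← th3_add_half, show x + y + 1 / 2 = (x + 1 / 2) + y by ring,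
    show x - y + 1 / 2 = (x + 1 / 2) - y by ring, th3_add_mul_th3_sub hτ, thA_add_half,
    thB_add_half]
  ring

lemma th2_eq (τ z : ℂ) :
    th2 τ z = exp (Real.pi * I * z + Real.pi * I * τ / 4) * th3 τ (z + τ / 2) := rfl

lemma th2_add_mul_th2_sub {τ : ℂ} (hτ : 0 < τ.im) (x y : ℂ) :
    th2 τ (x + y) * th2 τ (x - y) = thB τ x * thA τ y + thA τ x * thB τ y := by
  have e : exp (Real.pi * I * (x + y) + Real.pi * I * τ / 4) *
      exp (Real.pi * I * (x - y) + Real.pi * I * τ / 4) *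
      exp (-(2 * Real.pi * I * x) - Real.pi * I * τ / 2) = 1 := by
    rw [← Complex.exp_add, ← Complex.exp_add, ← Complex.exp_zero]
    congr 1
    ring
  rw [th2_eq, th2_eq, mul_mul_mul_comm, show x + y + τ / 2 = (x + τ / 2) + y by ring,
    show x - y + τ / 2 = (x + τ / 2) - y by ring, th3_add_mul_th3_sub hτ, thA_add_tau_half,
    thB_add_tau_half]
  linear_combination (thB τ x * thA τ y + thA τ x * thB τ y) * e

lemma th1_add_mul_th1_sub {τ : ℂ} (hτ : 0 < τ.im) (x y : ℂ) :
    th1 τ (x + y) * th1 τ (x - y) = thA τ x * thB τ y - thB τ x * thA τ y := by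
  have h := th2_add_mul_th2_sub hτ (x + 1 / 2) y
  rw [show x + 1 / 2 + y = x + y + 1 / 2 by ring, show x + 1 / 2 - y = x - y + 1 / 2 by ring,
    th2_add_half, th2_add_half, thA_add_half, thB_add_half] at h
  linear_combination h

lemma th3_sq {τ : ℂ} (hτ : 0 < τ.im) (x : ℂ) :
    th3 τ x ^ 2 = thA τ x * thA τ 0 + thB τ x * thB τ 0 := by
  rw [← th3_add_mul_th3_sub hτ, add_zero, sub_zero, sq]

lemma th4_sq {τ : ℂ} (hτ : 0 < τ.im) (x : ℂ) :
    th4 τ x ^ 2 = thA τ x * thA τ 0 - thB τ x * thB τ 0 := by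
  rw [← th4_add_mul_th4_sub hτ, add_zero, sub_zero, sq]

lemma th2_sq {τ : ℂ} (hτ : 0 < τ.im) (x : ℂ) :
    th2 τ x ^ 2 = thB τ x * thA τ 0 + thA τ x * thB τ 0 := by
  rw [← th2_add_mul_th2_sub hτ, add_zero, sub_zero, sq]

lemma th1_sq {τ : ℂ} (hτ : 0 < τ.im) (x : ℂ) :
    th1 τ x ^ 2 = thA τ x * thB τ 0 - thB τ x * thA τ 0 := by
  rw [← th1_add_mul_th1_sub hτ, add_zero, sub_zero, sq]

/-- The addition formula behind the factorization of `sn² α - sn² β`. -/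
lemma th1_add_mul_th1_sub' {τ : ℂ} (hτ : 0 < τ.im) (x y : ℂ) :
    th1 τ (x + y) * th1 τ (x - y) * th4 τ 0 ^ 2 =
      th1 τ x ^ 2 * th4 τ y ^ 2 - th4 τ x ^ 2 * th1 τ y ^ 2 := by
  rw [th1_add_mul_th1_sub hτ]
  simp only [th1_sq hτ, th4_sq hτ]
  ring

/-! ### Quarter-period shifts -/

/-- `θ₃(2x + τ/2|2τ)` made nearly periodic by an exponential factor.  The odd and the even part of
this function are proportional to `θ₁θ₄` and `θ₂θ₃`. -/
noncomputable def thU (τ x : ℂ) : ℂ :=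
  exp (Real.pi * I * x + Real.pi * I * τ / 8) * thA τ (x + τ / 4)

lemma thU_neg (τ x : ℂ) :
    thU τ (-x) = exp (Real.pi * I * x + Real.pi * I * τ / 8) * thB τ (x + τ / 4) := by
  rw [show x + τ / 4 = (x - τ / 4) + τ / 2 by ring, thB_add_tau_half, ← thA_neg, thU,
    ← mul_assoc, ← Complex.exp_add, show -x + τ / 4 = -(x - τ / 4) by ring]
  congr 2
  ring

lemma th2_add_mul_th3_sub {τ : ℂ} (hτ : 0 < τ.im) (x y : ℂ) :
    th2 τ (x + y) * th3 τ (x - y) = thU τ x * thU τ y + thU τ (-x) * thU τ (-y) := by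
  have e : exp (Real.pi * I * (x + y) + Real.pi * I * τ / 4) =
      exp (Real.pi * I * x + Real.pi * I * τ / 8) *
        exp (Real.pi * I * y + Real.pi * I * τ / 8) := by
    rw [← Complex.exp_add]
    congr 1
    ring
  rw [th2_eq, mul_assoc, show x + y + τ / 2 = (x + τ / 4) + (y + τ / 4) by ring,
    show x - y = (x + τ / 4) - (y + τ / 4) by ring, th3_add_mul_th3_sub hτ, thU_neg, thU_neg, thU,
    thU, e]
  ring

lemma th1_add_mul_th4_sub {τ : ℂ} (hτ : 0 < τ.im) (x y : ℂ) :
    th1 τ (x + y) * th4 τ (x - y) = -I * (thU τ x * thU τ y - thU τ (-x) * thU τ (-y)) := by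
  have h := th2_add_mul_th3_sub hτ (x + 1 / 2) y
  rw [show x + 1 / 2 + y = x + y + 1 / 2 by ring, show x + 1 / 2 - y = x - y + 1 / 2 by ring,
    th2_add_half, th3_add_half] at h
  have e : exp (Real.pi * I * (x + 1 / 2) + Real.pi * I * τ / 8) =
      I * exp (Real.pi * I * x + Real.pi * I * τ / 8) := by
    rw [show Real.pi * I * (x + 1 / 2) + Real.pi * I * τ / 8 =
      Real.pi / 2 * I + (Real.pi * I * x + Real.pi * I * τ / 8) by ring, Complex.exp_add,
      Complex.exp_pi_div_two_mul_I]
  have h1 : thU τ (x + 1 / 2) = I * thU τ x := by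
    rw [thU, thU, show x + 1 / 2 + τ / 4 = x + τ / 4 + 1 / 2 by ring, thA_add_half, e, mul_assoc]
  have h2 : thU τ (-(x + 1 / 2)) = -I * thU τ (-x) := by
    rw [thU_neg, thU_neg, show x + 1 / 2 + τ / 4 = x + τ / 4 + 1 / 2 by ring, thB_add_half, e]
    ring
  rw [h1, h2] at h
  linear_combination -h

/-! ### Entire functions with two quasi-periods, and the zeros of the theta functions -/

lemma differentiable_jacobiTheta₂ {τ : ℂ} (hτ : 0 < τ.im) :
    Differentiable ℂ fun z => jacobiTheta₂ z τ :=
  fun z => differentiableAt_jacobiTheta₂_fst z hτ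

lemma differentiable_th4 {τ : ℂ} (hτ : 0 < τ.im) : Differentiable ℂ (th4 τ) := by
  exact (differentiable_jacobiTheta₂ hτ).comp (differentiable_id.add_const (1 / 2 : ℂ))

lemma differentiable_th2 {τ : ℂ} (hτ : 0 < τ.im) : Differentiable ℂ (th2 τ) := by
  have := (differentiable_jacobiTheta₂ hτ).comp (differentiable_id.add_const (τ / 2 : ℂ))
  exact Differentiable.mul (by fun_prop) this

lemma differentiable_th1 {τ : ℂ} (hτ : 0 < τ.im) : Differentiable ℂ (th1 τ) := by
  have : th1 τ = fun z => th2 τ (z - 1 / 2) := by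
    ext z
    rw [← th1_add_half, sub_add_cancel]
  rw [this]
  exact (differentiable_th2 hτ).comp (differentiable_id.sub_const (1 / 2 : ℂ))

lemma two_mul_im_pos {τ : ℂ} (hτ : 0 < τ.im) : 0 < (2 * τ).im := by simpa using hτ

lemma differentiable_thA {τ : ℂ} (hτ : 0 < τ.im) : Differentiable ℂ (thA τ) := by
  exact (differentiable_jacobiTheta₂ (two_mul_im_pos hτ)).comp
    (differentiable_id.const_mul (2 : ℂ))

lemma differentiable_thB {τ : ℂ} (hτ : 0 < τ.im) : Differentiable ℂ (thB τ) := by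
  have := (differentiable_jacobiTheta₂ (two_mul_im_pos hτ)).comp
    ((differentiable_id.const_mul (2 : ℂ)).add_const τ)
  exact Differentiable.mul (by fun_prop) this

lemma differentiable_thU {τ : ℂ} (hτ : 0 < τ.im) : Differentiable ℂ (thU τ) := by
  have := (differentiable_thA hτ).comp (differentiable_id.add_const (τ / 4))
  exact Differentiable.mul (by fun_prop) this

/-- Liouville's theorem for elliptic functions without poles. -/
theorem eq_of_doubly_periodic {τ : ℂ} (hτ : 0 < τ.im) {f : ℂ → ℂ} (hf : Differentiable ℂ f)
    (h1 : ∀ z, f (z + 1) = f z) (h2 : ∀ z, f (z + τ) = f z) (z w : ℂ) : f z = f w := by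
  refine hf.apply_eq_apply_of_bounded ?_ z w
  let g : ℝ × ℝ → ℂ := fun p => f (p.1 + p.2 * τ)
  have hg : Continuous g := hf.continuous.comp (by fun_prop)
  have hK : IsCompact (g '' (Set.Icc 0 1 ×ˢ Set.Icc 0 1)) :=
    (isCompact_Icc.prod isCompact_Icc).image hg
  refine hK.isBounded.subset ?_
  rintro _ ⟨z, rfl⟩
  set t : ℝ := z.im / τ.im with ht
  set s : ℝ := z.re - t * τ.re with hs
  have hz : z = s + t * τ := by
    apply Complex.ext
    · simp [hs]
    · simp [ht, hτ.ne']
  refine ⟨(Int.fract s, Int.fract t), ⟨⟨Int.fract_nonneg _, (Int.fract_lt_one _).le⟩,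
    ⟨Int.fract_nonneg _, (Int.fract_lt_one _).le⟩⟩, ?_⟩
  have p1 : Function.Periodic f 1 := h1
  have p2 : Function.Periodic f τ := h2
  simp only [g]
  rw [← p1.int_mul ⌊s⌋, ← p2.int_mul ⌊t⌋]
  congr 1
  conv_rhs => rw [hz]
  rw [Int.fract, Int.fract]
  push_cast
  ring

/-- An entire function without zeros that has a multiplier at `1` and an exponential multiplier at
`τ` is an exponential, and its multiplier at `τ` is constant: the logarithmic derivative has an
elliptic derivative without poles. -/
theorem eq_exp_of_quasi_periodic {τ : ℂ} (hτ : 0 < τ.im) {F : ℂ → ℂ} (hF : Differentiable ℂ F)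
    (h0 : ∀ z, F z ≠ 0) {c a b : ℂ} (h1 : ∀ z, F (z + 1) = c * F z)
    (h2 : ∀ z, F (z + τ) = exp (a * z + b) * F z) :
    a = 0 ∧ ∃ d, ∀ z, F z = F 0 * exp (d * z) := by
  have hc : c ≠ 0 := by
    rintro rfl
    exact h0 (0 + 1) (by rw [h1, zero_mul])
  have hF' : Differentiable ℂ (deriv F) := hF.deriv
  set L : ℂ → ℂ := fun z => deriv F z / F z with hLdef
  have hL : Differentiable ℂ L := hF'.div hF h0
  have d1 : ∀ z, deriv F (z + 1) = c * deriv F z := by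
    intro z
    rw [← deriv_comp_add_const, ← deriv_const_mul _ (hF z)]
    congr 1
    ext w
    exact h1 w
  have d2 : ∀ z, deriv F (z + τ) = exp (a * z + b) * (a * F z + deriv F z) := by
    intro z
    rw [← deriv_comp_add_const, show (fun w => F (w + τ)) = fun w => exp (a * w + b) * F w from
      funext h2]
    have : HasDerivAt (fun w => exp (a * w + b)) (exp (a * z + b) * a) z := by
      simpa using (((hasDerivAt_id z).const_mul a).add_const b).cexp
    rw [(this.fun_mul (hF z).hasDerivAt).deriv]
    ring
  have L1 : ∀ z, L (z + 1) = L z := by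
    intro z
    simp only [hLdef]
    rw [d1, h1, mul_div_mul_left _ _ hc]
  have L2 : ∀ z, L (z + τ) = L z + a := by
    intro z
    simp only [hLdef]
    rw [d2, h2, mul_div_mul_left _ _ (Complex.exp_ne_zero _)]
    field_simp [h0 z]
    ring
  have hL' : ∀ z w, deriv L z = deriv L w := by
    refine eq_of_doubly_periodic hτ hL.deriv (fun z => ?_) (fun z => ?_)
    · rw [← deriv_comp_add_const, funext L1]
    · rw [← deriv_comp_add_const, funext L2, deriv_add_const]
  have hlin : ∀ z, L z = L 0 + deriv L 0 * z := by
    intro z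
    have hd : Differentiable ℂ fun w => L w - deriv L 0 * w := by fun_prop
    have := is_const_of_deriv_eq_zero hd (fun w => by
      rw [((hL w).hasDerivAt.fun_sub ((hasDerivAt_id' w).const_mul _)).deriv, hL' w 0]; simp) z 0
    simp only [mul_zero, sub_zero] at this
    linear_combination this
  have s0 : deriv L 0 = 0 := by
    have e1 := L1 0
    rw [zero_add, hlin 1] at e1
    linear_combination e1
  have hconst : ∀ z, L z = L 0 := fun z => by rw [hlin, s0]; ring
  refine ⟨?_, L 0, fun z => ?_⟩
  · have := L2 0
    rw [hconst (0 + τ)] at this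
    linear_combination -this
  · have hE : ∀ w, HasDerivAt (fun w => F w * exp (-(L 0 * w))) 0 w := by
      intro w
      have e : HasDerivAt (fun w => exp (-(L 0 * w))) (exp (-(L 0 * w)) * -(L 0)) w := by
        simpa using ((hasDerivAt_id w).const_mul (L 0)).neg.cexp
      convert! (hF w).hasDerivAt.mul e using 1
      have : deriv F w = L 0 * F w := by
        rw [← hconst w, hLdef]
        field_simp [h0 w]
      rw [this]
      ring
    have := is_const_of_deriv_eq_zero (fun w => (hE w).differentiableAt) (fun w => (hE w).deriv)
      z 0
    simp only [mul_zero, neg_zero, Complex.exp_zero, mul_one] at this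
    rw [← this, mul_assoc, ← Complex.exp_add]
    simp

/-- Entire functions with the same zeros, with multiplicity, differ by a factor that is entire and
has no zeros. -/
lemma exists_entire_quotient {f g : ℂ → ℂ} (hf : Differentiable ℂ f) (hg : Differentiable ℂ g)
    (hg0 : ∀ z, analyticOrderAt g z ≠ ⊤)
    (hfg : ∀ z, analyticOrderAt f z = analyticOrderAt g z) :
    ∃ φ : ℂ → ℂ, Differentiable ℂ φ ∧ (∀ z, φ z ≠ 0) ∧ ∀ z, f z = φ z * g z := by
  have af : ∀ z, AnalyticAt ℂ f z := fun z => hf.analyticAt z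
  have ag : ∀ z, AnalyticAt ℂ g z := fun z => hg.analyticAt z
  have hm : MeromorphicOn (f / g) Set.univ :=
    fun z _ => (af z).meromorphicAt.div (ag z).meromorphicAt
  set φ := toMeromorphicNFOn (f / g) Set.univ with hφ
  have hNF : ∀ z, MeromorphicNFAt φ z :=
    fun z => meromorphicNFOn_toMeromorphicNFOn (f / g) Set.univ (Set.mem_univ z)
  have hev : ∀ z, φ =ᶠ[𝓝[≠] z] f / g :=
    fun z => hm.toMeromorphicNFOn_eq_self_on_nhdsNE (Set.mem_univ z)
  have hord : ∀ z, meromorphicOrderAt φ z = 0 := by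
    intro z
    rw [meromorphicOrderAt_congr (hev z), div_eq_mul_inv,
      meromorphicOrderAt_mul (af z).meromorphicAt (ag z).meromorphicAt.inv, meromorphicOrderAt_inv,
      (af z).meromorphicOrderAt_eq, (ag z).meromorphicOrderAt_eq, hfg z]
    obtain ⟨n, hn⟩ := ENat.ne_top_iff_exists.1 (hg0 z)
    rw [← hn]
    change ((n : ℤ) : WithTop ℤ) + -((n : ℤ) : WithTop ℤ) = 0
    rw [← WithTop.LinearOrderedAddCommGroup.coe_neg, ← WithTop.coe_add]
    simp
  have han : ∀ z, AnalyticAt ℂ φ z := fun z =>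
    (hNF z).meromorphicOrderAt_nonneg_iff_analyticAt.1 (hord z).ge
  refine ⟨φ, fun z => (han z).differentiableAt,
    fun z => (hNF z).meromorphicOrderAt_eq_zero_iff.1 (hord z), fun z => ?_⟩
  have hgne : ∀ᶠ w in 𝓝[≠] z, g w ≠ 0 := by
    rcases (ag z).eventually_eq_zero_or_eventually_ne_zero with h | h
    · exact absurd (analyticOrderAt_eq_top.2 h) (hg0 z)
    · exact h
  have : ∀ᶠ w in 𝓝[≠] z, f w = φ w * g w := by
    filter_upwards [hev z, hgne] with w hw hw'
    rw [hw, Pi.div_apply, div_mul_cancel₀ _ hw']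
  have t1 : Tendsto f (𝓝[≠] z) (𝓝 (f z)) := (hf z).continuousAt.tendsto.mono_left
    nhdsWithin_le_nhds
  have t2 : Tendsto (fun w => φ w * g w) (𝓝[≠] z) (𝓝 (φ z * g z)) :=
    ((han z).continuousAt.mul (hg z).continuousAt).tendsto.mono_left nhdsWithin_le_nhds
  exact tendsto_nhds_unique (t1.congr' this) t2

lemma thA_eq_zero_of_th3 {τ : ℂ} (hτ : 0 < τ.im) (h : ∀ z, th3 τ z = 0) (z : ℂ) :
    th3 (2 * τ) z = 0 := by
  have h3 := th3_add_mul_th3_sub hτ (z / 2) (z / 2)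
  have h4 := th4_add_mul_th4_sub hτ (z / 2) (z / 2)
  rw [h, zero_mul] at h3
  rw [← th3_add_half, h, zero_mul] at h4
  have : thA τ (z / 2) * thA τ (z / 2) = 0 := by linear_combination -(h3 + h4) / 2
  have := mul_self_eq_zero.1 this
  rwa [thA, mul_div_cancel₀ _ two_ne_zero] at this

/-- The theta function does not vanish identically: otherwise it would vanish identically for all
`2ⁿτ`, but its value at `0` tends to `1` as `τ → i∞`. -/
lemma exists_th3_ne_zero {τ : ℂ} (hτ : 0 < τ.im) : ∃ z, th3 τ z ≠ 0 := by
  by_contra! h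
  have hn : ∀ n : ℕ, 0 < (2 ^ n * τ).im ∧ ∀ z, th3 (2 ^ n * τ) z = 0 := by
    intro n
    induction n with
    | zero => simpa using ⟨hτ, h⟩
    | succ n ih =>
      rw [pow_succ', mul_assoc]
      exact ⟨two_mul_im_pos ih.1, thA_eq_zero_of_th3 ih.1 ih.2⟩
  have him : ∀ n : ℕ, (2 ^ n * τ).im = 2 ^ n * τ.im := by
    intro n
    have : ((2 : ℂ) ^ n) = ((2 ^ n : ℝ) : ℂ) := by push_cast; rfl
    rw [this, Complex.im_ofReal_mul]
  have hb : ∀ n : ℕ, (1 : ℝ) ≤ 2 / (1 - Real.exp (-Real.pi * (2 ^ n * τ.im))) *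
      Real.exp (-Real.pi * (2 ^ n * τ.im)) := by
    intro n
    have := norm_jacobiTheta_sub_one_le (hn n).1
    rw [jacobiTheta_eq_jacobiTheta₂, ← th3, (hn n).2, him] at this
    simpa using this
  have ht : Tendsto (fun n : ℕ => Real.exp (-Real.pi * (2 ^ n * τ.im))) atTop (𝓝 0) := by
    refine Real.tendsto_exp_atBot.comp ?_
    refine Tendsto.const_mul_atTop_of_neg (by linarith [Real.pi_pos]) ?_
    exact (tendsto_pow_atTop_atTop_of_one_lt one_lt_two).atTop_mul_const hτ
  have ht2 : Tendsto (fun n : ℕ => 2 / (1 - Real.exp (-Real.pi * (2 ^ n * τ.im))) *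
      Real.exp (-Real.pi * (2 ^ n * τ.im))) atTop (𝓝 (2 / (1 - 0) * 0)) :=
    (tendsto_const_nhds.div (tendsto_const_nhds.sub ht) (by norm_num)).mul ht
  rw [mul_zero] at ht2
  exact absurd (ge_of_tendsto' ht2 hb) (by norm_num)

lemma exists_th1_ne_zero {τ : ℂ} (hτ : 0 < τ.im) : ∃ z, th1 τ z ≠ 0 := by
  by_contra! h
  obtain ⟨z, hz⟩ := exists_th3_ne_zero hτ
  apply hz
  rw [← th4_add_half, show z + 1 / 2 = (z + 1 / 2 - τ / 2) + τ / 2 by ring, th4_add_tau_half, h,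
    mul_zero]

lemma analyticOrderAt_th1_ne_top {τ : ℂ} (hτ : 0 < τ.im) (z : ℂ) :
    analyticOrderAt (th1 τ) z ≠ ⊤ := by
  intro h
  obtain ⟨w, hw⟩ := exists_th1_ne_zero hτ
  have := AnalyticOnNhd.eqOn_zero_of_preconnected_of_eventuallyEq_zero
    (fun x _ => (differentiable_th1 hτ).analyticAt x) isPreconnected_univ (Set.mem_univ z)
    (analyticOrderAt_eq_top.1 h)
  exact hw (this (Set.mem_univ w))

/-- A two-sided arithmetic progression of nonnegative integers is constant. -/
lemma eq_of_nonneg_arith (a : ℤ → ℤ) (h0 : ∀ n, 0 ≤ a n)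
    (h : ∀ n, a (n + 1) + a (n - 1) = 2 * a n) : a 1 = a 0 := by
  have hp : ∀ n : ℕ, a n = a 0 + n * (a 1 - a 0) ∧ a (n + 1) = a 0 + (n + 1) * (a 1 - a 0) := by
    intro n
    induction n with
    | zero => simp
    | succ n ih =>
      refine ⟨by exact_mod_cast ih.2, ?_⟩
      have := h (n + 1)
      rw [add_sub_cancel_right, ih.1, ih.2] at this
      push_cast
      linarith
  have hm : ∀ n : ℕ, a (-n) = a 0 - n * (a 1 - a 0) ∧
      a (-n - 1) = a 0 - (n + 1) * (a 1 - a 0) := by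
    intro n
    induction n with
    | zero =>
      refine ⟨by simp, ?_⟩
      have := h 0
      simp only [zero_add, zero_sub] at this
      simp
      linarith
    | succ n ih =>
      have e : (-((n + 1 : ℕ) : ℤ)) = -n - 1 := by push_cast; ring
      rw [e]
      refine ⟨by push_cast; exact ih.2, ?_⟩
      have := h (-n - 1)
      rw [sub_add_cancel, ih.1, ih.2] at this
      push_cast
      linarith
  set d := a 1 - a 0
  have h1 := h0 ((a 0).toNat + 1 : ℕ)
  have h2 := h0 (-((a 0).toNat + 1 : ℕ))
  rw [(hp _).1] at h1
  rw [(hm _).1] at h2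
  have e : (((a 0).toNat + 1 : ℕ) : ℤ) = a 0 + 1 := by
    push_cast
    rw [Int.toNat_of_nonneg (h0 0)]
  rw [e] at h1 h2
  have h00 := h0 0
  have : d = 0 := by
    rcases lt_trichotomy d 0 with hd | hd | hd
    · nlinarith
    · exact hd
    · nlinarith
  linarith

/-- If `z₁` is a zero of `θ₁`, then `θ₁(x + z₁) θ₁(x - z₁)` is proportional to `θ₁(x)²`. -/
lemma th1_shift_of_zero {τ : ℂ} (hτ : 0 < τ.im) {z₁ : ℂ} (hz : th1 τ z₁ = 0) :
    ∃ μ : ℂ, μ ≠ 0 ∧ ∀ x, th1 τ (x + z₁) * th1 τ (x - z₁) = μ * th1 τ x ^ 2 := by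
  have hAB : thA τ z₁ * thB τ 0 - thB τ z₁ * thA τ 0 = 0 := by
    rw [← th1_sq hτ, hz]; ring
  obtain ⟨w, hw⟩ := exists_th1_ne_zero hτ
  have hne : thA τ 0 ≠ 0 ∨ thB τ 0 ≠ 0 := by
    by_contra! h
    have := th1_sq hτ w
    rw [h.1, h.2] at this
    simp [hw] at this
  obtain ⟨μ, h1, h2⟩ : ∃ μ, thA τ z₁ = μ * thA τ 0 ∧ thB τ z₁ = μ * thB τ 0 := by
    rcases hne with h | h
    · refine ⟨thA τ z₁ / thA τ 0, by field_simp, ?_⟩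
      field_simp
      linear_combination -hAB
    · refine ⟨thB τ z₁ / thB τ 0, ?_, by field_simp⟩
      field_simp
      linear_combination hAB
  have key : ∀ x, th1 τ (x + z₁) * th1 τ (x - z₁) = μ * th1 τ x ^ 2 := by
    intro x
    rw [th1_add_mul_th1_sub hτ, th1_sq hτ, h1, h2]
    ring
  refine ⟨μ, ?_, key⟩
  rintro rfl
  have a1 : AnalyticOnNhd ℂ (fun x => th1 τ (x + z₁)) Set.univ := fun x _ =>
    ((differentiable_th1 hτ).comp (differentiable_id.add_const z₁)).analyticAt x
  have a2 : AnalyticOnNhd ℂ (fun x => th1 τ (x - z₁)) Set.univ := fun x _ =>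
    ((differentiable_th1 hτ).comp (differentiable_id.sub_const z₁)).analyticAt x
  rcases AnalyticOnNhd.eq_zero_or_eq_zero_of_mul_eq_zero a1 a2
    (fun x _ => by simp [key]) isPreconnected_univ with h | h
  · exact hw (by simpa using h (w - z₁) (Set.mem_univ _))
  · exact hw (by simpa using h (w + z₁) (Set.mem_univ _))

lemma analyticOrderAt_comp_add (f : ℂ → ℂ) (c x : ℂ) :
    analyticOrderAt (fun z => f (z + c)) x = analyticOrderAt f (x + c) := by
  have hg : AnalyticAt ℂ (fun z : ℂ => z + c) x := by fun_prop
  have h := analyticOrderAt_comp_of_deriv_ne_zero (f := f) hg (by simp)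
  exact h

/-- The zeros of `θ₁` are the points of the lattice spanned by `1` and `τ`.  A zero `z₁` makes the
orders of vanishing at `x + n z₁` an arithmetic progression in `n`, hence constant, so that `z₁` is
a quasi-period of `θ₁`; comparing it with the quasi-periods `1` and `τ` locates it. -/
theorem exists_int_of_th1_eq_zero {τ : ℂ} (hτ : 0 < τ.im) {z₁ : ℂ} (hz : th1 τ z₁ = 0) :
    ∃ j n : ℤ, z₁ = j + n * τ := by
  obtain ⟨μ, hμ, key⟩ := th1_shift_of_zero hτ hz
  have hd := differentiable_th1 hτ
  have ha : ∀ x, AnalyticAt ℂ (th1 τ) x := fun x => hd.analyticAt x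
  have hs : ∀ c x, AnalyticAt ℂ (fun z => th1 τ (z + c)) x := fun c x =>
    (hd.comp (differentiable_id.add_const c)).analyticAt x
  set o : ℂ → ℕ := fun x => analyticOrderNatAt (th1 τ) x
  have ho : ∀ x, analyticOrderAt (th1 τ) x = o x := fun x =>
    (Nat.cast_analyticOrderNatAt (analyticOrderAt_th1_ne_top hτ x)).symm
  have hadd : ∀ x, o (x + z₁) + o (x - z₁) = 2 * o x := by
    intro x
    have e : (fun z => th1 τ (z + z₁)) * (fun z => th1 τ (z + -z₁)) =
        (fun _ => μ) * (th1 τ * th1 τ) := by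
      ext z
      simp only [Pi.mul_apply, ← sub_eq_add_neg, key]
      ring
    have h := congrArg (fun f => analyticOrderAt f x) e
    rw [analyticOrderAt_mul (hs _ _) (hs _ _), analyticOrderAt_mul analyticAt_const
      ((ha x).mul (ha x)), analyticOrderAt_mul (ha x) (ha x), analyticOrderAt_comp_add,
      analyticOrderAt_comp_add, ho, ho, ho,
      (analyticAt_const (v := μ)).analyticOrderAt_eq_zero.2 hμ, ← sub_eq_add_neg] at h
    have h' : ((o (x + z₁) + o (x - z₁) : ℕ) : ℕ∞) = ((2 * o x : ℕ) : ℕ∞) := by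
      push_cast
      rw [h]
      ring
    exact_mod_cast h'
  have hconst : ∀ x, o (x + z₁) = o x := by
    intro x
    have := eq_of_nonneg_arith (fun n : ℤ => (o (x + n * z₁) : ℤ)) (fun n => by positivity)
      (fun n => by
        have := hadd (x + n * z₁)
        rw [show x + n * z₁ + z₁ = x + ((n + 1 : ℤ) : ℂ) * z₁ by push_cast; ring,
          show x + n * z₁ - z₁ = x + ((n - 1 : ℤ) : ℂ) * z₁ by push_cast; ring] at this
        exact_mod_cast this)
    simpa using this
  obtain ⟨φ, hφ, hφ0, hφe⟩ := exists_entire_quotient (f := fun z => th1 τ (z + z₁)) (g := th1 τ)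
    (hd.comp (differentiable_id.add_const z₁)) hd (analyticOrderAt_th1_ne_top hτ)
    (fun z => by rw [analyticOrderAt_comp_add, ho, ho, hconst])
  -- the functional equations of `φ` hold off the zeros of `θ₁`, hence everywhere
  have ext : ∀ u v : ℂ → ℂ, Differentiable ℂ u → Differentiable ℂ v →
      (∀ z, u z * th1 τ z = v z * th1 τ z) → ∀ z, u z = v z := by
    intro u v hu hv huv z
    rcases AnalyticOnNhd.eq_zero_or_eq_zero_of_mul_eq_zero (f := fun z => u z - v z) (g := th1 τ)
      (fun x _ => (hu.sub hv).analyticAt x) (fun x _ => ha x)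
      (fun x _ => by rw [sub_mul, huv, sub_self]) isPreconnected_univ with h | h
    · exact sub_eq_zero.1 (h z (Set.mem_univ z))
    · obtain ⟨w, hw⟩ := exists_th1_ne_zero hτ
      exact absurd (h w (Set.mem_univ w)) hw
  have p1 : ∀ z, φ (z + 1) = 1 * φ z := by
    refine ext _ _ (hφ.comp (differentiable_id.add_const 1)) (hφ.const_mul 1) (fun z => ?_)
    have h := hφe (z + 1)
    rw [th1_add_one, show z + 1 + z₁ = z + z₁ + 1 by ring, th1_add_one] at h
    have h' := hφe z
    linear_combination h' + h
  have p2 : ∀ z, φ (z + τ) = exp (0 * z + -(2 * Real.pi * I * z₁)) * φ z := by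
    refine ext _ _ (hφ.comp (differentiable_id.add_const τ)) (by fun_prop) (fun z => ?_)
    have h := hφe (z + τ)
    rw [th1_add_tau, show z + τ + z₁ = z + z₁ + τ by ring, th1_add_tau,
      show -(2 * Real.pi * I * (z + z₁)) - Real.pi * I * τ =
      (-(2 * Real.pi * I * z) - Real.pi * I * τ) + (0 * z + -(2 * Real.pi * I * z₁)) by ring,
      Complex.exp_add] at h
    have h' := hφe z
    rw [h'] at h
    have he := Complex.exp_ne_zero (-(2 * Real.pi * I * z) - Real.pi * I * τ)
    refine mul_left_cancel₀ he ?_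
    linear_combination h
  obtain ⟨-, d, hd'⟩ := eq_exp_of_quasi_periodic hτ hφ hφ0 p1 p2
  have e1 : exp d = 1 := by
    have := p1 0
    rw [hd' (0 + 1), one_mul] at this
    simpa [hφ0 0] using this
  have e2 : exp (d * τ) = exp (-(2 * Real.pi * I * z₁)) := by
    have := p2 0
    rw [hd' (0 + τ), mul_comm] at this
    simpa [hφ0 0] using this
  obtain ⟨n, hn⟩ := Complex.exp_eq_one_iff.1 e1
  obtain ⟨k, hk⟩ := Complex.exp_eq_exp_iff_exists_int.1 e2
  refine ⟨k, -n, ?_⟩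
  have hpi : (2 * Real.pi * I : ℂ) ≠ 0 := Complex.two_pi_I_ne_zero
  refine mul_left_cancel₀ hpi ?_
  rw [hn] at hk
  push_cast
  linear_combination hk

/-- Every even theta function of order two has a zero. -/
theorem exists_zero_thA_thB {τ : ℂ} (hτ : 0 < τ.im) (p q : ℂ) :
    ∃ z, p * thA τ z + q * thB τ z = 0 := by
  by_contra! h
  have hA := differentiable_thA hτ
  have hB := differentiable_thB hτ
  have := (eq_exp_of_quasi_periodic hτ (F := fun z => p * thA τ z + q * thB τ z) (c := 1)
    (a := -(4 * Real.pi * I)) (b := -(2 * Real.pi * I * τ)) (by fun_prop) h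
    (fun z => by rw [thA_add_one, thB_add_one, one_mul])
    (fun z => by rw [thA_add_tau, thB_add_tau]; ring_nf)).1
  simp [Real.pi_ne_zero] at this

/-! ### Values of the theta functions at half periods -/

lemma im_int_add_int_mul (τ : ℂ) (j n : ℤ) : ((j : ℂ) + n * τ).im = n * τ.im := by simp

lemma th2_zero_ne {τ : ℂ} (hτ : 0 < τ.im) : th2 τ 0 ≠ 0 := by
  intro h
  rw [← th1_add_half] at h
  obtain ⟨j, n, hjn⟩ := exists_int_of_th1_eq_zero hτ h
  have him := congrArg Complex.im hjn
  rw [im_int_add_int_mul] at him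
  have hn : n = 0 := by
    have : (n : ℝ) * τ.im = 0 := by rw [← him]; simp
    simpa [hτ.ne'] using this
  rw [hn] at hjn
  have hre := congrArg Complex.re hjn
  simp at hre
  have : (2 * j : ℝ) = 1 := by rw [← hre]; norm_num
  have : (2 * j : ℤ) = 1 := by exact_mod_cast this
  omega

/-- The zeros of `θ₄` are the translates of the lattice by `τ/2`. -/
lemma exists_int_of_th4_eq_zero {τ : ℂ} (hτ : 0 < τ.im) {z : ℂ} (hz : th4 τ z = 0) :
    ∃ j n : ℤ, z = j + (n + 1 / 2) * τ := by
  rw [show z = (z - τ / 2) + τ / 2 by ring, th4_add_tau_half] at hz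
  obtain ⟨j, n, h⟩ := exists_int_of_th1_eq_zero hτ (z₁ := z - τ / 2) (by simpa using hz)
  exact ⟨j, n, by linear_combination h⟩

lemma th4_ofReal_ne {τ : ℂ} (hτ : 0 < τ.im) {z : ℂ} (hz : z.im = 0) : th4 τ z ≠ 0 := by
  intro h
  obtain ⟨j, n, h⟩ := exists_int_of_th4_eq_zero hτ h
  have him := congrArg Complex.im h
  have e : ((j : ℂ) + (n + 1 / 2) * τ).im = (n + 1 / 2 : ℝ) * τ.im := by
    have : ((n : ℂ) + 1 / 2) = ((n + 1 / 2 : ℝ) : ℂ) := by push_cast; rfl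
    rw [this, Complex.add_im, Complex.im_ofReal_mul, Complex.intCast_im, zero_add]
  rw [e, hz] at him
  have h2 : (n + 1 / 2 : ℝ) = 0 := by
    rcases mul_eq_zero.1 him.symm with h | h
    · exact h
    · exact absurd h hτ.ne'
  have : (2 * n + 1 : ℝ) = 0 := by linarith
  have : (2 * n + 1 : ℤ) = 0 := by exact_mod_cast this
  omega

lemma th4_zero_ne {τ : ℂ} (hτ : 0 < τ.im) : th4 τ 0 ≠ 0 := th4_ofReal_ne hτ rfl

lemma th3_zero_ne {τ : ℂ} (hτ : 0 < τ.im) : th3 τ 0 ≠ 0 := by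
  rw [← th4_add_half]
  exact th4_ofReal_ne hτ (by simp)

/-! ### The quotient `θ₁/θ₄` and its derivative -/

/-- The theta constant `θ₁'(0|τ)`. -/
noncomputable def th1' (τ : ℂ) : ℂ := deriv (th1 τ) 0

/-- The derivative of `θ₁/θ₄` is proportional to `θ₂θ₃/θ₄²`. -/
theorem th1_th4_wronskian {τ : ℂ} (hτ : 0 < τ.im) (x : ℂ) :
    (deriv (th1 τ) x * th4 τ x - th1 τ x * deriv (th4 τ) x) * (th2 τ 0 * th3 τ 0) =
      th1' τ * th4 τ 0 * (th2 τ x * th3 τ x) := by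
  have hU := differentiable_thU hτ
  set U' := deriv (thU τ) 0 with hU'
  have hW : ∀ x, deriv (th1 τ) x * th4 τ x - th1 τ x * deriv (th4 τ) x =
      -I * U' * (thU τ x + thU τ (-x)) := by
    intro x
    have l1 : HasDerivAt (fun y => th1 τ (x + y)) (deriv (th1 τ) x) 0 := by
      have := (differentiable_th1 hτ (x + 0)).hasDerivAt.comp_const_add x 0
      simpa using this
    have l4 : HasDerivAt (fun y => th4 τ (x - y)) (-deriv (th4 τ) x) 0 := by
      have := (differentiable_th4 hτ (x - 0)).hasDerivAt.comp_const_sub x 0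
      simpa using this
    have r1 : HasDerivAt (thU τ) U' 0 := (hU 0).hasDerivAt
    have r2 : HasDerivAt (fun y => thU τ (-y)) (-U') 0 := by
      have := (hU (0 - 0)).hasDerivAt.comp_const_sub 0 0
      simpa using this
    have hl := l1.fun_mul l4
    have hr := ((r1.const_mul (thU τ x)).fun_sub (r2.const_mul (thU τ (-x)))).const_mul (-I)
    rw [show (fun y => th1 τ (x + y) * th4 τ (x - y)) = fun y =>
      -I * (thU τ x * thU τ y - thU τ (-x) * thU τ (-y)) from
      funext fun y => th1_add_mul_th4_sub hτ x y] at hl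
    have := hl.unique hr
    simp only [add_zero, sub_zero] at this
    linear_combination this
  have hP : ∀ x, th2 τ x * th3 τ x = thU τ 0 * (thU τ x + thU τ (-x)) := by
    intro x
    have := th2_add_mul_th3_sub hτ x 0
    rw [add_zero, sub_zero, neg_zero] at this
    linear_combination this
  have h0 : th1' τ * th4 τ 0 = -I * U' * (2 * thU τ 0) := by
    have := hW 0
    rw [th1_zero, neg_zero, zero_mul, sub_zero] at this
    rw [th1', this]
    ring
  have h2 := hP 0
  rw [neg_zero] at h2
  rw [hW, hP x, h0, h2]
  ring

/-! ### Elliptic functions with nome `exp (π i τ)` in the variable `z = α / 2K` -/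

/-- The modular lambda function `λ(τ) = θ₂(0|τ)⁴ / θ₃(0|τ)⁴`. -/
noncomputable def lam (τ : ℂ) : ℂ := th2 τ 0 ^ 4 / th3 τ 0 ^ 4

/-- The derivative at `0` of `sn` in the variable `z = α / 2K`, as a function of `τ`. -/
noncomputable def kap (τ : ℂ) : ℂ := th1' τ * th3 τ 0 / (th2 τ 0 * th4 τ 0)

/-- `sn` in the variable `z = α / 2K`. -/
noncomputable def snZ (τ z : ℂ) : ℂ := th3 τ 0 / th2 τ 0 * (th1 τ z / th4 τ z)

/-- `cn` in the variable `z = α / 2K`. -/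
noncomputable def cnZ (τ z : ℂ) : ℂ := th4 τ 0 / th2 τ 0 * (th2 τ z / th4 τ z)

/-- `dn` in the variable `z = α / 2K`. -/
noncomputable def dnZ (τ z : ℂ) : ℂ := th4 τ 0 / th3 τ 0 * (th3 τ z / th4 τ z)

lemma snZ_sq_add_cnZ_sq {τ : ℂ} (hτ : 0 < τ.im) {z : ℂ} (hz : th4 τ z ≠ 0) :
    snZ τ z ^ 2 + cnZ τ z ^ 2 = 1 := by
  have h2 := th2_zero_ne hτ
  have key : th3 τ 0 ^ 2 * th1 τ z ^ 2 + th4 τ 0 ^ 2 * th2 τ z ^ 2 =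
      th2 τ 0 ^ 2 * th4 τ z ^ 2 := by
    simp only [th1_sq hτ, th2_sq hτ, th3_sq hτ, th4_sq hτ]; ring
  rw [snZ, cnZ]
  field_simp
  linear_combination key

lemma dnZ_sq_add {τ : ℂ} (hτ : 0 < τ.im) {z : ℂ} (hz : th4 τ z ≠ 0) :
    dnZ τ z ^ 2 + lam τ * snZ τ z ^ 2 = 1 := by
  have h2 := th2_zero_ne hτ
  have h3 := th3_zero_ne hτ
  have key : th4 τ 0 ^ 2 * th3 τ z ^ 2 + th2 τ 0 ^ 2 * th1 τ z ^ 2 =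
      th3 τ 0 ^ 2 * th4 τ z ^ 2 := by
    simp only [th1_sq hτ, th2_sq hτ, th3_sq hτ, th4_sq hτ]; ring
  rw [snZ, dnZ, lam]
  field_simp
  linear_combination key

lemma one_sub_lam {τ : ℂ} (hτ : 0 < τ.im) : 1 - lam τ = th4 τ 0 ^ 4 / th3 τ 0 ^ 4 := by
  have h3 := th3_zero_ne hτ
  have key : (th4 τ 0 ^ 2) ^ 2 + (th2 τ 0 ^ 2) ^ 2 = (th3 τ 0 ^ 2) ^ 2 := by
    simp only [th2_sq hτ, th3_sq hτ, th4_sq hτ]; ring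
  rw [lam]
  field_simp
  linear_combination -key

lemma hasDerivAt_snZ {τ : ℂ} (hτ : 0 < τ.im) {z : ℂ} (hz : th4 τ z ≠ 0) :
    HasDerivAt (snZ τ) (kap τ * cnZ τ z * dnZ τ z) z := by
  have h2 := th2_zero_ne hτ
  have h3 := th3_zero_ne hτ
  have h4 := th4_zero_ne hτ
  have h := (((differentiable_th1 hτ z).hasDerivAt).fun_div ((differentiable_th4 hτ z).hasDerivAt)
    hz).const_mul (th3 τ 0 / th2 τ 0)
  refine h.congr_deriv ?_
  have := th1_th4_wronskian hτ z
  rw [kap, cnZ, dnZ]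
  field_simp
  linear_combination this

lemma snZ_zero (τ : ℂ) : snZ τ 0 = 0 := by simp [snZ, th1_zero]

lemma snZ_half {τ : ℂ} (hτ : 0 < τ.im) : snZ τ (1 / 2) = 1 := by
  have h2 := th2_zero_ne hτ
  have h3 := th3_zero_ne hτ
  have e1 := th1_add_half τ 0
  have e4 := th4_add_half τ 0
  rw [zero_add] at e1 e4
  rw [snZ, e1, e4]
  field_simp

/-! ### The transformation `τ ↦ -1/τ` -/

lemma th3_zero_modular (τ : ℂ) :
    th3 τ 0 = 1 / (-I * τ) ^ (1 / 2 : ℂ) * th3 (-1 / τ) 0 := by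
  rw [th3, jacobiTheta₂_functional_equation]
  simp [th3]

lemma th4_zero_modular (τ : ℂ) :
    th4 τ 0 = 1 / (-I * τ) ^ (1 / 2 : ℂ) * th2 (-1 / τ) 0 := by
  rw [th4, jacobiTheta₂_functional_equation, th2, mul_assoc,
    ← jacobiTheta₂_neg_left (0 + -1 / τ / 2)]
  congr 3 <;> ring

lemma th2_zero_modular {τ : ℂ} (hτ : τ ≠ 0) :
    th2 τ 0 = 1 / (-I * τ) ^ (1 / 2 : ℂ) * th4 (-1 / τ) 0 := by
  have e : exp (Real.pi * I * 0 + Real.pi * I * τ / 4) *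
      exp (-Real.pi * I * (0 + τ / 2) ^ 2 / τ) = 1 := by
    rw [← Complex.exp_add, ← Complex.exp_zero]
    congr 1
    field_simp
    ring
  rw [th2, jacobiTheta₂_functional_equation, th4,
    show (0 + τ / 2) / τ = 0 + 1 / 2 by field_simp; ring]
  linear_combination (1 / (-I * τ) ^ (1 / 2 : ℂ) * jacobiTheta₂ (0 + 1 / 2) (-1 / τ)) * e

lemma th1_modular {τ : ℂ} (hτ : τ ≠ 0) (z : ℂ) :
    th1 τ z = -I * (1 / (-I * τ) ^ (1 / 2 : ℂ)) * exp (-Real.pi * I * z ^ 2 / τ) *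
      th1 (-1 / τ) (-z / τ) := by
  have e : exp (Real.pi * I * z + Real.pi * I * τ / 4) *
      exp (-Real.pi * I * (z + 1 / 2 + τ / 2) ^ 2 / τ) =
      -I * (exp (-Real.pi * I * z ^ 2 / τ) *
        exp (Real.pi * I * (-z / τ) + Real.pi * I * (-1 / τ) / 4)) := by
    rw [← Complex.exp_neg_pi_div_two_mul_I, ← Complex.exp_add, ← Complex.exp_add,
      ← Complex.exp_add]
    congr 1
    field_simp
    ring
  have h : jacobiTheta₂ ((z + 1 / 2 + τ / 2) / τ) (-1 / τ) =
      jacobiTheta₂ (-z / τ + 1 / 2 + -1 / τ / 2) (-1 / τ) := by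
    rw [← jacobiTheta₂_neg_left, ← jacobiTheta₂_add_left]
    congr 1
    field_simp
    ring
  rw [th1, jacobiTheta₂_functional_equation, th1, h]
  linear_combination (-I * (1 / (-I * τ) ^ (1 / 2 : ℂ)) *
    jacobiTheta₂ (-z / τ + 1 / 2 + -1 / τ / 2) (-1 / τ)) * e

lemma im_neg_one_div_pos {τ : ℂ} (hτ : 0 < τ.im) : 0 < (-1 / τ).im := by
  have h0 : τ ≠ 0 := by rintro rfl; simp at hτ
  rw [Complex.div_im]
  simp only [neg_im, one_im, neg_zero, zero_mul, zero_div, neg_re, one_re]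
  have := Complex.normSq_pos.2 h0
  have : 0 < τ.im / normSq τ := by positivity
  linarith [show -1 * τ.im / normSq τ = -(τ.im / normSq τ) by ring]

lemma th1'_modular {τ : ℂ} (hτ : 0 < τ.im) :
    th1' τ = I / τ * (1 / (-I * τ) ^ (1 / 2 : ℂ)) * th1' (-1 / τ) := by
  have h0 : τ ≠ 0 := by rintro rfl; simp at hτ
  set c := 1 / (-I * τ) ^ (1 / 2 : ℂ)
  have d1 : HasDerivAt (fun z => th1 (-1 / τ) (-z / τ)) (th1' (-1 / τ) * (-1 / τ)) 0 := by
    have hi : HasDerivAt (fun z : ℂ => -z / τ) (-1 / τ) 0 :=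
      (hasDerivAt_id' (0 : ℂ)).neg.div_const τ
    have ho : HasDerivAt (th1 (-1 / τ)) (th1' (-1 / τ)) (-0 / τ) := by
      rw [neg_zero, zero_div]
      exact (differentiable_th1 (im_neg_one_div_pos hτ) 0).hasDerivAt
    exact ho.comp (0 : ℂ) hi
  have d2 : HasDerivAt (fun z : ℂ => -I * c * exp (-Real.pi * I * z ^ 2 / τ)) 0 0 := by
    have : HasDerivAt (fun z : ℂ => -Real.pi * I * z ^ 2 / τ) 0 0 := by
      have := (((hasDerivAt_id' (0 : ℂ)).fun_pow 2).const_mul (-Real.pi * I)).div_const τ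
      simpa using this
    simpa using this.cexp.const_mul (-I * c)
  have h := d2.fun_mul d1
  rw [← show th1 τ = _ from funext fun z => th1_modular h0 z] at h
  rw [th1', h.deriv]
  simp
  ring

lemma lam_modular {τ : ℂ} (hτ : 0 < τ.im) : lam (-1 / τ) = 1 - lam τ := by
  have h0 : τ ≠ 0 := by rintro rfl; simp at hτ
  have h3 := th3_zero_ne hτ
  have e3 := th3_zero_modular τ
  have e4 := th4_zero_modular τ
  set c := 1 / (-I * τ) ^ (1 / 2 : ℂ)
  have hc : c ≠ 0 := by
    intro hc
    rw [hc, zero_mul] at e3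
    exact h3 e3
  rw [one_sub_lam hτ, lam, e3, e4, mul_pow, mul_pow, mul_div_mul_left _ _ (pow_ne_zero 4 hc)]

lemma kap_modular {τ : ℂ} (hτ : 0 < τ.im) : kap τ = I / τ * kap (-1 / τ) := by
  have h0 : τ ≠ 0 := by rintro rfl; simp at hτ
  have h3 := th3_zero_ne hτ
  have e1 := th1'_modular hτ
  have e3 := th3_zero_modular τ
  have e4 := th4_zero_modular τ
  have e2 := th2_zero_modular h0
  set c := 1 / (-I * τ) ^ (1 / 2 : ℂ)
  have hc : c ≠ 0 := by
    intro hc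
    rw [hc, zero_mul] at e3
    exact h3 e3
  have n2 := th2_zero_ne (im_neg_one_div_pos hτ)
  have n4 := th4_zero_ne (im_neg_one_div_pos hτ)
  rw [kap, kap, e1, e2, e3, e4]
  field_simp

/-! ### The complete elliptic integral on the imaginary axis -/

/-- Inversion of the complete elliptic integral by a real solution of
`s' = κ √(1-s²) √(1-μ s²)` that increases from `0` to `1` on `[0, 1/2]`. -/
lemma ellK_eq_of_param {μ κ : ℝ} (hμ1 : μ < 1) {s c d : ℝ → ℝ}
    (hs : ∀ x, HasDerivAt s (κ * c x * d x) x) (hsc : ∀ x, s x ^ 2 + c x ^ 2 = 1)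
    (hds : ∀ x, d x ^ 2 + μ * s x ^ 2 = 1) (hd : ∀ x, 0 < d x)
    (hc : ∀ x ∈ Set.Ico (0 : ℝ) (1 / 2), 0 < c x) (h0 : s 0 = 0) (h1 : s (1 / 2) = 1) :
    ellK μ = (κ / 2 : ℝ) := by
  have hpos : ∀ u : ℝ, u ^ 2 ≤ 1 → 0 < 1 - μ * u ^ 2 := by
    intro u hu
    rcases le_total μ 0 with h | h
    · linarith [mul_nonpos_of_nonpos_of_nonneg h (sq_nonneg u)]
    · linarith [mul_le_of_le_one_right h hu]
  have hpos' : ∀ θ : ℝ, 0 < 1 - μ * Real.sin θ ^ 2 := fun θ => hpos _ (Real.sin_sq_le_one θ)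
  set f : ℝ → ℝ := fun θ => (√(1 - μ * Real.sin θ ^ 2))⁻¹ with hf
  have hfc : Continuous f := by
    refine Continuous.inv₀ (by fun_prop) fun θ => (Real.sqrt_pos.2 (hpos' θ)).ne'
  set F : ℝ → ℝ := fun t => ∫ θ in (0 : ℝ)..t, f θ with hF
  have hFd : ∀ t, HasDerivAt F (f t) t := fun t =>
    intervalIntegral.integral_hasDerivAt_right (hfc.intervalIntegrable _ _)
      hfc.aestronglyMeasurable.stronglyMeasurableAtFilter hfc.continuousAt
  have hFc : Continuous F := continuous_iff_continuousAt.2 fun t => (hFd t).continuousAt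
  have hsC : Continuous s := continuous_iff_continuousAt.2 fun t => (hs t).continuousAt
  have hconst : ∀ x ∈ Set.Icc (0 : ℝ) (1 / 2), F (Real.arcsin (s x)) - κ * x =
      F (Real.arcsin (s 0)) - κ * 0 := by
    refine constant_of_has_deriv_right_zero (f := fun x => F (Real.arcsin (s x)) - κ * x)
      (Continuous.continuousOn (by
      have := Real.continuous_arcsin
      fun_prop)) fun x hx => ?_
    have hcx := hc x hx
    have hs1 : s x < 1 := by nlinarith [hsc x]
    have hs2 : -1 < s x := by nlinarith [hsc x]
    have e1 : √(1 - s x ^ 2) = c x := by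
      rw [show 1 - s x ^ 2 = c x ^ 2 by linarith [hsc x], Real.sqrt_sq hcx.le]
    have e2 : √(1 - μ * s x ^ 2) = d x := by
      rw [show 1 - μ * s x ^ 2 = d x ^ 2 by linarith [hds x], Real.sqrt_sq (hd x).le]
    have ha : HasDerivAt (fun x => Real.arcsin (s x)) (1 / c x * (κ * c x * d x)) x := by
      rw [← e1]
      exact (Real.hasDerivAt_arcsin hs2.ne' hs1.ne).comp x (e1 ▸ hs x)
    have hb : HasDerivAt (fun x => F (Real.arcsin (s x)) - κ * x)
        (f (Real.arcsin (s x)) * (1 / c x * (κ * c x * d x)) - κ * 1) x :=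
      ((hFd _).comp x ha).sub ((hasDerivAt_id' x).const_mul κ)
    have e3 : f (Real.arcsin (s x)) = (d x)⁻¹ := by
      rw [hf]
      simp only
      rw [Real.sin_arcsin hs2.le hs1.le, e2]
    have hdx := (hd x).ne'
    have : f (Real.arcsin (s x)) * (1 / c x * (κ * c x * d x)) - κ * 1 = 0 := by
      rw [e3]
      field_simp
      ring
    rw [this] at hb
    exact hb.hasDerivWithinAt
  have hval := hconst (1 / 2) ⟨by norm_num, le_rfl⟩
  rw [h0, h1, Real.arcsin_zero, Real.arcsin_one] at hval
  have hF0 : F 0 = 0 := intervalIntegral.integral_same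
  have hFK : F (Real.pi / 2) = κ / 2 := by
    rw [hF0] at hval
    linarith
  rw [← hFK, hF, ellK, ← intervalIntegral.integral_ofReal]
  refine intervalIntegral.integral_congr fun θ _ => ?_
  simp only [hf]
  rw [show (1 - (μ : ℂ) * (Real.sin θ : ℂ) ^ 2) = ((1 - μ * Real.sin θ ^ 2 : ℝ) : ℂ) by
      push_cast; rfl,
    show (-(1 / 2) : ℂ) = ((-(1 / 2) : ℝ) : ℂ) by push_cast; rfl,
    ← Complex.ofReal_cpow (hpos' θ).le, Real.rpow_neg (hpos' θ).le, ← Real.sqrt_eq_rpow]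

lemma conj_one_half : conj (1 / 2 : ℂ) = 1 / 2 := by
  have := Complex.conj_ofReal (1 / 2)
  push_cast at this
  exact this

lemma conj_th3 {τ : ℂ} (hτ : -conj τ = τ) (z : ℂ) : conj (th3 τ z) = th3 τ (conj z) := by
  rw [th3, jacobiTheta₂_conj, hτ, th3]

lemma conj_th4 {τ : ℂ} (hτ : -conj τ = τ) (z : ℂ) : conj (th4 τ z) = th4 τ (conj z) := by
  rw [← th3_add_half, conj_th3 hτ, ← th3_add_half, map_add, conj_one_half]

lemma conj_th2 {τ : ℂ} (hτ : -conj τ = τ) (z : ℂ) : conj (th2 τ z) = th2 τ (conj z) := by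
  have hc : conj τ = -τ := neg_eq_iff_eq_neg.1 hτ
  rw [← th2_neg, th2, map_mul, jacobiTheta₂_conj, hτ, ← Complex.exp_conj, th2,
    ← jacobiTheta₂_neg_left]
  simp only [map_add, map_mul, map_div₀, map_neg, Complex.conj_ofReal, Complex.conj_I, hc]
  have e1 : conj (2 : ℂ) = 2 := by simpa using Complex.conj_ofReal 2
  have e2 : conj (4 : ℂ) = 4 := by simpa using Complex.conj_ofReal 4
  rw [e1, e2]
  congr 2 <;> ring

lemma conj_th1 {τ : ℂ} (hτ : -conj τ = τ) (z : ℂ) : conj (th1 τ z) = th1 τ (conj z) := by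
  have h : ∀ z, th1 τ z = th2 τ (z - 1 / 2) := fun z => by
    rw [← th1_add_half, sub_add_cancel]
  rw [h, conj_th2 hτ, h, map_sub, conj_one_half]

lemma re_tsum_pos {f : ℤ → ℂ} {a : ℂ} (hf : HasSum f a) (h : ∀ n, 0 < (f n).re) : 0 < a.re := by
  have := hf.mapL Complex.reCLM
  exact (h 0).trans_le (le_hasSum this 0 fun n _ => (h n).le)

lemma th3_zero_re_pos {τ : ℂ} (hτ : 0 < τ.im) (hτ' : τ.re = 0) : 0 < (th3 τ 0).re := by
  refine re_tsum_pos (hasSum_jacobiTheta₂_term 0 hτ) fun n => ?_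
  have : jacobiTheta₂_term n 0 τ = ((Real.exp (-(Real.pi * n ^ 2 * τ.im)) : ℝ) : ℂ) := by
    rw [jacobiTheta₂_term, Complex.ofReal_exp]
    congr 1
    apply Complex.ext <;> simp [hτ', pow_two]
  rw [this, Complex.ofReal_re]
  exact Real.exp_pos _

lemma th2_zero_re_pos {τ : ℂ} (hτ : 0 < τ.im) (hτ' : τ.re = 0) : 0 < (th2 τ 0).re := by
  have hs := (hasSum_jacobiTheta₂_term (0 + τ / 2) hτ).mul_left
    (exp (Real.pi * I * 0 + Real.pi * I * τ / 4))
  refine re_tsum_pos hs fun n => ?_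
  obtain ⟨t, ht⟩ : ∃ t, τ.im = t := ⟨_, rfl⟩
  have hI : τ = (t : ℂ) * I := by apply Complex.ext <;> simp [hτ', ht]
  have : exp (Real.pi * I * 0 + Real.pi * I * τ / 4) * jacobiTheta₂_term n (0 + τ / 2) τ =
      ((Real.exp (-(Real.pi * (n + 1 / 2) ^ 2 * τ.im)) : ℝ) : ℂ) := by
    rw [jacobiTheta₂_term, ← Complex.exp_add, Complex.ofReal_exp]
    congr 1
    rw [ht, hI]
    push_cast
    linear_combination (Real.pi * (n + 1 / 2) ^ 2 * t : ℂ) * I_sq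
  rw [this, Complex.ofReal_re]
  exact Real.exp_pos _

/-- Jacobi's inversion of the complete elliptic integral for purely imaginary `τ`. -/
theorem ellK_lam_of_re_eq_zero {τ : ℂ} (hτ : 0 < τ.im) (hτ' : τ.re = 0) :
    ellK (lam τ) = kap τ / 2 := by
  have hc : -conj τ = τ := by apply Complex.ext <;> simp [hτ']
  have rl : ∀ {f : ℂ → ℂ}, (∀ z, conj (f z) = f (conj z)) → ∀ x : ℝ, f x = ((f x).re : ℂ) := by
    intro f hf x
    have := hf x
    rw [Complex.conj_ofReal] at this
    exact (Complex.conj_eq_iff_re.1 this).symm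
  have r1 := rl (conj_th1 hc)
  have r2 := rl (conj_th2 hc)
  have r3 := rl (conj_th3 hc)
  have r4 := rl (conj_th4 hc)
  -- `θ₄` is real without zeros on the real axis, so it keeps the sign of `θ₄(1/2) = θ₃(0)`
  have p4 : ∀ x : ℝ, 0 < (th4 τ x).re := by
    intro x
    by_contra! hx
    have hcont : Continuous fun x : ℝ => (th4 τ x).re :=
      Complex.continuous_re.comp ((differentiable_th4 hτ).continuous.comp
        Complex.continuous_ofReal)
    have hp : 0 ≤ (th4 τ ((1 / 2 : ℝ) : ℂ)).re := by
      have := th4_add_half τ 0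
      rw [zero_add] at this
      push_cast
      rw [this]
      exact (th3_zero_re_pos hτ hτ').le
    obtain ⟨y, hy⟩ := mem_range_of_exists_le_of_exists_ge hcont ⟨x, hx⟩ ⟨1 / 2, hp⟩
    refine th4_ofReal_ne hτ (z := y) (by simp) ?_
    rw [r4 y]
    simp only at hy
    rw [hy, Complex.ofReal_zero]
  have p3 : ∀ x : ℝ, 0 < (th3 τ x).re := by
    intro x
    have := p4 (x + 1 / 2)
    push_cast at this
    rwa [th4_add_half] at this
  -- the first zero of `θ₂` on the positive real axis is `1/2`
  have p2 : ∀ x ∈ Set.Ico (0 : ℝ) (1 / 2), 0 < (th2 τ x).re := by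
    intro x hx
    by_contra! hx'
    have hcont : Continuous fun x : ℝ => (th2 τ x).re :=
      Complex.continuous_re.comp ((differentiable_th2 hτ).continuous.comp
        Complex.continuous_ofReal)
    obtain ⟨y, hy, hy0⟩ := intermediate_value_Icc' hx.1 hcont.continuousOn
      (show (0 : ℝ) ∈ Set.Icc _ _ from ⟨hx', by simpa using (th2_zero_re_pos hτ hτ').le⟩)
    have hz : th2 τ y = 0 := by
      rw [r2 y]
      simp only at hy0
      rw [hy0, Complex.ofReal_zero]
    rw [← th1_add_half] at hz
    obtain ⟨j, n, hjn⟩ := exists_int_of_th1_eq_zero hτ hz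
    have him := congrArg Complex.im hjn
    rw [im_int_add_int_mul] at him
    have hn : n = 0 := by
      have : (n : ℝ) * τ.im = 0 := by rw [← him]; simp
      simpa [hτ.ne'] using this
    rw [hn] at hjn
    have hre := congrArg Complex.re hjn
    simp at hre
    have h1 := hy.1
    have h2 := hy.2.trans_lt hx.2
    have : (0 : ℝ) < j := by rw [← hre]; linarith
    have j0 : 0 < j := by exact_mod_cast this
    have : (j : ℝ) < 1 := by rw [← hre]; linarith
    have j1 : j < 1 := by exact_mod_cast this
    omega
  have r30 := r3 0
  have r20 := r2 0
  have r40 := r4 0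
  rw [Complex.ofReal_zero] at r30 r20 r40
  have p30 := th3_zero_re_pos hτ hτ'
  have p20 := th2_zero_re_pos hτ hτ'
  have p40 : 0 < (th4 τ 0).re := by simpa using p4 0
  have hreal : ∀ {w : ℂ} {r : ℝ}, w = r → w = (w.re : ℂ) := by
    rintro w r rfl
    simp
  have hS : ∀ x : ℝ, snZ τ x = ((snZ τ x).re : ℂ) := fun x => by
    refine hreal (r := (th3 τ 0).re / (th2 τ 0).re * ((th1 τ x).re / (th4 τ x).re)) ?_
    push_cast
    rw [snZ, ← r30, ← r20, ← r1, ← r4]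
  have eC : ∀ x : ℝ, cnZ τ x =
      (((th4 τ 0).re / (th2 τ 0).re * ((th2 τ x).re / (th4 τ x).re) : ℝ) : ℂ) := fun x => by
    push_cast
    rw [cnZ, ← r40, ← r20, ← r2, ← r4]
  have eD : ∀ x : ℝ, dnZ τ x =
      (((th4 τ 0).re / (th3 τ 0).re * ((th3 τ x).re / (th4 τ x).re) : ℝ) : ℂ) := fun x => by
    push_cast
    rw [dnZ, ← r40, ← r30, ← r3, ← r4]
  have hC : ∀ x : ℝ, cnZ τ x = ((cnZ τ x).re : ℂ) := fun x => hreal (eC x)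
  have hD : ∀ x : ℝ, dnZ τ x = ((dnZ τ x).re : ℂ) := fun x => hreal (eD x)
  have hne : ∀ x : ℝ, th4 τ x ≠ 0 := fun x => th4_ofReal_ne hτ (by simp)
  have elam : lam τ = (((th2 τ 0).re ^ 4 / (th3 τ 0).re ^ 4 : ℝ) : ℂ) := by
    push_cast
    rw [lam, ← r20, ← r30]
  have hlam : lam τ = ((lam τ).re : ℂ) := hreal elam
  have hlam1 : (lam τ).re < 1 := by
    have h := one_sub_lam hτ
    rw [r40, r30, hlam] at h
    have h' : 1 - (lam τ).re = (th4 τ 0).re ^ 4 / (th3 τ 0).re ^ 4 := by exact_mod_cast h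
    have : 0 < (th4 τ 0).re ^ 4 / (th3 τ 0).re ^ 4 := by positivity
    linarith
  -- `kap τ` is the derivative at `0` of a function that is real on the real axis
  have hkap : kap τ = ((kap τ).re : ℂ) := by
    have hd : HasDerivAt (fun x : ℝ => snZ τ x) (kap τ * cnZ τ (0 : ℝ) * dnZ τ (0 : ℝ)) 0 :=
      (hasDerivAt_snZ hτ (hne 0)).comp_ofReal
    have e1 : cnZ τ (0 : ℝ) = 1 := by
      rw [Complex.ofReal_zero, cnZ]
      field_simp [th2_zero_ne hτ, th4_zero_ne hτ]
    have e2 : dnZ τ (0 : ℝ) = 1 := by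
      rw [Complex.ofReal_zero, dnZ]
      field_simp [th3_zero_ne hτ, th4_zero_ne hτ]
    rw [e1, e2, mul_one, mul_one] at hd
    have hi := Complex.imCLM.hasFDerivAt.comp_hasDerivAt (0 : ℝ) hd
    have h0 : (fun x : ℝ => Complex.imCLM (snZ τ x)) = fun _ => 0 := by
      ext x
      rw [hS x]
      simp
    have h1 : Complex.imCLM (kap τ) = 0 := by
      refine hi.unique ?_
      change HasDerivAt (fun x : ℝ => Complex.imCLM (snZ τ x)) 0 0
      rw [h0]
      exact hasDerivAt_const _ _
    exact (Complex.conj_eq_iff_re.1 (Complex.conj_eq_iff_im.2 h1)).symm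
  rw [hlam, ellK_eq_of_param (κ := (kap τ).re) hlam1 (s := fun x => (snZ τ x).re)
    (c := fun x => (cnZ τ x).re) (d := fun x => (dnZ τ x).re)]
  · push_cast
    rw [← hkap]
  · intro x
    have := (hasDerivAt_snZ hτ (hne x)).real_of_complex
    rw [hkap, hC x, hD x] at this
    refine this.congr_deriv ?_
    simp only [← Complex.ofReal_mul, Complex.ofReal_re]
  · intro x
    have := snZ_sq_add_cnZ_sq hτ (hne x)
    rw [hS x, hC x] at this
    exact_mod_cast this
  · intro x
    have := dnZ_sq_add hτ (hne x)
    rw [hS x, hD x, hlam] at this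
    exact_mod_cast this
  · intro x
    have := p4 x
    have := p3 x
    rw [eD x, Complex.ofReal_re]
    positivity
  · intro x hx
    have := p4 x
    have := p2 x hx
    rw [eC x, Complex.ofReal_re]
    positivity
  · simp [snZ_zero]
  · have := snZ_half hτ
    push_cast
    rw [this, Complex.one_re]

/-! ### The complete elliptic integral with complex parameter -/

/-- The integrand of the complete elliptic integral `K(m)`. -/
noncomputable def ellInt (m : ℂ) (θ : ℝ) : ℂ := (1 - m * (Real.sin θ : ℂ) ^ 2) ^ (-(1 / 2) : ℂ)

lemma ellK_eq_integral (m : ℂ) : ellK m = ∫ θ in (0 : ℝ)..(Real.pi / 2), ellInt m θ := rfl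

lemma measurable_ellInt (m : ℂ) : Measurable (ellInt m) := by
  unfold ellInt
  fun_prop

lemma norm_cpow_neg_half {z : ℂ} (hz : z ≠ 0) :
    ‖z ^ (-(1 / 2) : ℂ)‖ = ‖z‖ ^ (-(1 / 2) : ℝ) := by
  rw [Complex.norm_cpow_of_ne_zero hz]
  simp

lemma norm_cpow_neg_half_le {z : ℂ} (hz : z.re ≠ 0) :
    ‖z ^ (-(1 / 2) : ℂ)‖ ≤ |z.re| ^ (-(1 / 2) : ℝ) := by
  have h0 : z ≠ 0 := by rintro rfl; simp at hz
  rw [norm_cpow_neg_half h0]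
  exact Real.rpow_le_rpow_of_nonpos (abs_pos.2 hz) (Complex.abs_re_le_norm z) (by norm_num)

lemma one_sub_mul_sq_mem_slitPlane {m : ℂ} (hm : 1 - m ∈ slitPlane) (θ : ℝ) :
    1 - m * (Real.sin θ : ℂ) ^ 2 ∈ slitPlane := by
  have := starConvex_one_slitPlane hm (a := 1 - Real.sin θ ^ 2) (b := Real.sin θ ^ 2)
    (by linarith [Real.sin_sq_le_one θ]) (sq_nonneg _) (by ring)
  convert this using 1
  simp only [Complex.real_smul]
  push_cast
  ring

lemma continuous_ellInt {m : ℂ} (hm : 1 - m ∈ slitPlane) : Continuous (ellInt m) := by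
  unfold ellInt
  exact Continuous.cpow (by fun_prop) continuous_const (one_sub_mul_sq_mem_slitPlane hm)

lemma abs_rpow_neg_half_le (x : ℝ) :
    |x| ^ (-(1 / 2) : ℝ) ≤ |x ^ (-(1 / 2) : ℝ)| + |(-x) ^ (-(1 / 2) : ℝ)| := by
  rcases le_total 0 x with h | h
  · rw [abs_of_nonneg h]
    exact (le_abs_self _).trans (le_add_of_nonneg_right (abs_nonneg _))
  · rw [abs_of_nonpos h]
    exact (le_abs_self _).trans (le_add_of_nonneg_left (abs_nonneg _))

/-- A lower bound for the radicand of `K(c)`, `c > 1`, near its zero `θ₀`. -/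
lemma exists_le_abs_one_sub_mul_sin_sq {c : ℝ} (hc : 1 < c) :
    ∃ A θ₀ : ℝ, 0 < A ∧ ∀ θ ∈ Set.Icc 0 (Real.pi / 2),
      A * |θ - θ₀| ≤ |1 - c * Real.sin θ ^ 2| := by
  have hpi := Real.pi_pos
  set u : ℝ := √(1 / c) with hu
  have hc0 : 0 < c := by linarith
  have husq : u ^ 2 = 1 / c := Real.sq_sqrt (by positivity)
  have hu0 : 0 < u := Real.sqrt_pos.2 (by positivity)
  have hu1 : u < 1 := by
    rw [hu, Real.sqrt_lt' one_pos, one_pow, div_lt_one hc0]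
    exact hc
  set θ₀ := Real.arcsin u with hθ₀
  have hs : Real.sin θ₀ = u := Real.sin_arcsin (by linarith) hu1.le
  have h0 : 0 < θ₀ := Real.arcsin_pos.2 hu0
  have h1 : θ₀ < Real.pi / 2 := Real.arcsin_lt_pi_div_two.2 hu1
  have hcos : 0 < Real.cos θ₀ := Real.cos_pos_of_mem_Ioo ⟨by linarith, h1⟩
  set δ := min u (Real.cos θ₀) with hδ
  have hδ0 : 0 < δ := lt_min hu0 hcos
  refine ⟨c * δ * (2 / Real.pi), θ₀, by positivity, fun θ hθ => ?_⟩
  have key : 1 - c * Real.sin θ ^ 2 = -(c * (Real.sin (θ + θ₀) * Real.sin (θ - θ₀))) := by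
    rw [Real.sin_add, Real.sin_sub]
    have e : Real.cos θ₀ ^ 2 = 1 - 1 / c := by
      rw [← husq, ← hs, Real.cos_sq']
    have e' : Real.cos θ ^ 2 = 1 - Real.sin θ ^ 2 := Real.cos_sq' θ
    have e'' : Real.sin θ₀ ^ 2 = 1 / c := by rw [hs, husq]
    have : (Real.sin θ * Real.cos θ₀ + Real.cos θ * Real.sin θ₀) *
        (Real.sin θ * Real.cos θ₀ - Real.cos θ * Real.sin θ₀) =
        Real.sin θ ^ 2 * Real.cos θ₀ ^ 2 - Real.cos θ ^ 2 * Real.sin θ₀ ^ 2 := by ring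
    rw [this, e, e', e'']
    field_simp
    ring
  have hsθ : 0 ≤ Real.sin θ := Real.sin_nonneg_of_nonneg_of_le_pi hθ.1 (by linarith [hθ.2])
  have hcθ : 0 ≤ Real.cos θ := Real.cos_nonneg_of_mem_Icc ⟨by linarith [hθ.1], hθ.2⟩
  have hsum : 1 ≤ Real.sin θ + Real.cos θ := by
    nlinarith [Real.sin_sq_add_cos_sq θ, mul_nonneg hsθ hcθ]
  have hplus : δ ≤ Real.sin (θ + θ₀) := by
    rw [Real.sin_add, hs]
    calc δ = δ * 1 := (mul_one _).symm
      _ ≤ δ * (Real.sin θ + Real.cos θ) := mul_le_mul_of_nonneg_left hsum hδ0.le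
      _ = Real.sin θ * δ + Real.cos θ * δ := by ring
      _ ≤ Real.sin θ * Real.cos θ₀ + Real.cos θ * u :=
        add_le_add (mul_le_mul_of_nonneg_left (min_le_right _ _) hsθ)
          (mul_le_mul_of_nonneg_left (min_le_left _ _) hcθ)
  have hminus : 2 / Real.pi * |θ - θ₀| ≤ |Real.sin (θ - θ₀)| :=
    Real.mul_abs_le_abs_sin (abs_le.2 ⟨by linarith [hθ.1], by linarith [hθ.2]⟩)
  rw [key, abs_neg, abs_mul, abs_mul, abs_of_pos hc0, mul_assoc, mul_assoc]
  refine mul_le_mul_of_nonneg_left ?_ hc0.le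
  refine mul_le_mul (hplus.trans (le_abs_self _)) hminus (by positivity) (abs_nonneg _)

/-- An integrable bound for the integrand of `K(m)`, uniform on a vertical line `Re m = c > 1`. -/
lemma exists_bound_ellInt {c : ℝ} (hc : 1 < c) :
    ∃ g : ℝ → ℝ, IntervalIntegrable g volume 0 (Real.pi / 2) ∧
      ∀ᵐ θ : ℝ, θ ∈ Set.uIoc 0 (Real.pi / 2) →
        1 - c * Real.sin θ ^ 2 ≠ 0 ∧ ∀ m : ℂ, m.re = c → ‖ellInt m θ‖ ≤ g θ := by
  obtain ⟨A, θ₀, hA, h⟩ := exists_le_abs_one_sub_mul_sin_sq hc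
  refine ⟨fun θ => A ^ (-(1 / 2) : ℝ) *
    (|(θ - θ₀) ^ (-(1 / 2) : ℝ)| + |(θ₀ - θ) ^ (-(1 / 2) : ℝ)|), ?_, ?_⟩
  · have i : ∀ a b : ℝ, IntervalIntegrable (fun x : ℝ => x ^ (-(1 / 2) : ℝ)) volume a b :=
      fun a b => intervalIntegral.intervalIntegrable_rpow' (by norm_num)
    have i1 := (i (0 - θ₀) (Real.pi / 2 - θ₀)).comp_sub_right θ₀
    have i2 := (i (θ₀ - 0) (θ₀ - Real.pi / 2)).comp_sub_left θ₀
    simp only [sub_add_cancel, sub_sub_cancel] at i1 i2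
    exact (i1.abs.add i2.abs).const_mul _
  · filter_upwards [Measure.ae_ne volume θ₀] with θ hne hθ
    rw [Set.uIoc_of_le (by positivity)] at hθ
    have hle := h θ ⟨hθ.1.le, hθ.2⟩
    have hpos : 0 < A * |θ - θ₀| := mul_pos hA (abs_pos.2 (sub_ne_zero.2 hne))
    have hne0 : 1 - c * Real.sin θ ^ 2 ≠ 0 := abs_pos.1 (hpos.trans_le hle)
    refine ⟨hne0, fun m hm => ?_⟩
    have hre : (1 - m * (Real.sin θ : ℂ) ^ 2).re = 1 - c * Real.sin θ ^ 2 := by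
      rw [← Complex.ofReal_pow, Complex.sub_re, Complex.re_mul_ofReal, hm, Complex.one_re]
    have h1 := norm_cpow_neg_half_le (z := 1 - m * (Real.sin θ : ℂ) ^ 2) (by rwa [hre])
    rw [hre] at h1
    refine h1.trans ((Real.rpow_le_rpow_of_nonpos hpos hle (by norm_num)).trans ?_)
    rw [Real.mul_rpow hA.le (abs_nonneg _)]
    have := abs_rpow_neg_half_le (θ - θ₀)
    rw [neg_sub] at this
    exact mul_le_mul_of_nonneg_left this (Real.rpow_nonneg hA.le _)

lemma one_sub_mem_slitPlane_or {m : ℂ} (hm : m ≠ 1) :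
    1 - m ∈ slitPlane ∨ (m.im = 0 ∧ 1 < m.re) := by
  by_cases h : 1 - m ∈ slitPlane
  · exact Or.inl h
  · right
    rw [Complex.mem_slitPlane_iff] at h
    push Not at h
    simp only [Complex.sub_re, Complex.one_re, Complex.sub_im, Complex.one_im, zero_sub,
      neg_eq_zero] at h
    refine ⟨h.2, lt_of_le_of_ne (by linarith [h.1]) fun h1 => hm ?_⟩
    exact Complex.ext h1.symm h.2

lemma intervalIntegrable_ellInt {m : ℂ} (hm : m ≠ 1) :
    IntervalIntegrable (ellInt m) volume 0 (Real.pi / 2) := by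
  rcases one_sub_mem_slitPlane_or hm with h | ⟨-, h⟩
  · exact (continuous_ellInt h).intervalIntegrable _ _
  · obtain ⟨g, hg, hb⟩ := exists_bound_ellInt h
    refine hg.mono_fun' (measurable_ellInt m).aestronglyMeasurable ?_
    rw [Filter.EventuallyLE, ae_restrict_iff' measurableSet_uIoc]
    filter_upwards [hb] with θ hθ hmem
    exact (hθ hmem).2 m rfl

/-! ### Positivity of the imaginary part of `τ` -/

lemma cpow_neg_half_mul_conj_re {z w : ℂ} (hz : z ≠ 0) (hw : w ≠ 0) :
    (z ^ (-(1 / 2) : ℂ) * conj (w ^ (-(1 / 2) : ℂ))).re =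
      Real.exp ((log z * (-(1 / 2)) + conj (log w * (-(1 / 2)))).re) *
        Real.cos ((arg z - arg w) / 2) := by
  rw [Complex.cpow_def_of_ne_zero hz, Complex.cpow_def_of_ne_zero hw, ← Complex.exp_conj,
    ← Complex.exp_add, Complex.exp_re]
  congr 1
  rw [← Real.cos_neg]
  congr 1
  simp [Complex.log_im]
  ring

/-- A vector in the closed upper half plane lies at most a half turn ahead of a vector in the closed
lower half plane if their cross product has the right sign. -/
lemma abs_arg_sub_arg_le {z w : ℂ} (hz : 0 ≤ z.im) (hw : w.im ≤ 0)
    (h : 0 ≤ (z * conj w).im) : |arg z - arg w| ≤ Real.pi := by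
  have h1 := Complex.arg_le_pi z
  have h2 := Complex.neg_pi_lt_arg w
  have h3 := Complex.arg_nonneg_iff.2 hz
  have h4 := Complex.arg_le_pi w
  rcases le_or_gt (arg w) 0 with h5 | h5
  · rw [abs_of_nonneg (by linarith)]
    by_contra! hlt
    have hs : Real.sin (arg z - arg w) < 0 := by
      rw [← Real.sin_sub_two_pi]
      exact Real.sin_neg_of_neg_of_neg_pi_lt (by linarith) (by linarith)
    have e : (z * conj w).im = ‖z‖ * ‖w‖ * Real.sin (arg z - arg w) := by
      rw [Real.sin_sub]
      have a1 := Complex.norm_mul_cos_arg z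
      have a2 := Complex.norm_mul_sin_arg z
      have a3 := Complex.norm_mul_cos_arg w
      have a4 := Complex.norm_mul_sin_arg w
      rw [Complex.mul_im, Complex.conj_re, Complex.conj_im, ← a1, ← a2, ← a3, ← a4]
      ring
    rcases eq_or_ne z 0 with rfl | hz0
    · simp at hlt
      linarith
    rcases eq_or_ne w 0 with rfl | hw0
    · simp at hlt
      linarith
    have : 0 < ‖z‖ * ‖w‖ := mul_pos (norm_pos_iff.2 hz0) (norm_pos_iff.2 hw0)
    rw [e] at h
    nlinarith
  · exact abs_le.2 ⟨by linarith, by linarith⟩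

lemma cos_half_nonneg {x : ℝ} (h : |x| ≤ Real.pi) : 0 ≤ Real.cos (x / 2) := by
  rw [abs_le] at h
  exact Real.cos_nonneg_of_mem_Icc ⟨by linarith [h.1], by linarith [h.2]⟩

lemma cpow_neg_half_mul_conj_re_nonneg {z w : ℂ} (h : |arg z - arg w| ≤ Real.pi) :
    0 ≤ (z ^ (-(1 / 2) : ℂ) * conj (w ^ (-(1 / 2) : ℂ))).re := by
  -- at a zero of the radicand the power takes the value `0`
  rcases eq_or_ne z 0 with rfl | hz
  · simp
  rcases eq_or_ne w 0 with rfl | hw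
  · simp
  rw [cpow_neg_half_mul_conj_re hz hw]
  exact mul_nonneg (Real.exp_pos _).le (cos_half_nonneg h)

/-- The integrands of `K(1-m)` and `K(m)` always enclose an angle of at most `π/2`: the radicands
lie on the segments from `1` to `m` and from `1` to `1 - m`. -/
lemma ellInt_mul_conj_re_nonneg (m : ℂ) (θ φ : ℝ) :
    0 ≤ (ellInt (1 - m) θ * conj (ellInt m φ)).re := by
  set s := Real.sin θ ^ 2 with hs
  set t := Real.sin φ ^ 2 with ht
  have s0 : 0 ≤ s := sq_nonneg _
  have s1 : s ≤ 1 := Real.sin_sq_le_one θ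
  have t0 : 0 ≤ t := sq_nonneg _
  have e : ((1 - (1 - m) * (s : ℂ)) * conj (1 - m * (t : ℂ))).im =
      m.im * (s + (1 - s) * t) := by
    simp
    ring
  have i1 : (1 - (1 - m) * (s : ℂ)).im = m.im * s := by simp
  have i2 : (1 - m * (t : ℂ)).im = -(m.im * t) := by simp
  have hst : 0 ≤ s + (1 - s) * t := add_nonneg s0 (mul_nonneg (by linarith) t0)
  unfold ellInt
  rw [← Complex.ofReal_pow, ← Complex.ofReal_pow, ← hs, ← ht]
  refine cpow_neg_half_mul_conj_re_nonneg ?_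
  rcases le_total 0 m.im with h | h
  · refine abs_arg_sub_arg_le ?_ ?_ ?_
    · rw [i1]; positivity
    · rw [i2]; linarith [mul_nonneg h t0]
    · rw [e]; positivity
  · rw [abs_sub_comm]
    refine abs_arg_sub_arg_le ?_ ?_ ?_
    · rw [i2]; linarith [mul_nonpos_of_nonpos_of_nonneg h t0]
    · rw [i1]; exact mul_nonpos_of_nonpos_of_nonneg h s0
    · have : ((1 - m * (t : ℂ)) * conj (1 - (1 - m) * (s : ℂ))).im =
          -((1 - (1 - m) * (s : ℂ)) * conj (1 - m * (t : ℂ))).im := by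
        simp only [Complex.mul_im, Complex.conj_re, Complex.conj_im]
        ring
      rw [this, e]
      linarith [mul_nonpos_of_nonpos_of_nonneg h hst]

lemma ellInt_zero_right (m : ℂ) : ellInt m 0 = 1 := by simp [ellInt]

lemma continuousAt_ellInt_zero (m : ℂ) : ContinuousAt (ellInt m) 0 := by
  unfold ellInt
  refine ContinuousAt.cpow (by fun_prop) continuousAt_const ?_
  simp

/-- A nonnegative integrable function that is continuous and positive at the left end point has
a positive integral. -/
lemma integral_pos_of_continuousAt {f : ℝ → ℝ} {b : ℝ} (hb : 0 < b)
    (hf : IntervalIntegrable f volume 0 b) (h0 : ∀ x, 0 ≤ f x) (hc : ContinuousAt f 0)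
    (hpos : 0 < f 0) : 0 < ∫ x in (0 : ℝ)..b, f x := by
  rw [intervalIntegral.integral_pos_iff_support_of_nonneg_ae (Eventually.of_forall h0) hf]
  refine ⟨hb, ?_⟩
  obtain ⟨ε, hε, h⟩ := Metric.eventually_nhds_iff.1 (hc.eventually (lt_mem_nhds hpos))
  have hsub : Set.Ioo 0 (min ε b) ⊆ Function.support f ∩ Set.Ioc 0 b := by
    intro x hx
    refine ⟨(h ?_).ne', hx.1, (hx.2.trans_le (min_le_right _ _)).le⟩
    rw [Real.dist_eq, sub_zero, abs_of_pos hx.1]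
    exact hx.2.trans_le (min_le_left _ _)
  refine lt_of_lt_of_le ?_ (measure_mono hsub)
  rw [Real.volume_Ioo]
  simp [hε, hb]

lemma re_integral {f : ℝ → ℂ} {a b : ℝ} (hf : IntervalIntegrable f volume a b) :
    (∫ x in a..b, f x).re = ∫ x in a..b, (f x).re :=
  (Complex.reCLM.intervalIntegral_comp_comm hf).symm

lemma intervalIntegrable_re {f : ℝ → ℂ} {a b : ℝ} (hf : IntervalIntegrable f volume a b) :
    IntervalIntegrable (fun x => (f x).re) volume a b :=
  ⟨hf.1.re, hf.2.re⟩

/-- The real part of `K(m)` is positive, with no restriction on `m` but `m ≠ 1`: the integrand of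
`K(m)` has nonnegative real part, as it encloses an angle of at most `π/2` with the value `1` that
the integrand of `K(1-m)` takes at `0`. -/
lemma ellK_re_pos {m : ℂ} (hm : m ≠ 1) : 0 < (ellK m).re := by
  have hi := intervalIntegrable_ellInt hm
  rw [ellK_eq_integral, re_integral hi]
  refine integral_pos_of_continuousAt (by positivity) (intervalIntegrable_re hi) (fun θ => ?_)
    (Complex.continuous_re.continuousAt.comp (continuousAt_ellInt_zero m)) ?_
  · have := ellInt_mul_conj_re_nonneg (1 - m) θ 0
    simpa [ellInt_zero_right] using this
  · simp [ellInt_zero_right]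

lemma ellK_ne_zero {m : ℂ} (hm : m ≠ 1) : ellK m ≠ 0 := by
  intro h
  have := ellK_re_pos hm
  simp [h] at this

lemma ellK_mul_conj_re_pos {m : ℂ} (hm0 : m ≠ 0) (hm1 : m ≠ 1) :
    0 < (ellK (1 - m) * conj (ellK m)).re := by
  have hm0' : 1 - m ≠ 1 := fun h => hm0 (by linear_combination -h)
  have hi := intervalIntegrable_ellInt hm1
  have hi' := intervalIntegrable_ellInt hm0'
  -- the integral over the first variable is nonnegative, and positive at `φ = 0`
  have hin : ∀ φ, 0 ≤ (ellK (1 - m) * conj (ellInt m φ)).re := by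
    intro φ
    rw [ellK_eq_integral, ← intervalIntegral.integral_mul_const, re_integral (hi'.mul_const _)]
    exact intervalIntegral.integral_nonneg (by positivity)
      fun θ _ => ellInt_mul_conj_re_nonneg m θ φ
  have hic : IntervalIntegrable (fun φ => conj (ellInt m φ)) volume 0 (Real.pi / 2) :=
    ⟨(Complex.conjCLE : ℂ →L[ℝ] ℂ).integrable_comp hi.1,
      (Complex.conjCLE : ℂ →L[ℝ] ℂ).integrable_comp hi.2⟩
  have hcj : conj (ellK m) = ∫ φ in (0 : ℝ)..(Real.pi / 2), conj (ellInt m φ) :=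
    ((Complex.conjCLE : ℂ →L[ℝ] ℂ).intervalIntegral_comp_comm hi).symm
  rw [hcj, ← intervalIntegral.integral_const_mul, re_integral (hic.const_mul _)]
  refine integral_pos_of_continuousAt (by positivity) (intervalIntegrable_re (hic.const_mul _))
    hin ?_ ?_
  · refine Complex.continuous_re.continuousAt.comp (ContinuousAt.mul continuousAt_const ?_)
    exact Complex.continuous_conj.continuousAt.comp (continuousAt_ellInt_zero m)
  · simpa [ellInt_zero_right] using ellK_re_pos hm0'

/-- The half-period ratio `τ` lies in the upper half plane for every `m ≠ 0, 1`. -/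
theorem ellTau_im_pos {m : ℂ} (hm0 : m ≠ 0) (hm1 : m ≠ 1) : 0 < (ellTau m).im := by
  have hK := ellK_ne_zero hm1
  have h := ellK_mul_conj_re_pos hm0 hm1
  rw [ellTau, mul_div_assoc, Complex.I_mul_im, div_eq_inv_mul, Complex.inv_def]
  rw [show conj (ellK m) * ((normSq (ellK m))⁻¹ : ℝ) * ellK (1 - m) =
    ((normSq (ellK m))⁻¹ : ℝ) * (ellK (1 - m) * conj (ellK m)) by ring, Complex.re_ofReal_mul]
  exact mul_pos (inv_pos.2 (normSq_pos.2 hK)) h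

/-! ### Jacobi's inversion theorem -/

lemma isOpen_one_sub_mem_slitPlane : IsOpen {m : ℂ | 1 - m ∈ slitPlane} :=
  isOpen_slitPlane.preimage (by fun_prop)

lemma differentiableAt_ellK {m : ℂ} (hm : 1 - m ∈ slitPlane) : DifferentiableAt ℂ ellK m := by
  obtain ⟨r, hr, hball⟩ := Metric.nhds_basis_closedBall.mem_iff.1
    (isOpen_one_sub_mem_slitPlane.mem_nhds hm)
  set F' : ℂ → ℝ → ℂ := fun m θ =>
    -(1 / 2) * (1 - m * (Real.sin θ : ℂ) ^ 2) ^ (-(1 / 2) - 1 : ℂ) *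
      (-(Real.sin θ : ℂ) ^ 2) with hF'
  have hcont : ContinuousOn (fun p : ℂ × ℝ => F' p.1 p.2)
      (Metric.closedBall m r ×ˢ Set.uIcc 0 (Real.pi / 2)) := by
    refine ContinuousOn.mul (ContinuousOn.mul continuousOn_const ?_) (by fun_prop)
    refine ContinuousOn.cpow (by fun_prop) continuousOn_const fun p hp => ?_
    exact one_sub_mul_sq_mem_slitPlane (hball hp.1) p.2
  obtain ⟨C, hC⟩ := ((isCompact_closedBall m r).prod isCompact_uIcc).exists_bound_of_continuousOn
    hcont
  have hd : ∀ x, 1 - x ∈ slitPlane → ∀ θ, HasDerivAt (fun x => ellInt x θ) (F' x θ) x := by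
    intro x hx θ
    have h1 : HasDerivAt (fun x : ℂ => 1 - x * (Real.sin θ : ℂ) ^ 2) (-(Real.sin θ : ℂ) ^ 2) x := by
      simpa using ((hasDerivAt_id' x).mul_const ((Real.sin θ : ℂ) ^ 2)).const_sub 1
    exact h1.cpow_const (one_sub_mul_sq_mem_slitPlane hx θ)
  have hF'c : Continuous (F' m) := by
    refine Continuous.mul (Continuous.mul continuous_const ?_) (by fun_prop)
    exact Continuous.cpow (by fun_prop) continuous_const (one_sub_mul_sq_mem_slitPlane hm)
  refine (intervalIntegral.hasDerivAt_integral_of_dominated_loc_of_deriv_le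
    (F := ellInt) (F' := F') (bound := fun _ => C) (s := Metric.closedBall m r)
    (Metric.closedBall_mem_nhds m hr) (Eventually.of_forall fun x =>
      (measurable_ellInt x).aestronglyMeasurable) ((continuous_ellInt hm).intervalIntegrable _ _)
    hF'c.aestronglyMeasurable (Eventually.of_forall fun θ hθ x hx => ?_)
    intervalIntegrable_const (Eventually.of_forall fun θ _ x hx => ?_)).2.differentiableAt
  · exact hC (x, θ) ⟨hx, Set.uIoc_subset_uIcc hθ⟩
  · exact hd x (hball hx) θ

/-- On the cut `m > 1`, `K` is continuous from below. -/
lemma tendsto_ellK_sub {c : ℝ} (hc : 1 < c) :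
    Tendsto (fun ε : ℝ => ellK (c - ε * I)) (𝓝[>] 0) (𝓝 (ellK c)) := by
  obtain ⟨g, hg, hb⟩ := exists_bound_ellInt hc
  refine intervalIntegral.tendsto_integral_filter_of_dominated_convergence g
    (Eventually.of_forall fun ε => (measurable_ellInt _).aestronglyMeasurable)
    (Eventually.of_forall fun ε => ?_) hg ?_
  · filter_upwards [hb] with θ hθ hmem
    exact (hθ hmem).2 _ (by simp)
  · filter_upwards [hb] with θ hθ hmem
    have hne := (hθ hmem).1
    have hlin : Tendsto (fun ε : ℝ => 1 - (c - ε * I) * (Real.sin θ : ℂ) ^ 2) (𝓝[>] 0)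
        (𝓝 (1 - (c : ℂ) * (Real.sin θ : ℂ) ^ 2)) := by
      have : Continuous fun ε : ℝ => 1 - ((c : ℂ) - ε * I) * (Real.sin θ : ℂ) ^ 2 := by fun_prop
      have := this.tendsto 0
      simp only [Complex.ofReal_zero, zero_mul, sub_zero] at this
      exact this.mono_left nhdsWithin_le_nhds
    have hval : (1 - (c : ℂ) * (Real.sin θ : ℂ) ^ 2) = ((1 - c * Real.sin θ ^ 2 : ℝ) : ℂ) := by
      push_cast
      rfl
    rcases lt_or_gt_of_ne hne with hlt | hgt
    · -- the radicand approaches a negative real number from the upper half plane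
      have hlog := continuousWithinAt_log_of_re_neg_of_im_zero
        (z := 1 - (c : ℂ) * (Real.sin θ : ℂ) ^ 2) (by rw [hval]; exact hlt)
        (by rw [hval]; exact Complex.ofReal_im _)
      have hin : Tendsto (fun ε : ℝ => 1 - (c - ε * I) * (Real.sin θ : ℂ) ^ 2) (𝓝[>] 0)
          (𝓝[{z | 0 ≤ z.im}] (1 - (c : ℂ) * (Real.sin θ : ℂ) ^ 2)) := by
        refine tendsto_nhdsWithin_iff.2 ⟨hlin, ?_⟩
        filter_upwards [self_mem_nhdsWithin] with ε hε
        have : (1 - ((c : ℂ) - ε * I) * (Real.sin θ : ℂ) ^ 2).im = ε * Real.sin θ ^ 2 := by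
          rw [← Complex.ofReal_pow, Complex.sub_im, Complex.im_mul_ofReal]
          simp
        rw [this]
        exact mul_nonneg (le_of_lt hε) (sq_nonneg _)
      have h0 : 1 - (c : ℂ) * (Real.sin θ : ℂ) ^ 2 ≠ 0 := by
        rw [hval]
        exact_mod_cast hne
      have hev := hlin.eventually_ne h0
      have := (Complex.continuous_exp.tendsto _).comp
        ((hlog.tendsto.comp hin).mul_const (-(1 / 2) : ℂ))
      rw [Complex.cpow_def_of_ne_zero h0]
      refine this.congr' ?_
      filter_upwards [hev] with ε hε
      rw [Complex.cpow_def_of_ne_zero hε]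
      rfl
    · have hs : 1 - (c : ℂ) * (Real.sin θ : ℂ) ^ 2 ∈ slitPlane := by
        rw [hval]
        exact Complex.ofReal_mem_slitPlane.2 hgt
      exact hlin.cpow tendsto_const_nhds hs

/-! ### Dependence of the theta constants on `τ` -/

lemma differentiableAt_jacobiTheta₂_comp {τ : ℂ} (hτ : 0 < τ.im) (a b : ℂ) :
    DifferentiableAt ℂ (fun t => jacobiTheta₂ (a + b * t) t) τ := by
  have h := (hasFDerivAt_jacobiTheta₂ (a + b * τ) hτ).differentiableAt
  have hg : DifferentiableAt ℂ (fun t : ℂ => (a + b * t, t)) τ := by fun_prop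
  exact DifferentiableAt.comp (g := fun p : ℂ × ℂ => jacobiTheta₂ p.1 p.2)
    (f := fun t : ℂ => (a + b * t, t)) τ h hg

lemma differentiableAt_th3_zero {τ : ℂ} (hτ : 0 < τ.im) :
    DifferentiableAt ℂ (fun t => th3 t 0) τ := by
  simpa [th3] using differentiableAt_jacobiTheta₂_comp hτ 0 0

lemma differentiableAt_th4_zero {τ : ℂ} (hτ : 0 < τ.im) :
    DifferentiableAt ℂ (fun t => th4 t 0) τ := by
  simpa [th4] using differentiableAt_jacobiTheta₂_comp hτ (1 / 2) 0

lemma differentiableAt_th2_zero {τ : ℂ} (hτ : 0 < τ.im) :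
    DifferentiableAt ℂ (fun t => th2 t 0) τ := by
  have h := differentiableAt_jacobiTheta₂_comp hτ 0 (1 / 2)
  have e : (fun t => th2 t 0) = fun t => exp (Real.pi * I * 0 + Real.pi * I * t / 4) *
      jacobiTheta₂ (0 + 1 / 2 * t) t := by
    ext t
    rw [th2]
    congr 2
    ring
  rw [e]
  exact DifferentiableAt.mul (by fun_prop) h

lemma th1'_eq {τ : ℂ} (hτ : 0 < τ.im) :
    th1' τ = -I * exp (Real.pi * I * τ / 4) * jacobiTheta₂' (1 / 2 + τ / 2) τ := by
  have h0 : jacobiTheta₂ (1 / 2 + τ / 2) τ = 0 := by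
    have := th1_zero τ
    rw [th1, zero_add] at this
    simpa [Complex.exp_ne_zero] using this
  have hj : HasDerivAt (fun z => jacobiTheta₂ (z + 1 / 2 + τ / 2) τ)
      (jacobiTheta₂' (1 / 2 + τ / 2) τ) 0 := by
    have h := hasDerivAt_jacobiTheta₂_fst (0 + (1 / 2 + τ / 2)) hτ
    have := h.comp_add_const 0 (1 / 2 + τ / 2)
    simpa [add_assoc] using this
  have he : HasDerivAt (fun z => -I * exp (Real.pi * I * z + Real.pi * I * τ / 4))
      (-I * (exp (Real.pi * I * 0 + Real.pi * I * τ / 4) * (Real.pi * I * 1))) 0 :=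
    ((((hasDerivAt_id' (0 : ℂ)).const_mul (Real.pi * I : ℂ)).add_const _).cexp).const_mul (-I)
  have := (he.fun_mul hj).deriv
  rw [th1', show th1 τ = fun z => -I * exp (Real.pi * I * z + Real.pi * I * τ / 4) *
    jacobiTheta₂ (z + 1 / 2 + τ / 2) τ from rfl, this]
  simp only [zero_add, h0, mul_zero]

lemma differentiableAt_th1' {τ : ℂ} (hτ : 0 < τ.im) : DifferentiableAt ℂ th1' τ := by
  set T := τ.im / 2 with hT
  have hT0 : 0 < T := by positivity
  set S := τ.im with hS
  set U : Set ℂ := {t | T < t.im ∧ t.im < 2 * S} with hU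
  have hUo : IsOpen U :=
    (isOpen_lt continuous_const Complex.continuous_im).inter
      (isOpen_lt Complex.continuous_im continuous_const)
  have hmem : τ ∈ U := ⟨by rw [hT]; linarith, by linarith⟩
  -- the series of derivatives converges uniformly on a horizontal strip
  have hd : DifferentiableOn ℂ (fun t => jacobiTheta₂' (1 / 2 + t / 2) t) U := by
    refine differentiableOn_tsum_of_summable_norm
      (u := fun n : ℤ => 2 * Real.pi * |(n : ℝ)| *
        Real.exp (-Real.pi * (T * n ^ 2 - 2 * S * |(n : ℝ)|))) ?_ ?_ hUo ?_
    · have := (summable_pow_mul_jacobiTheta₂_term_bound S hT0 1).mul_left (2 * Real.pi)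
      refine this.congr fun n => ?_
      push_cast
      ring
    · intro n
      unfold jacobiTheta₂'_term jacobiTheta₂_term
      fun_prop
    · intro n t ht
      have := norm_jacobiTheta₂'_term_le (S := S) hT0 (z := 1 / 2 + t / 2) (τ := t) ?_ ht.1.le n
      · exact_mod_cast this
      · have : (1 / 2 + t / 2 : ℂ).im = t.im / 2 := by
          simp
        rw [this, abs_of_pos (by linarith [ht.1])]
        linarith [ht.2]
  have hd' : DifferentiableAt ℂ (fun t => -I * exp (Real.pi * I * t / 4) *
      jacobiTheta₂' (1 / 2 + t / 2) t) τ :=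
    DifferentiableAt.mul (by fun_prop) (hd.differentiableAt (hUo.mem_nhds hmem))
  refine hd'.congr_of_eventuallyEq ?_
  filter_upwards [hUo.mem_nhds hmem] with t ht
  exact th1'_eq (hT0.trans ht.1)

lemma differentiableAt_lam {τ : ℂ} (hτ : 0 < τ.im) : DifferentiableAt ℂ lam τ :=
  ((differentiableAt_th2_zero hτ).fun_pow 4).fun_div ((differentiableAt_th3_zero hτ).fun_pow 4)
    (pow_ne_zero 4 (th3_zero_ne hτ))

lemma differentiableAt_kap {τ : ℂ} (hτ : 0 < τ.im) : DifferentiableAt ℂ kap τ :=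
  ((differentiableAt_th1' hτ).fun_mul (differentiableAt_th3_zero hτ)).fun_div
    ((differentiableAt_th2_zero hτ).fun_mul (differentiableAt_th4_zero hτ))
    (mul_ne_zero (th2_zero_ne hτ) (th4_zero_ne hτ))

/-! ### The inversion on the imaginary axis, and its continuation -/

lemma lam_ne_one {τ : ℂ} (hτ : 0 < τ.im) : lam τ ≠ 1 := by
  intro h
  have h1 := one_sub_lam hτ
  rw [h, sub_self] at h1
  exact div_ne_zero (pow_ne_zero 4 (th4_zero_ne hτ)) (pow_ne_zero 4 (th3_zero_ne hτ)) h1.symm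

lemma exists_lam_eq_ofReal {τ : ℂ} (hτ : 0 < τ.im) (hτ' : τ.re = 0) :
    ∃ r : ℝ, 0 < r ∧ r < 1 ∧ lam τ = r := by
  have hc : -conj τ = τ := by apply Complex.ext <;> simp [hτ']
  have hr : ∀ {f : ℂ → ℂ}, (∀ z, conj (f z) = f (conj z)) → ∃ r : ℝ, f 0 = r := by
    intro f hf
    have := hf 0
    rw [map_zero] at this
    exact ⟨_, (Complex.conj_eq_iff_re.1 this).symm⟩
  obtain ⟨r2, h2⟩ := hr (conj_th2 hc)
  obtain ⟨r3, h3⟩ := hr (conj_th3 hc)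
  obtain ⟨r4, h4⟩ := hr (conj_th4 hc)
  have n2 : r2 ≠ 0 := fun h => th2_zero_ne hτ (by rw [h2, h, Complex.ofReal_zero])
  have n3 : r3 ≠ 0 := fun h => th3_zero_ne hτ (by rw [h3, h, Complex.ofReal_zero])
  have n4 : r4 ≠ 0 := fun h => th4_zero_ne hτ (by rw [h4, h, Complex.ofReal_zero])
  have e : ((1 - r2 ^ 4 / r3 ^ 4 : ℝ) : ℂ) = ((r4 ^ 4 / r3 ^ 4 : ℝ) : ℂ) := by
    have := one_sub_lam hτ
    rw [lam, h2, h3, h4] at this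
    exact_mod_cast this
  have e' : 1 - r2 ^ 4 / r3 ^ 4 = r4 ^ 4 / r3 ^ 4 := by exact_mod_cast e
  have pos : ∀ {x : ℝ}, x ≠ 0 → 0 < x ^ 4 := fun h => by positivity
  refine ⟨r2 ^ 4 / r3 ^ 4, div_pos (pos n2) (pos n3), ?_, ?_⟩
  · have := div_pos (pos n4) (pos n3)
    linarith
  · rw [lam, h2, h3]
    push_cast
    rfl

lemma ellTau_lam_of_re_eq_zero {τ : ℂ} (hτ : 0 < τ.im) (hτ' : τ.re = 0) :
    ellTau (lam τ) = τ := by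
  have h0 : τ ≠ 0 := by rintro rfl; simp at hτ
  have hK := ellK_lam_of_re_eq_zero hτ hτ'
  have hK' := ellK_lam_of_re_eq_zero (im_neg_one_div_pos hτ) (by simp [Complex.div_re, hτ'])
  rw [lam_modular hτ] at hK'
  have hne := ellK_ne_zero (lam_ne_one hτ)
  have hk := kap_modular hτ
  rw [ellTau, div_eq_iff hne, hK', hK, hk]
  field_simp

/-- The plane cut along `(-∞, 0]` and `[1, ∞)`. -/
def cutPlane : Set ℂ := {m | m ∈ slitPlane ∧ 1 - m ∈ slitPlane}

lemma isOpen_cutPlane : IsOpen cutPlane :=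
  isOpen_slitPlane.inter isOpen_one_sub_mem_slitPlane

lemma mem_cutPlane_iff {m : ℂ} : m ∈ cutPlane ↔ (0 < m.re ∧ m.re < 1) ∨ m.im ≠ 0 := by
  simp only [cutPlane, Set.mem_ofPred_eq, Complex.mem_slitPlane_iff, Complex.sub_re,
    Complex.one_re, Complex.sub_im, Complex.one_im, zero_sub, neg_ne_zero, sub_pos]
  tauto

lemma isPreconnected_cutPlane : IsPreconnected cutPlane := by
  have hs : StarConvex ℝ (1 / 2 : ℂ) cutPlane := by
    intro m hm a b ha hb hab
    rw [mem_cutPlane_iff] at hm ⊢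
    have hre : (a • (1 / 2 : ℂ) + b • m).re = a / 2 + b * m.re := by
      simp [Complex.real_smul, div_eq_mul_inv]
    have him : (a • (1 / 2 : ℂ) + b • m).im = b * m.im := by
      simp [Complex.real_smul]
    rw [hre, him]
    rcases hb.eq_or_lt with rfl | hb
    · left
      constructor <;> linarith
    · rcases hm with ⟨h1, h2⟩ | h
      · left
        constructor
        · have := mul_pos hb h1
          linarith
        · have : b * m.re < b := mul_lt_of_lt_one_right hb h2
          linarith
      · right
        exact mul_ne_zero hb.ne' h
  have hmem : (1 / 2 : ℂ) ∈ cutPlane := by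
    rw [mem_cutPlane_iff]
    left
    norm_num
  exact (hs.isPathConnected hmem).isConnected.isPreconnected

lemma cutPlane_ne_zero {m : ℂ} (hm : m ∈ cutPlane) : m ≠ 0 := slitPlane_ne_zero hm.1

lemma cutPlane_ne_one {m : ℂ} (hm : m ∈ cutPlane) : m ≠ 1 := by
  rintro rfl
  exact slitPlane_ne_zero hm.2 (sub_self 1)

lemma differentiableAt_ellTau {m : ℂ} (hm : m ∈ cutPlane) : DifferentiableAt ℂ ellTau m := by
  have h1 := differentiableAt_ellK hm.2
  have h2 : DifferentiableAt ℂ (fun m => ellK (1 - m)) m :=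
    DifferentiableAt.comp m (differentiableAt_ellK (m := 1 - m) (by simpa using hm.1))
      (by fun_prop)
  exact (h2.const_mul I).fun_div h1 (ellK_ne_zero (cutPlane_ne_one hm))

/-- The identity theorem on the cut plane, for identities known on the segment `(0, 1)`, which is
the image of the imaginary axis under `lam`. -/
lemma eq_on_cutPlane {f g : ℂ → ℂ} (hf : ∀ m ∈ cutPlane, DifferentiableAt ℂ f m)
    (hg : ∀ m ∈ cutPlane, DifferentiableAt ℂ g m)
    (h : ∀ τ : ℂ, 0 < τ.im → τ.re = 0 → f (lam τ) = g (lam τ)) :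
    Set.EqOn f g cutPlane := by
  have him : ∀ t : ℝ, ((t : ℂ) * I).im = t := fun t => by simp
  have hre : ∀ t : ℝ, ((t : ℂ) * I).re = 0 := fun t => by simp
  have hlam : ∀ t : ℝ, 0 < t → lam (t * I) ∈ cutPlane := by
    intro t ht
    obtain ⟨r, h0, h1, hr⟩ := exists_lam_eq_ofReal (by rw [him]; exact ht) (hre t)
    rw [mem_cutPlane_iff, hr]
    exact Or.inl ⟨h0, h1⟩
  refine AnalyticOnNhd.eqOn_of_preconnected_of_frequently_eq (z₀ := lam ((1 : ℝ) * I))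
    ((DifferentiableOn.analyticOnNhd fun m hm => (hf m hm).differentiableWithinAt) isOpen_cutPlane)
    ((DifferentiableOn.analyticOnNhd fun m hm => (hg m hm).differentiableWithinAt) isOpen_cutPlane)
    isPreconnected_cutPlane (hlam 1 one_pos) ?_
  have hpos : ∀ᶠ t : ℝ in 𝓝[≠] 1, 0 < t :=
    nhdsWithin_le_nhds (lt_mem_nhds one_pos)
  have ht : Tendsto (fun t : ℝ => lam (t * I)) (𝓝[≠] 1) (𝓝[≠] (lam ((1 : ℝ) * I))) := by
    refine tendsto_nhdsWithin_iff.2 ⟨?_, ?_⟩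
    · have hc : ContinuousAt lam ((1 : ℝ) * I) :=
        (differentiableAt_lam (by rw [him]; exact one_pos)).continuousAt
      have hl : ContinuousAt (fun t : ℝ => (t : ℂ) * I) 1 := by fun_prop
      exact (ContinuousAt.comp (f := fun t : ℝ => (t : ℂ) * I) (x := 1) hc hl).tendsto.mono_left
        nhdsWithin_le_nhds
    · filter_upwards [hpos, self_mem_nhdsWithin] with t ht hne heq
      -- `lam` is injective on the imaginary axis, with left inverse `ellTau`
      have h1 := ellTau_lam_of_re_eq_zero (τ := t * I) (by rw [him]; exact ht) (hre t)
      have h2 := ellTau_lam_of_re_eq_zero (τ := (1 : ℝ) * I) (by rw [him]; exact one_pos) (hre 1)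
      rw [Set.mem_singleton_iff] at heq
      rw [heq, h2] at h1
      have := mul_right_cancel₀ I_ne_zero h1
      exact hne (by exact_mod_cast this.symm)
  refine ht.frequently (Eventually.frequently ?_)
  filter_upwards [hpos] with t ht
  exact h _ (by rw [him]; exact ht) (hre t)

lemma inversion_on_cutPlane {m : ℂ} (hm : m ∈ cutPlane) :
    lam (ellTau m) = m ∧ kap (ellTau m) = 2 * ellK m := by
  have hτ : ∀ m ∈ cutPlane, 0 < (ellTau m).im := fun m hm =>
    ellTau_im_pos (cutPlane_ne_zero hm) (cutPlane_ne_one hm)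
  constructor
  · exact eq_on_cutPlane (f := fun m => lam (ellTau m)) (g := fun m => m)
      (fun m hm => (differentiableAt_lam (hτ m hm)).comp m (differentiableAt_ellTau hm))
      (fun m _ => differentiableAt_id)
      (fun τ h1 h2 => by simp only [ellTau_lam_of_re_eq_zero h1 h2]) hm
  · exact eq_on_cutPlane (f := fun m => kap (ellTau m)) (g := fun m => 2 * ellK m)
      (fun m hm => (differentiableAt_kap (hτ m hm)).comp m (differentiableAt_ellTau hm))
      (fun m hm => (differentiableAt_ellK hm.2).const_mul 2)
      (fun τ h1 h2 => by
        simp only [ellTau_lam_of_re_eq_zero h1 h2, ellK_lam_of_re_eq_zero h1 h2]; ring) hm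

/-- Passage to the limit from the cut plane. -/
lemma inversion_of_tendsto {m : ℂ} (hm0 : m ≠ 0) (hm1 : m ≠ 1) {u : ℝ → ℂ}
    (hu : Tendsto u (𝓝[>] 0) (𝓝 m)) (huc : ∀ᶠ ε in 𝓝[>] (0 : ℝ), u ε ∈ cutPlane)
    (hK : Tendsto (fun ε => ellK (u ε)) (𝓝[>] 0) (𝓝 (ellK m)))
    (hK' : Tendsto (fun ε => ellK (1 - u ε)) (𝓝[>] 0) (𝓝 (ellK (1 - m)))) :
    lam (ellTau m) = m ∧ kap (ellTau m) = 2 * ellK m := by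
  have hτ : Tendsto (fun ε => ellTau (u ε)) (𝓝[>] 0) (𝓝 (ellTau m)) :=
    (hK'.const_mul I).div hK (ellK_ne_zero hm1)
  have him := ellTau_im_pos hm0 hm1
  constructor
  · have h1 := (differentiableAt_lam him).continuousAt.tendsto.comp hτ
    refine tendsto_nhds_unique (h1.congr' ?_) hu
    filter_upwards [huc] with ε hε
    exact (inversion_on_cutPlane hε).1
  · have h1 := (differentiableAt_kap him).continuousAt.tendsto.comp hτ
    refine tendsto_nhds_unique (h1.congr' ?_) (hK.const_mul 2)
    filter_upwards [huc] with ε hε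
    exact (inversion_on_cutPlane hε).2

/-- Jacobi's inversion theorem for arbitrary complex parameter: the theta functions of nome
`exp (π i τ)`, `τ = i K(1-m)/K(m)`, have parameter `m` and quarter period `K(m)`.  It is
continued analytically from `0 < m < 1` to the cut plane, and by continuity to the cuts. -/
theorem jacobi_inversion {m : ℂ} (hm0 : m ≠ 0) (hm1 : m ≠ 1) :
    lam (ellTau m) = m ∧ kap (ellTau m) = 2 * ellK m := by
  by_cases hm : m ∈ cutPlane
  · exact inversion_on_cutPlane hm
  rw [mem_cutPlane_iff] at hm
  push Not at hm
  obtain ⟨hre, him⟩ := hm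
  have hmr : m = (m.re : ℂ) := Complex.ext rfl (by simpa using him)
  obtain ⟨c, hc⟩ : ∃ c, m.re = c := ⟨_, rfl⟩
  rw [hc] at hmr hre
  have hlim : ∀ (a : ℂ) (s : ℂ), Tendsto (fun ε : ℝ => a + s * ε * I) (𝓝[>] 0) (𝓝 a) := by
    intro a s
    have : Continuous fun ε : ℝ => a + s * ε * I := by fun_prop
    have := this.tendsto 0
    simp only [Complex.ofReal_zero, mul_zero, zero_mul, add_zero] at this
    exact this.mono_left nhdsWithin_le_nhds
  rcases lt_or_ge 0 c with h | h
  · have hc1 : 1 < c := lt_of_le_of_ne (hre h) fun h1 => hm1 (by rw [hmr, ← h1]; simp)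
    refine inversion_of_tendsto hm0 hm1 (u := fun ε : ℝ => m - ε * I) ?_ ?_ ?_ ?_
    · convert hlim m (-1) using 2
      ring
    · filter_upwards [self_mem_nhdsWithin] with ε hε
      rw [mem_cutPlane_iff]
      right
      simpa [him] using (Set.mem_Ioi.1 hε).ne'
    · rw [hmr]
      exact tendsto_ellK_sub hc1
    · have hs : 1 - (1 - m) ∈ slitPlane := by
        rw [sub_sub_cancel, hmr]
        exact Complex.ofReal_mem_slitPlane.2 h
      refine (differentiableAt_ellK hs).continuousAt.tendsto.comp ?_
      convert hlim (1 - m) 1 using 2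
      ring
  · have hc0 : c < 0 := lt_of_le_of_ne h fun h1 => hm0 (by rw [hmr, h1]; simp)
    refine inversion_of_tendsto hm0 hm1 (u := fun ε : ℝ => m + ε * I) ?_ ?_ ?_ ?_
    · convert hlim m 1 using 2
      ring
    · filter_upwards [self_mem_nhdsWithin] with ε hε
      rw [mem_cutPlane_iff]
      right
      simpa [him] using (Set.mem_Ioi.1 hε).ne'
    · have hs : 1 - m ∈ slitPlane := by
        rw [hmr, ← Complex.ofReal_one, ← Complex.ofReal_sub]
        exact Complex.ofReal_mem_slitPlane.2 (by linarith)
      refine (differentiableAt_ellK hs).continuousAt.tendsto.comp ?_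
      convert hlim m 1 using 2
      ring
    · have := tendsto_ellK_sub (c := 1 - c) (by linarith)
      rw [hmr]
      push_cast at this
      convert this using 3
      ring

/-! ### Jacobi functions with complex parameter -/

lemma Theta_eq (m α : ℂ) : Theta m α = th4 (ellTau m) (α / (2 * ellK m)) := rfl

lemma Eta_eq (m α : ℂ) : Eta m α = th1 (ellTau m) (α / (2 * ellK m)) := rfl

lemma Theta₁_eq {m : ℂ} (hm1 : m ≠ 1) (α : ℂ) :
    Theta₁ m α = th3 (ellTau m) (α / (2 * ellK m)) := by
  have hK := ellK_ne_zero hm1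
  rw [Theta₁, Theta_eq, ← th4_add_half]
  congr 1
  field_simp

lemma Eta₁_eq {m : ℂ} (hm1 : m ≠ 1) (α : ℂ) :
    Eta₁ m α = th2 (ellTau m) (α / (2 * ellK m)) := by
  have hK := ellK_ne_zero hm1
  rw [Eta₁, Eta_eq, ← th1_add_half]
  congr 1
  field_simp

lemma sn_eq {m : ℂ} (hm1 : m ≠ 1) (α : ℂ) :
    sn m α = snZ (ellTau m) (α / (2 * ellK m)) := by
  rw [sn, snZ, Theta₁_eq hm1, Eta₁_eq hm1, zero_div]
  rfl

lemma cn_eq {m : ℂ} (hm1 : m ≠ 1) (α : ℂ) :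
    cn m α = cnZ (ellTau m) (α / (2 * ellK m)) := by
  rw [cn, cnZ, Eta₁_eq hm1, Eta₁_eq hm1, Theta_eq, Theta_eq, zero_div]

lemma dn_eq {m : ℂ} (hm1 : m ≠ 1) (α : ℂ) :
    dn m α = dnZ (ellTau m) (α / (2 * ellK m)) := by
  rw [dn, dnZ, Theta₁_eq hm1, Theta₁_eq hm1, Theta_eq, Theta_eq, zero_div]

lemma sn_sq_add_cn_sq {m : ℂ} (hm0 : m ≠ 0) (hm1 : m ≠ 1) {α : ℂ} (hα : Theta m α ≠ 0) :
    sn m α ^ 2 + cn m α ^ 2 = 1 := by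
  rw [sn_eq hm1, cn_eq hm1]
  exact snZ_sq_add_cnZ_sq (ellTau_im_pos hm0 hm1) hα

lemma dn_sq_add {m : ℂ} (hm0 : m ≠ 0) (hm1 : m ≠ 1) {α : ℂ} (hα : Theta m α ≠ 0) :
    dn m α ^ 2 + m * sn m α ^ 2 = 1 := by
  have := dnZ_sq_add (ellTau_im_pos hm0 hm1) hα
  rwa [(jacobi_inversion hm0 hm1).1, ← sn_eq hm1, ← dn_eq hm1] at this

lemma hasDerivAt_sn {m : ℂ} (hm0 : m ≠ 0) (hm1 : m ≠ 1) {α : ℂ} (hα : Theta m α ≠ 0) :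
    HasDerivAt (sn m) (cn m α * dn m α) α := by
  have hK := ellK_ne_zero hm1
  have h := hasDerivAt_snZ (ellTau_im_pos hm0 hm1) hα
  rw [(jacobi_inversion hm0 hm1).2, ← cn_eq hm1, ← dn_eq hm1] at h
  have hd : HasDerivAt (fun α : ℂ => α / (2 * ellK m)) (1 / (2 * ellK m)) α :=
    (hasDerivAt_id' α).div_const _
  have hc := h.comp α hd
  rw [show snZ (ellTau m) ∘ (fun α : ℂ => α / (2 * ellK m)) = sn m from
    funext fun α => (sn_eq hm1 α).symm] at hc
  refine hc.congr_deriv ?_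
  field_simp

lemma differentiable_Theta {m : ℂ} (hm0 : m ≠ 0) (hm1 : m ≠ 1) : Differentiable ℂ (Theta m) := by
  exact (differentiable_th4 (ellTau_im_pos hm0 hm1)).comp
    (differentiable_id.div_const (2 * ellK m))

lemma differentiable_Eta {m : ℂ} (hm0 : m ≠ 0) (hm1 : m ≠ 1) : Differentiable ℂ (Eta m) := by
  exact (differentiable_th1 (ellTau_im_pos hm0 hm1)).comp
    (differentiable_id.div_const (2 * ellK m))

lemma Theta_neg (m α : ℂ) : Theta m (-α) = Theta m α := by
  rw [Theta_eq, Theta_eq, neg_div, th4_neg]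

lemma sn_neg {m : ℂ} (hm1 : m ≠ 1) (α : ℂ) : sn m (-α) = -sn m α := by
  rw [sn_eq hm1, sn_eq hm1, neg_div, snZ, snZ, th1_neg, th4_neg]
  ring

lemma cn_neg {m : ℂ} (hm1 : m ≠ 1) (α : ℂ) : cn m (-α) = cn m α := by
  rw [cn_eq hm1, cn_eq hm1, neg_div, cnZ, cnZ, th2_neg, th4_neg]

lemma dn_neg {m : ℂ} (hm1 : m ≠ 1) (α : ℂ) : dn m (-α) = dn m α := by
  rw [dn_eq hm1, dn_eq hm1, neg_div, dnZ, dnZ, th3_neg, th4_neg]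

lemma add_two_ellK_div {m : ℂ} (hm1 : m ≠ 1) (α : ℂ) :
    (α + 2 * ellK m) / (2 * ellK m) = α / (2 * ellK m) + 1 := by
  have hK := ellK_ne_zero hm1
  field_simp

lemma Theta_add_two_ellK {m : ℂ} (hm1 : m ≠ 1) (α : ℂ) :
    Theta m (α + 2 * ellK m) = Theta m α := by
  rw [Theta_eq, Theta_eq, add_two_ellK_div hm1, th4_add_one]

lemma Eta_add_two_ellK {m : ℂ} (hm1 : m ≠ 1) (α : ℂ) :
    Eta m (α + 2 * ellK m) = -Eta m α := by
  rw [Eta_eq, Eta_eq, add_two_ellK_div hm1, th1_add_one]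

lemma sn_sq_add_two_ellK {m : ℂ} (hm1 : m ≠ 1) (α : ℂ) :
    sn m (α + 2 * ellK m) ^ 2 = sn m α ^ 2 := by
  rw [sn, sn, Theta_add_two_ellK hm1, Eta_add_two_ellK hm1]
  ring

lemma Zeta_eq {m : ℂ} (hm0 : m ≠ 0) (hm1 : m ≠ 1) (α : ℂ) :
    Zeta m α = deriv (th4 (ellTau m)) (α / (2 * ellK m)) /
      th4 (ellTau m) (α / (2 * ellK m)) / (2 * ellK m) := by
  have h := (differentiable_th4 (ellTau_im_pos hm0 hm1) (α / (2 * ellK m))).hasDerivAt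
  have hd : HasDerivAt (fun α : ℂ => α / (2 * ellK m)) (1 / (2 * ellK m)) α :=
    (hasDerivAt_id' α).div_const _
  have hc : HasDerivAt (Theta m) (deriv (th4 (ellTau m)) (α / (2 * ellK m)) *
      (1 / (2 * ellK m))) α :=
    HasDerivAt.comp (h₂ := th4 (ellTau m)) (h := fun α => α / (2 * ellK m)) α h hd
  rw [Zeta, hc.deriv, Theta_eq]
  ring

/-- The Jacobi zeta function under a shift by an element of the period lattice. -/
lemma Zeta_add_lattice {m : ℂ} (hm0 : m ≠ 0) (hm1 : m ≠ 1) {α : ℂ} (hα : Theta m α ≠ 0)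
    (j n : ℤ) :
    Zeta m (α + 2 * ellK m * (j + n * ellTau m)) = Zeta m α - n * (Real.pi * I / ellK m) := by
  have hK := ellK_ne_zero hm1
  have hτ := ellTau_im_pos hm0 hm1
  set τ := ellTau m
  have hd := differentiable_th4 hτ
  set L : ℂ → ℂ := fun z => deriv (th4 τ) z / th4 τ z with hL
  have L1 : Function.Periodic L 1 := by
    intro z
    simp only [hL]
    rw [← deriv_comp_add_const, show (fun w => th4 τ (w + 1)) = th4 τ from
      funext (th4_add_one τ), th4_add_one]
  have Lτ : ∀ z, th4 τ z ≠ 0 → th4 τ (z + τ) ≠ 0 ∧ L (z + τ) = L z - 2 * Real.pi * I := by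
    intro z hz
    have he := Complex.exp_ne_zero (-(2 * Real.pi * I * z) - Real.pi * I * τ)
    refine ⟨by rw [th4_add_tau]; exact mul_ne_zero (neg_ne_zero.2 he) hz, ?_⟩
    have hexp : HasDerivAt (fun w => -exp (-(2 * Real.pi * I * w) - Real.pi * I * τ))
        (-(exp (-(2 * Real.pi * I * z) - Real.pi * I * τ) * -(2 * Real.pi * I))) z := by
      simpa using ((((hasDerivAt_id' z).const_mul (2 * Real.pi * I)).fun_neg).sub_const
        (Real.pi * I * τ)).cexp.fun_neg
    have h1 := (hexp.fun_mul (hd z).hasDerivAt).deriv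
    simp only [hL]
    rw [← deriv_comp_add_const, show (fun w => th4 τ (w + τ)) = _ from funext (th4_add_tau τ),
      h1, th4_add_tau]
    field_simp
    ring
  have Ln : ∀ n : ℕ, ∀ z, th4 τ z ≠ 0 →
      th4 τ (z + n * τ) ≠ 0 ∧ L (z + n * τ) = L z - n * (2 * Real.pi * I) := by
    intro n
    induction n with
    | zero => intro z hz; simpa using hz
    | succ n ih =>
      intro z hz
      obtain ⟨h1, h2⟩ := ih z hz
      obtain ⟨h3, h4⟩ := Lτ _ h1
      rw [show z + ((n + 1 : ℕ) : ℂ) * τ = z + n * τ + τ by push_cast; ring]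
      refine ⟨h3, ?_⟩
      rw [h4, h2]
      push_cast
      ring
  have ne_of : ∀ n : ℕ, ∀ z, th4 τ z ≠ 0 → th4 τ (z - n * τ) ≠ 0 := by
    intro n z hz
    rw [← th4_neg, show -(z - n * τ) = -z + n * τ by ring]
    exact (Ln n (-z) (by rwa [th4_neg])).1
  have Lz : ∀ n : ℤ, ∀ z, th4 τ z ≠ 0 → L (z + n * τ) = L z - n * (2 * Real.pi * I) := by
    intro n z hz
    rcases Int.eq_nat_or_neg n with ⟨k, rfl | rfl⟩
    · exact_mod_cast (Ln k z hz).2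
    · have := (Ln k (z - k * τ) (ne_of k z hz)).2
      rw [sub_add_cancel] at this
      push_cast
      rw [show z + -(k : ℂ) * τ = z - k * τ by ring, this]
      ring
  rw [Zeta_eq hm0 hm1, Zeta_eq hm0 hm1]
  change L _ / _ = L _ / _ - _
  have e : (α + 2 * ellK m * (j + n * τ)) / (2 * ellK m) =
      (α / (2 * ellK m) + n * τ) + j * 1 := by
    field_simp
    ring
  rw [e, L1.int_mul j, Lz n _ hα]
  field_simp

/-! ### The parametrization of the elliptic curve -/

/-- The abscissa `x = m sn²(α) - (m+1)/3` of the point with parameter `α` of the curve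
`y² = 4x³ - g₂x - g₃`. -/
noncomputable def jX (m α : ℂ) : ℂ := m * sn m α ^ 2 - 1 / 3 * (m + 1)

/-- The ordinate `y = 2m sn(α) cn(α) dn(α) = dx/dα` of the point with parameter `α`. -/
noncomputable def jY (m α : ℂ) : ℂ := 2 * m * sn m α * cn m α * dn m α

lemma hasDerivAt_jX {m : ℂ} (hm0 : m ≠ 0) (hm1 : m ≠ 1) {α : ℂ} (hα : Theta m α ≠ 0) :
    HasDerivAt (jX m) (jY m α) α := by
  refine (((hasDerivAt_sn hm0 hm1 hα).fun_pow 2).const_mul m |>.sub_const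
    (1 / 3 * (m + 1))).congr_deriv ?_
  rw [jY]
  push_cast
  ring

lemma jY_sq {m : ℂ} (hm0 : m ≠ 0) (hm1 : m ≠ 1) {α : ℂ} (hα : Theta m α ≠ 0) :
    jY m α ^ 2 = 4 * jX m α ^ 3 - g2J m * jX m α - g3J m := by
  have h1 : cn m α ^ 2 = 1 - sn m α ^ 2 := by linear_combination sn_sq_add_cn_sq hm0 hm1 hα
  have h2 : dn m α ^ 2 = 1 - m * sn m α ^ 2 := by linear_combination dn_sq_add hm0 hm1 hα
  have : jY m α ^ 2 = 4 * m ^ 2 * sn m α ^ 2 * cn m α ^ 2 * dn m α ^ 2 := by rw [jY]; ring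
  rw [this, h1, h2, jX, g2J, g3J]
  ring

lemma jX_neg {m : ℂ} (hm1 : m ≠ 1) (α : ℂ) : jX m (-α) = jX m α := by
  rw [jX, jX, sn_neg hm1]; ring

lemma jY_neg {m : ℂ} (hm1 : m ≠ 1) (α : ℂ) : jY m (-α) = -jY m α := by
  rw [jY, jY, sn_neg hm1, cn_neg hm1, dn_neg hm1]; ring

lemma jX_eq {m : ℂ} (hm1 : m ≠ 1) (α : ℂ) :
    jX m α = m * (th3 (ellTau m) 0 ^ 2 / th2 (ellTau m) 0 ^ 2) *
      (th1 (ellTau m) (α / (2 * ellK m)) ^ 2 / th4 (ellTau m) (α / (2 * ellK m)) ^ 2) -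
      1 / 3 * (m + 1) := by
  rw [jX, sn_eq hm1, snZ]
  ring

/-- Every finite point of the curve has a parameter `α`. -/
theorem exists_jX_eq_jY_eq {m : ℂ} (hm0 : m ≠ 0) (hm1 : m ≠ 1) {x₀ y₀ : ℂ}
    (h : y₀ ^ 2 = 4 * x₀ ^ 3 - g2J m * x₀ - g3J m) :
    ∃ α, Theta m α ≠ 0 ∧ jX m α = x₀ ∧ jY m α = y₀ := by
  have hτ := ellTau_im_pos hm0 hm1
  have hK := ellK_ne_zero hm1
  obtain ⟨τ, hτe⟩ : ∃ τ, ellTau m = τ := ⟨_, rfl⟩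
  rw [hτe] at hτ
  have n2 := th2_zero_ne hτ
  have n3 := th3_zero_ne hτ
  have n4 := th4_zero_ne hτ
  set c := m * (th3 τ 0 ^ 2 / th2 τ 0 ^ 2) with hc
  have hc0 : c ≠ 0 := by rw [hc]; positivity
  set w := (x₀ + 1 / 3 * (m + 1)) / c with hw
  -- the equation `θ₁² = w θ₄²` in terms of the basis of even theta functions of order two
  obtain ⟨z, hz⟩ := exists_zero_thA_thB hτ (thB τ 0 - w * thA τ 0) (w * thB τ 0 - thA τ 0)
  have hz' : th1 τ z ^ 2 = w * th4 τ z ^ 2 := by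
    rw [th1_sq hτ, th4_sq hτ]
    linear_combination hz
  have hz4 : th4 τ z ≠ 0 := by
    intro h4
    have h1 : th1 τ z = 0 := by simpa [h4] using hz'
    obtain ⟨j, n, e1⟩ := exists_int_of_th1_eq_zero hτ h1
    obtain ⟨j', n', e2⟩ := exists_int_of_th4_eq_zero hτ h4
    have him := congrArg Complex.im (e1.symm.trans e2)
    have e : ((j' : ℂ) + (n' + 1 / 2) * τ).im = (n' + 1 / 2 : ℝ) * τ.im := by
      have : ((n' : ℂ) + 1 / 2) = ((n' + 1 / 2 : ℝ) : ℂ) := by push_cast; rfl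
      rw [this, Complex.add_im, Complex.im_ofReal_mul, Complex.intCast_im, zero_add]
    rw [im_int_add_int_mul, e] at him
    have h2 := mul_right_cancel₀ hτ.ne' him
    have : (2 * n : ℝ) = 2 * n' + 1 := by linarith
    have : (2 * n : ℤ) = 2 * n' + 1 := by exact_mod_cast this
    omega
  have hdiv : 2 * ellK m * z / (2 * ellK m) = z := by field_simp
  have hα : Theta m (2 * ellK m * z) ≠ 0 := by rwa [Theta_eq, hdiv, hτe]
  have hX : jX m (2 * ellK m * z) = x₀ := by
    rw [jX_eq hm1, hdiv, hτe, hz', ← hc, mul_div_cancel_right₀ _ (pow_ne_zero 2 hz4), hw]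
    field_simp
    ring
  have hY := jY_sq hm0 hm1 hα
  rw [hX, ← h] at hY
  rcases sq_eq_sq_iff_eq_or_eq_neg.1 hY with hY | hY
  · exact ⟨_, hα, hX, hY⟩
  · exact ⟨-(2 * ellK m * z), by rwa [Theta_neg], by rw [jX_neg hm1, hX],
      by rw [jY_neg hm1, hY, neg_neg]⟩

/-- The difference of two abscissas as a product of theta functions. -/
lemma jX_sub_jX {m : ℂ} (hm0 : m ≠ 0) (hm1 : m ≠ 1) {α β : ℂ} (hα : Theta m α ≠ 0)
    (hβ : Theta m β ≠ 0) :
    (jX m α - jX m β) * (Theta m α ^ 2 * Theta m β ^ 2) =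
      m * (th3 (ellTau m) 0 ^ 2 / th2 (ellTau m) 0 ^ 2) * th4 (ellTau m) 0 ^ 2 *
        (Eta m (α + β) * Eta m (α - β)) := by
  have hτ := ellTau_im_pos hm0 hm1
  have h := th1_add_mul_th1_sub' hτ (α / (2 * ellK m)) (β / (2 * ellK m))
  rw [Theta_eq] at hα hβ
  rw [jX_eq hm1, jX_eq hm1, Theta_eq, Theta_eq, Eta_eq, Eta_eq, add_div, sub_div]
  have n2 := th2_zero_ne hτ
  generalize α / (2 * ellK m) = z at *
  generalize β / (2 * ellK m) = w at *
  field_simp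
  linear_combination -3 * m * th3 (ellTau m) 0 ^ 2 * h

/-- The function `jX` is doubly periodic. -/
lemma jX_add_lattice {m : ℂ} (hm1 : m ≠ 1) (j n : ℤ) (α : ℂ) :
    jX m (α + 2 * ellK m * (j + n * ellTau m)) = jX m α := by
  have hK := ellK_ne_zero hm1
  have h1 : Function.Periodic (jX m) (2 * ellK m) := fun γ => by
    rw [jX, jX, sn_sq_add_two_ellK hm1]
  have h2 : Function.Periodic (jX m) (2 * ellK m * ellTau m) := fun γ => by
    have e : (γ + 2 * ellK m * ellTau m) / (2 * ellK m) = γ / (2 * ellK m) + ellTau m := by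
      field_simp
    rw [jX_eq hm1, jX_eq hm1, e, th1_add_tau, th4_add_tau, mul_pow, mul_pow, mul_div_mul_left]
    exact pow_ne_zero 2 (neg_ne_zero.2 (Complex.exp_ne_zero _))
  rw [show α + 2 * ellK m * (j + n * ellTau m) =
    α + j * (2 * ellK m) + n * (2 * ellK m * ellTau m) by ring, h2.int_mul n, h1.int_mul j]

/-- The parameter of a point of the curve is determined up to the period lattice. -/
theorem exists_int_of_jX_eq_jY_eq {m : ℂ} (hm0 : m ≠ 0) (hm1 : m ≠ 1) {α β : ℂ}
    (hα : Theta m α ≠ 0) (hβ : Theta m β ≠ 0) (hX : jX m α = jX m β) (hY : jY m α = jY m β) :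
    ∃ j n : ℤ, α = β + 2 * ellK m * (j + n * ellTau m) := by
  have hτ := ellTau_im_pos hm0 hm1
  have hK := ellK_ne_zero hm1
  have n2 := th2_zero_ne hτ
  have n3 := th3_zero_ne hτ
  have n4 := th4_zero_ne hτ
  have h := jX_sub_jX hm0 hm1 hα hβ
  rw [hX, sub_self, zero_mul] at h
  have hc : m * (th3 (ellTau m) 0 ^ 2 / th2 (ellTau m) 0 ^ 2) * th4 (ellTau m) 0 ^ 2 ≠ 0 := by
    positivity
  have hlat : ∀ γ, Eta m γ = 0 → ∃ j n : ℤ, γ = 2 * ellK m * (j + n * ellTau m) := by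
    intro γ hγ
    obtain ⟨j, n, e⟩ := exists_int_of_th1_eq_zero hτ hγ
    refine ⟨j, n, ?_⟩
    rw [← e]
    field_simp
  rcases mul_eq_zero.1 ((mul_eq_zero.1 h.symm).resolve_left hc) with h | h
  · obtain ⟨j, n, e⟩ := hlat _ h
    -- `α + β` is a period; then `y(α) = 0`, so that `α` is half a period
    have hβ' : β = -α + 2 * ellK m * (j + n * ellTau m) := by linear_combination e
    have hY0 : jY m α = 0 := by
      have h1 := (hasDerivAt_jX hm0 hm1 hβ).deriv
      have h2 := (hasDerivAt_jX hm0 hm1 (α := -α) (by rwa [Theta_neg])).deriv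
      rw [hβ', ← deriv_comp_add_const, funext (jX_add_lattice hm1 j n), h2, ← hβ', ← hY,
        jY_neg hm1] at h1
      linear_combination -(1 / 2 : ℂ) * h1
    have half : ∀ {z : ℂ} (i : ℤ), th1 (ellTau m) (z + i / 2) = 0 →
        ∃ j n : ℤ, 2 * z = j + n * ellTau m := by
      intro z i hz
      obtain ⟨j, n, e⟩ := exists_int_of_th1_eq_zero hτ hz
      exact ⟨2 * j - i, 2 * n, by push_cast; linear_combination 2 * e⟩
    have h2 : ∃ j n : ℤ, 2 * (α / (2 * ellK m)) = j + n * ellTau m := by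
      rw [jY, sn_eq hm1, cn_eq hm1, dn_eq hm1, snZ, cnZ, dnZ] at hY0
      rw [Theta_eq] at hα
      have n2' : th1 (ellTau m) (α / (2 * ellK m)) = 0 ∨
          th2 (ellTau m) (α / (2 * ellK m)) = 0 ∨ th3 (ellTau m) (α / (2 * ellK m)) = 0 := by
        simpa [hm0, n2, n3, n4, hα, or_assoc] using hY0
      rcases n2' with h | h | h
      · exact half 0 (by simpa using h)
      · refine half 1 ?_
        rw [Int.cast_one, th1_add_half, h]
      · rw [← th4_add_half] at h
        obtain ⟨j, n, e⟩ := exists_int_of_th4_eq_zero hτ h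
        exact ⟨2 * j - 1, 2 * n + 1, by push_cast; linear_combination 2 * e⟩
    obtain ⟨j', n', e'⟩ := h2
    have e'' : 2 * α = 2 * ellK m * (j' + n' * ellTau m) := by
      rw [← e']
      field_simp
    exact ⟨j' - j, n' - n, by push_cast; linear_combination e'' - e⟩
  · obtain ⟨j, n, e⟩ := hlat _ h
    exact ⟨j, n, by linear_combination e⟩

/-! ### Hermite–Krichever functions in the Jacobi variable -/

lemma exists_Eta_ne_zero {m : ℂ} (hm0 : m ≠ 0) (hm1 : m ≠ 1) : ∃ α, Eta m α ≠ 0 := by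
  obtain ⟨z, hz⟩ := exists_th1_ne_zero (ellTau_im_pos hm0 hm1)
  have hK := ellK_ne_zero hm1
  refine ⟨2 * ellK m * z, ?_⟩
  rwa [Eta_eq, mul_div_cancel_left₀ z (by simpa using hK)]

lemma Theta_zero_ne {m : ℂ} (hm0 : m ≠ 0) (hm1 : m ≠ 1) : Theta m 0 ≠ 0 := by
  rw [Theta_eq, zero_div]
  exact th4_zero_ne (ellTau_im_pos hm0 hm1)

/-- The zeros of an entire function which does not vanish identically are isolated. -/
lemma eventually_ne_zero_of_entire {f : ℂ → ℂ} (hf : Differentiable ℂ f) (h : ∃ w, f w ≠ 0)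
    (z : ℂ) : ∀ᶠ w in 𝓝[≠] z, f w ≠ 0 := by
  obtain ⟨w, hw⟩ := h
  have han : AnalyticOnNhd ℂ f Set.univ := fun z _ => hf.analyticAt z
  refine ((han z trivial).eventually_eq_zero_or_eventually_ne_zero).resolve_left fun h0 => hw ?_
  exact han.eqOn_zero_of_preconnected_of_eventuallyEq_zero isPreconnected_univ
    (Set.mem_univ z) h0 (Set.mem_univ w)

/-- Generic points: away from an exceptional set without accumulation points, neither `Θ(α)`,
nor `dx/dα`, nor `x(α) - x(α₀)` (in its factored form) vanishes. -/
lemma eventually_generic {m : ℂ} (hm0 : m ≠ 0) (hm1 : m ≠ 1) (α₀ z : ℂ) :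
    ∀ᶠ α in 𝓝[≠] z, Theta m α ≠ 0 ∧ jY m α ≠ 0 ∧ Eta m (α - α₀) ≠ 0 ∧ Eta m (α + α₀) ≠ 0 := by
  have hT := differentiable_Theta hm0 hm1
  have hE := differentiable_Eta hm0 hm1
  obtain ⟨b, hb⟩ := exists_Eta_ne_zero hm0 hm1
  have h0 := Theta_zero_ne hm0 hm1
  have shift : ∀ c, (∀ᶠ α in 𝓝[≠] z, Eta m (α + c) ≠ 0) := fun c =>
    eventually_ne_zero_of_entire (hE.comp (differentiable_id.add_const c))
      ⟨b - c, by simpa using hb⟩ z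
  have h1 := eventually_ne_zero_of_entire hT ⟨0, h0⟩ z
  have h2 : ∀ᶠ α in 𝓝[≠] z, Theta₁ m α ≠ 0 :=
    eventually_ne_zero_of_entire (hT.comp (differentiable_id.add_const (ellK m)))
      ⟨-ellK m, by simpa using h0⟩ z
  filter_upwards [h1, h2, shift 0, shift (ellK m), shift (-α₀), shift α₀] with α g1 g2 g3 g4 g5 g6
  have n1 : Theta₁ m 0 ≠ 0 := by
    rw [Theta₁_eq hm1, zero_div]; exact th3_zero_ne (ellTau_im_pos hm0 hm1)
  have n2 : Eta₁ m 0 ≠ 0 := by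
    rw [Eta₁_eq hm1, zero_div]; exact th2_zero_ne (ellTau_im_pos hm0 hm1)
  rw [add_zero] at g3
  change Eta₁ m α ≠ 0 at g4
  refine ⟨g1, ?_, g5, g6⟩
  rw [jY, sn, cn, dn]
  simp [hm0, h0, n1, n2, g1, g2, g3, g4]

lemma isOpen_Theta_ne {m : ℂ} (hm0 : m ≠ 0) (hm1 : m ≠ 1) : IsOpen {α | Theta m α ≠ 0} :=
  isOpen_ne_fun (differentiable_Theta hm0 hm1).continuous continuous_const

/-- The plane without the poles of the potential is connected. -/
lemma isPreconnected_Theta_ne {m : ℂ} (hm0 : m ≠ 0) (hm1 : m ≠ 1) :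
    IsPreconnected {α | Theta m α ≠ 0} := by
  have hK := ellK_ne_zero hm1
  have hc : {α | Theta m α = 0}.Countable := by
    refine (Set.countable_range
      fun p : ℤ × ℤ => 2 * ellK m * (p.1 + (p.2 + 1 / 2) * ellTau m)).mono fun α hα => ?_
    obtain ⟨j, n, e⟩ := exists_int_of_th4_eq_zero (ellTau_im_pos hm0 hm1) hα
    refine ⟨(j, n), ?_⟩
    change 2 * ellK m * (j + (n + 1 / 2) * ellTau m) = α
    rw [← e]
    field_simp
  exact (hc.isPathConnected_compl_of_one_lt_rank
    (by rw [Complex.rank_real_complex]; norm_num)).isConnected.isPreconnected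

lemma analyticAt_sn {m : ℂ} (hm0 : m ≠ 0) (hm1 : m ≠ 1) {α : ℂ} (hα : Theta m α ≠ 0) :
    AnalyticAt ℂ (sn m) α :=
  analyticAt_const.mul (((differentiable_Eta hm0 hm1).analyticAt α).div
    ((differentiable_Theta hm0 hm1).analyticAt α) hα)

lemma analyticAt_jX {m : ℂ} (hm0 : m ≠ 0) (hm1 : m ≠ 1) {α : ℂ} (hα : Theta m α ≠ 0) :
    AnalyticAt ℂ (jX m) α :=
  (analyticAt_const.mul ((analyticAt_sn hm0 hm1 hα).pow 2)).sub analyticAt_const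

lemma analyticAt_jY {m : ℂ} (hm0 : m ≠ 0) (hm1 : m ≠ 1) {α : ℂ} (hα : Theta m α ≠ 0) :
    AnalyticAt ℂ (jY m) α :=
  (analyticAt_jX hm0 hm1 hα).deriv.congr (Filter.eventuallyEq_of_mem
    ((isOpen_Theta_ne hm0 hm1).mem_nhds hα) fun _ hβ => (hasDerivAt_jX hm0 hm1 hβ).deriv)

lemma analyticAt_PhiJ {m : ℂ} (hm0 : m ≠ 0) (hm1 : m ≠ 1) (α₀ : ℂ) {α : ℂ}
    (hα : Theta m α ≠ 0) : AnalyticAt ℂ (PhiJ m α₀) α :=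
  ((((differentiable_Eta hm0 hm1).comp (differentiable_id.sub_const α₀)).analyticAt α).div
    ((differentiable_Theta hm0 hm1).analyticAt α) hα).mul
    (analyticAt_id.mul analyticAt_const).cexp

lemma analyticAt_hkFunJ {m : ℂ} (hm0 : m ≠ 0) (hm1 : m ≠ 1) (α₀ κ : ℂ) (A₀ B₀ : ℂ[X]) {α : ℂ}
    (hα : Theta m α ≠ 0) : AnalyticAt ℂ (hkFunJ m α₀ κ A₀ B₀) α := by
  have hs := (analyticAt_sn hm0 hm1 hα).fun_pow 2
  have hp : ∀ P : ℂ[X], AnalyticAt ℂ (fun α => P.eval (sn m α ^ 2)) α := fun P =>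
    (P.differentiable.analyticAt _).comp hs
  have hΦ := analyticAt_PhiJ hm0 hm1 α₀ hα
  exact (((hp A₀).mul hΦ).add ((analyticAt_const.mul (hp B₀)).mul hΦ.deriv)).mul
    (analyticAt_const.mul analyticAt_id).cexp

lemma PhiJ_add_two_ellK {m : ℂ} (hm1 : m ≠ 1) (α₀ α : ℂ) :
    PhiJ m α₀ (α + 2 * ellK m) = -exp (2 * ellK m * Zeta m α₀) * PhiJ m α₀ α := by
  rw [PhiJ, Theta_add_two_ellK hm1, show α + 2 * ellK m - α₀ = α - α₀ + 2 * ellK m by ring,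
    Eta_add_two_ellK hm1, add_mul, Complex.exp_add, PhiJ]
  ring

/-- The Floquet multiplier of a Hermite–Krichever function. -/
lemma hkFunJ_add_two_ellK {m : ℂ} (hm1 : m ≠ 1) (α₀ κ : ℂ) (A₀ B₀ : ℂ[X]) (α : ℂ) :
    hkFunJ m α₀ κ A₀ B₀ (α + 2 * ellK m) =
      -exp (2 * ellK m * (Zeta m α₀ + κ)) * hkFunJ m α₀ κ A₀ B₀ α := by
  have hd : deriv (PhiJ m α₀) (α + 2 * ellK m) =
      -exp (2 * ellK m * Zeta m α₀) * deriv (PhiJ m α₀) α := by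
    rw [← deriv_comp_add_const, funext (PhiJ_add_two_ellK hm1 α₀), deriv_const_mul_field]
  rw [hkFunJ, sn_sq_add_two_ellK hm1, PhiJ_add_two_ellK hm1, hd, hkFunJ, mul_add (2 * ellK m),
    mul_add κ, Complex.exp_add, Complex.exp_add, mul_comm κ (2 * ellK m)]
  ring

/-- The function `Φ̃` is a branch of `exp [½ ∫ (y+y₀)/(x-x₀) dx/y]`: its logarithmic derivative
with respect to `α` is `½ (y+y₀)/(x-x₀)`. -/
lemma deriv_PhiJ {m : ℂ} (hm0 : m ≠ 0) (hm1 : m ≠ 1) {α₀ α : ℂ} (hα₀ : Theta m α₀ ≠ 0)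
    (hα : Theta m α ≠ 0) :
    2 * deriv (PhiJ m α₀) α * (jX m α - jX m α₀) = (jY m α + jY m α₀) * PhiJ m α₀ α := by
  have hT := fun β => (differentiable_Theta hm0 hm1 β).hasDerivAt
  have hE := fun β => (differentiable_Eta hm0 hm1 β).hasDerivAt
  have hU := isOpen_Theta_ne hm0 hm1
  set c := m * (th3 (ellTau m) 0 ^ 2 / th2 (ellTau m) 0 ^ 2) * th4 (ellTau m) 0 ^ 2
  have key : ∀ {β γ}, Theta m β ≠ 0 → Theta m γ ≠ 0 →
      (jX m β - jX m γ) * (Theta m β ^ 2 * Theta m γ ^ 2) =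
        c * (Eta m (β + γ) * Eta m (β - γ)) := jX_sub_jX hm0 hm1
  -- differentiate the factorization of `x(α) - x(α₀)` with respect to both variables
  have h1 := HasDerivAt.unique
    ((((hasDerivAt_jX hm0 hm1 hα).sub_const (jX m α₀)).fun_mul
      (((hT α).fun_pow 2).mul_const (Theta m α₀ ^ 2))).congr_of_eventuallyEq
        (Filter.eventuallyEq_of_mem (hU.mem_nhds hα) fun β hβ => (key hβ hα₀).symm))
    ((((hE (α + α₀)).comp_add_const α α₀).fun_mul ((hE (α - α₀)).comp_sub_const α α₀)).const_mul c)
  have h2 := HasDerivAt.unique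
    ((((hasDerivAt_jX hm0 hm1 hα₀).const_sub (jX m α)).fun_mul
      (((hT α₀).fun_pow 2).const_mul (Theta m α ^ 2))).congr_of_eventuallyEq
        (Filter.eventuallyEq_of_mem (hU.mem_nhds hα₀) fun β hβ => (key hα hβ).symm))
    ((((hE (α + α₀)).comp_const_add α α₀).fun_mul
      ((hE (α - α₀)).comp_const_sub α α₀)).const_mul c)
  have h3 := key hα hα₀
  have hP : HasDerivAt (PhiJ m α₀) _ α :=
    (((hE (α - α₀)).comp_sub_const α α₀).fun_div (hT α) hα).fun_mul
      ((hasDerivAt_id' α).mul_const (Zeta m α₀)).cexp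
  rw [hP.deriv, PhiJ, Zeta]
  field_simp
  refine mul_right_cancel₀ (mul_ne_zero hα hα₀) ?_
  norm_num at h1 h2
  linear_combination 2 * deriv (Eta m) (α - α₀) * h3 - Eta m (α - α₀) * (h1 - h2)

/-- The abscissa takes generic values. -/
lemma eventually_eval_jX_ne_zero {m : ℂ} (hm0 : m ≠ 0) (hm1 : m ≠ 1) {P : ℂ[X]} (hP : P ≠ 0)
    {z : ℂ} (hz : Theta m z ≠ 0) (hY : jY m z ≠ 0) : ∀ᶠ α in 𝓝[≠] z, P.eval (jX m α) ≠ 0 := by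
  have h := (Finset.eventually_all (l := 𝓝[≠] z) P.roots.toFinset
    (p := fun r α => jX m α ≠ r)).2 fun r _ => (hasDerivAt_jX hm0 hm1 hz).eventually_ne hY
  filter_upwards [h] with α hα h0
  exact hα (jX m α) (by simpa [hP] using h0) rfl

/-- The substitution which turns a polynomial in `x` into a polynomial in `sn²`. -/
noncomputable def toSnSq (m : ℂ) (P : ℂ[X]) : ℂ[X] := P.comp (C m * X - C (1 / 3 * (m + 1)))

lemma eval_toSnSq (m : ℂ) (P : ℂ[X]) (α : ℂ) :
    (toSnSq m P).eval (sn m α ^ 2) = P.eval (jX m α) := by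
  simp [toSnSq, jX]

lemma hkFunJ_toSnSq (m α₀ κ : ℂ) (A₀ B₀ : ℂ[X]) (α : ℂ) :
    hkFunJ m α₀ κ (toSnSq m A₀) (toSnSq m B₀) α =
      (A₀.eval (jX m α) * PhiJ m α₀ α + 2 * B₀.eval (jX m α) * deriv (PhiJ m α₀) α) *
        exp (κ * α) := by
  rw [hkFunJ, eval_toSnSq, eval_toSnSq]

lemma PhiJ_ne_zero {m α₀ α : ℂ} (hα : Theta m α ≠ 0) (h : Eta m (α - α₀) ≠ 0) :
    PhiJ m α₀ α ≠ 0 :=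
  mul_ne_zero (div_ne_zero h hα) (Complex.exp_ne_zero _)

lemma jX_ne {m : ℂ} (hm0 : m ≠ 0) (hm1 : m ≠ 1) {α₀ α : ℂ} (hα₀ : Theta m α₀ ≠ 0)
    (hα : Theta m α ≠ 0) (h1 : Eta m (α - α₀) ≠ 0) (h2 : Eta m (α + α₀) ≠ 0) :
    jX m α ≠ jX m α₀ := by
  intro e
  have h := jX_sub_jX hm0 hm1 hα hα₀
  have hτ := ellTau_im_pos hm0 hm1
  rw [e, sub_self, zero_mul] at h
  simpa [hm0, th2_zero_ne hτ, th3_zero_ne hτ, th4_zero_ne hτ, h1, h2] using h.symm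

/-- A Hermite–Krichever function with nonzero polynomials does not vanish identically: otherwise
`𝒜(x) (x-x₀) + ℬ(x) (y+y₀) = 0` at generic points `(x,y)` and `(x,-y)`, whence
`𝒜(x) = ℬ(x) = 0` for infinitely many `x`. -/
lemma exists_hkFunJ_ne_zero {m : ℂ} (hm0 : m ≠ 0) (hm1 : m ≠ 1) {α₀ : ℂ}
    (hα₀ : Theta m α₀ ≠ 0) (κ : ℂ) {A₀ B₀ : ℂ[X]} (h : A₀ ≠ 0 ∨ B₀ ≠ 0) :
    ∃ α, Theta m α ≠ 0 ∧ hkFunJ m α₀ κ (toSnSq m A₀) (toSnSq m B₀) α ≠ 0 := by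
  by_contra! hF
  have gen : ∀ α, Theta m α ≠ 0 → jY m α ≠ 0 → Eta m (α - α₀) ≠ 0 → Eta m (α + α₀) ≠ 0 →
      A₀.eval (jX m α) = 0 ∧ B₀.eval (jX m α) = 0 := by
    intro α hα hY h1 h2
    have hX := sub_ne_zero.2 (jX_ne hm0 hm1 hα₀ hα h1 h2)
    have key : ∀ β, Theta m β ≠ 0 → Eta m (β - α₀) ≠ 0 →
        A₀.eval (jX m β) * (jX m β - jX m α₀) + B₀.eval (jX m β) * (jY m β + jY m α₀) = 0 := by
      intro β hβ hβ'
      have h3 := hF β hβ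
      rw [hkFunJ_toSnSq] at h3
      have h4 := (mul_eq_zero.1 h3).resolve_right (Complex.exp_ne_zero _)
      refine mul_right_cancel₀ (PhiJ_ne_zero hβ hβ') ?_
      linear_combination (jX m β - jX m α₀) * h4 -
        B₀.eval (jX m β) * deriv_PhiJ hm0 hm1 hα₀ hβ
    have k1 := key α hα h1
    have k2 := key (-α) (by rwa [Theta_neg]) (by
      rw [show -α - α₀ = -(α + α₀) by ring, Eta_eq, neg_div, th1_neg]
      exact neg_ne_zero.2 h2)
    rw [jX_neg hm1, jY_neg hm1] at k2
    have hB : B₀.eval (jX m α) = 0 := by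
      refine (mul_eq_zero.1 ?_).resolve_right hY
      linear_combination (1 / 2 : ℂ) * (k1 - k2)
    refine ⟨(mul_eq_zero.1 ?_).resolve_right hX, hB⟩
    linear_combination k1 - (jY m α + jY m α₀) * hB
  obtain ⟨z, hz, hYz, -⟩ := (eventually_generic hm0 hm1 α₀ 0).exists
  have hg := eventually_generic hm0 hm1 α₀ z
  rcases h with h | h
  all_goals
    obtain ⟨α, ⟨h1, h2, h3, h4⟩, h5⟩ :=
      (hg.and (eventually_eval_jX_ne_zero hm0 hm1 h hz hYz)).exists
    have := gen α h1 h2 h3 h4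
    tauto

/-- Pulled back to the `α` plane, a Hermite–Krichever solution on the elliptic curve solves the
equation at each generic point, where `x` is a local coordinate. -/
lemma deriv_deriv_hkFunJ_of_generic {ℓ : ℕ} {m B α₀ κ : ℂ} (hm0 : m ≠ 0) (hm1 : m ≠ 1)
    {A₀ B₀ : ℂ[X]} (hα₀ : Theta m α₀ ≠ 0)
    (h : IsHKSolution ℓ (g2J m) (g3J m) B (jX m α₀) (jY m α₀) κ A₀ B₀) {α : ℂ}
    (hα : Theta m α ≠ 0) (hY : jY m α ≠ 0) (h1 : Eta m (α - α₀) ≠ 0) (h2 : Eta m (α + α₀) ≠ 0) :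
    deriv (deriv (hkFunJ m α₀ κ (toSnSq m A₀) (toSnSq m B₀))) α =
      ((ℓ : ℂ) * (ℓ + 1) * jX m α + B) * hkFunJ m α₀ κ (toSnSq m A₀) (toSnSq m B₀) α := by
  set F := hkFunJ m α₀ κ (toSnSq m A₀) (toSnSq m B₀) with hF
  have hΦ := PhiJ_ne_zero hα h1
  -- the local inverse `g` of `x` near `α`
  have hstrict : HasStrictDerivAt (jX m) (jY m α) α := by
    have := (analyticAt_jX hm0 hm1 hα).hasStrictDerivAt
    rwa [(hasDerivAt_jX hm0 hm1 hα).deriv] at this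
  set e := HasStrictFDerivAt.toOpenPartialHomeomorph (jX m) (hstrict.hasStrictFDerivAt_equiv hY)
    with he
  have hex : ∀ β, e β = jX m β := fun β => rfl
  have hsrc : α ∈ e.source :=
    HasStrictFDerivAt.mem_toOpenPartialHomeomorph_source (hstrict.hasStrictFDerivAt_equiv hY)
  set g : ℂ → ℂ := ⇑e.symm with hg
  -- on `W` all the functions involved are regular, and a logarithm of `Φ̃` exists
  set W : Set ℂ := {β | Theta m β ≠ 0} ∩ {β | jY m β ≠ 0 ∧ jX m β ≠ jX m α₀ ∧
    PhiJ m α₀ β / PhiJ m α₀ α ∈ slitPlane} with hW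
  have hYan : ∀ β, Theta m β ≠ 0 → DifferentiableAt ℂ (jY m) β := fun β hβ =>
    (analyticAt_jY hm0 hm1 hβ).differentiableAt
  have hWo : IsOpen W := by
    refine isOpen_iff_mem_nhds.2 fun β hβ => ?_
    filter_upwards [(isOpen_Theta_ne hm0 hm1).mem_nhds hβ.1,
      (hYan β hβ.1).continuousAt.eventually_ne hβ.2.1,
      (analyticAt_jX hm0 hm1 hβ.1).continuousAt.eventually_ne hβ.2.2.1,
      ((analyticAt_PhiJ hm0 hm1 α₀ hβ.1).continuousAt.div_const
        (PhiJ m α₀ α)).preimage_mem_nhds (isOpen_slitPlane.mem_nhds hβ.2.2.2)] with γ k1 k2 k3 k4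
    exact ⟨k1, k2, k3, k4⟩
  have hαW : α ∈ W :=
    ⟨hα, hY, jX_ne hm0 hm1 hα₀ hα h1 h2, by rw [div_self hΦ]; exact one_mem_slitPlane⟩
  set U : Set ℂ := e.target ∩ g ⁻¹' W with hU
  have hUo : IsOpen U := e.isOpen_inter_preimage_symm hWo
  have hgx : ∀ x ∈ U, jX m (g x) = x := fun x hx => e.right_inv hx.1
  have hgd : ∀ x ∈ U, HasDerivAt g (jY m (g x))⁻¹ x := fun x hx =>
    e.hasDerivAt_symm hx.1 hx.2.2.1 (hasDerivAt_jX hm0 hm1 hx.2.1)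
  have hxα : jX m α ∈ U := ⟨e.map_source hsrc, by
    change g (e α) ∈ W
    rwa [hg, e.left_inv hsrc]⟩
  have hgα : g (jX m α) = α := e.left_inv hsrc
  -- the logarithm of `Φ̃`
  set I₁ : ℂ → ℂ := fun x => log (PhiJ m α₀ (g x) / PhiJ m α₀ α) with hI₁
  have hΦd : ∀ x ∈ U, HasDerivAt (fun x => PhiJ m α₀ (g x))
      (deriv (PhiJ m α₀) (g x) * (jY m (g x))⁻¹) x := fun x hx =>
    HasDerivAt.comp (h₂ := PhiJ m α₀) x
      (analyticAt_PhiJ hm0 hm1 α₀ hx.2.1).differentiableAt.hasDerivAt (hgd x hx)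
  have hΦn : ∀ x ∈ U, PhiJ m α₀ (g x) ≠ 0 := fun x hx h0 => by
    have := hx.2.2.2.2
    rw [h0, zero_div] at this
    exact slitPlane_ne_zero this rfl
  have hbr : IsBranch (g2J m) (g3J m) (jX m α₀) (jY m α₀) U (fun x => jY m (g x)) I₁ g := by
    refine ⟨hUo, fun x hx => ?_, fun x hx => hx.2.2.1, fun x hx => ?_, fun x hx => ?_,
      fun x hx => ?_, fun x hx => ?_⟩
    · rw [← hgx x hx]
      exact hx.2.2.2.1
    · exact ((hYan _ hx.2.1).comp x (hgd x hx).differentiableAt).differentiableWithinAt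
    · rw [jY_sq hm0 hm1 hx.2.1, hgx x hx]
    · refine (((hΦd x hx).div_const _).clog hx.2.2.2.2).congr_deriv ?_
      have h3 := deriv_PhiJ hm0 hm1 hα₀ hx.2.1
      have h4 := sub_ne_zero.2 hx.2.2.2.1
      have h5 := hx.2.2.1
      have h6 := hΦn x hx
      rw [hgx x hx] at h3 h4
      field_simp
      linear_combination h3
    · rw [one_div]
      exact hgd x hx
  have hsol := h.solves U _ I₁ g hbr
  have hexp : ∀ x ∈ U, exp (I₁ x) = PhiJ m α₀ (g x) / PhiJ m α₀ α := fun x hx =>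
    Complex.exp_log (div_ne_zero (hΦn x hx) hΦ)
  -- `y d/dx` is `d/dα`
  have hyD : ∀ f G : ℂ → ℂ, (∀ β, Theta m β ≠ 0 → DifferentiableAt ℂ G β) →
      (∀ x ∈ U, f x = G (g x) / PhiJ m α₀ α) →
      ∀ x ∈ U, yD (fun x => jY m (g x)) f x = deriv G (g x) / PhiJ m α₀ α := by
    intro f G hG hf x hx
    have h3 : HasDerivAt f (deriv G (g x) * (jY m (g x))⁻¹ / PhiJ m α₀ α) x :=
      ((HasDerivAt.comp (h₂ := G) x (hG _ hx.2.1).hasDerivAt (hgd x hx)).div_const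
        _).congr_of_eventuallyEq (Filter.eventuallyEq_of_mem (hUo.mem_nhds hx) hf)
    have h5 := hx.2.2.1
    rw [yD, h3.deriv]
    field_simp
  have hhk : ∀ x ∈ U, hkFun κ A₀ B₀ (fun x => jY m (g x)) I₁ g x = F (g x) / PhiJ m α₀ α := by
    intro x hx
    rw [hF, hkFunJ_toSnSq, hgx x hx, hkFun, hexp x hx,
      hyD _ (PhiJ m α₀) (fun β hβ => (analyticAt_PhiJ hm0 hm1 α₀ hβ).differentiableAt) hexp x hx]
    ring
  have hFan : ∀ β, Theta m β ≠ 0 → AnalyticAt ℂ F β := fun β hβ =>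
    analyticAt_hkFunJ hm0 hm1 α₀ κ _ _ hβ
  have hs := hsol (jX m α) hxα
  rw [hyD _ (deriv F) (fun β hβ => (hFan β hβ).deriv.differentiableAt)
    (hyD _ F (fun β hβ => (hFan β hβ).differentiableAt) hhk) _ hxα, hhk _ hxα, hgα] at hs
  field_simp at hs
  linear_combination hs

/-- A Hermite–Krichever solution on the elliptic curve is a solution of the Jacobi form of the
Lamé equation. -/
theorem isLameSolution_hkFunJ {ℓ : ℕ} {m E α₀ κ : ℂ} (hm0 : m ≠ 0) (hm1 : m ≠ 1)
    {A₀ B₀ : ℂ[X]} (hα₀ : Theta m α₀ ≠ 0)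
    (h : IsHKSolution ℓ (g2J m) (g3J m) (accB ℓ m E) (jX m α₀) (jY m α₀) κ A₀ B₀) :
    IsLameSolution ℓ m E (hkFunJ m α₀ κ (toSnSq m A₀) (toSnSq m B₀)) := by
  have han := fun β (hβ : Theta m β ≠ 0) =>
    analyticAt_hkFunJ hm0 hm1 α₀ κ (toSnSq m A₀) (toSnSq m B₀) hβ
  refine ⟨han, fun α hα => ?_, exists_hkFunJ_ne_zero hm0 hm1 hα₀ κ h.ne_zero⟩
  have hF := han α hα
  have hX := analyticAt_jX hm0 hm1 hα
  have h1 : deriv (deriv (hkFunJ m α₀ κ (toSnSq m A₀) (toSnSq m B₀))) α =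
      ((ℓ : ℂ) * (ℓ + 1) * jX m α + accB ℓ m E) *
        hkFunJ m α₀ κ (toSnSq m A₀) (toSnSq m B₀) α := by
    refine ((hF.deriv.deriv.continuousAt.eventuallyEq_nhds_iff_eventuallyEq_nhdsNE
      (((continuousAt_const.mul hX.continuousAt).add continuousAt_const).mul
        hF.continuousAt)).1 ?_).eq_of_nhds
    filter_upwards [eventually_generic hm0 hm1 α₀ α] with β hβ
    exact deriv_deriv_hkFunJ_of_generic hm0 hm1 hα₀ h hβ.1 hβ.2.1 hβ.2.2.1 hβ.2.2.2
  rw [h1, jX, accB]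
  ring

/-! ### Crystal momenta -/

lemma exp_two_ellK_eq_iff {m : ℂ} (hm1 : m ≠ 1) (a b : ℂ) :
    exp (I * a * (2 * ellK m)) = exp (I * b * (2 * ellK m)) ↔
      ∃ n : ℤ, a = b + n * (Real.pi / ellK m) := by
  have hK := ellK_ne_zero hm1
  rw [Complex.exp_eq_exp_iff_exists_int]
  refine exists_congr fun n => ⟨fun h => ?_, fun h => ?_⟩
  · have e : I * (b + n * (Real.pi / ellK m)) * (2 * ellK m) =
        I * b * (2 * ellK m) + n * (2 * Real.pi * I) := by
      field_simp
    refine mul_left_cancel₀ (mul_ne_zero I_ne_zero (mul_ne_zero two_ne_zero hK)) ?_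
    linear_combination h - e
  · rw [h]
    field_simp

/-- A solution determines its crystal momentum up to multiples of `π/K`. -/
lemma hasMomentum_iff {ℓ : ℕ} {m E : ℂ} (hm1 : m ≠ 1) {Ψ : ℂ → ℂ} (hΨ : IsLameSolution ℓ m E Ψ)
    {k₀ : ℂ} (h₀ : HasMomentum m Ψ k₀) (k : ℂ) :
    HasMomentum m Ψ k ↔ ∃ n : ℤ, k = k₀ + n * (Real.pi / ellK m) := by
  rw [← exp_two_ellK_eq_iff hm1]
  refine ⟨fun h => ?_, fun h α hα => by rw [h, h₀ α hα]⟩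
  obtain ⟨α, hα, hne⟩ := hΨ.nonzero
  exact mul_right_cancel₀ hne ((h α hα).symm.trans (h₀ α hα))

/-- The summand `π/2K` accounts for the sign in `H(α+2K) = -H(α)`. -/
lemma hasMomentum_hkFunJ {m : ℂ} (hm1 : m ≠ 1) (α₀ κ : ℂ) (A₀ B₀ : ℂ[X]) :
    HasMomentum m (hkFunJ m α₀ κ A₀ B₀)
      (-I * Zeta m α₀ + Real.pi / (2 * ellK m) - I * κ) := by
  intro α _
  have hK := ellK_ne_zero hm1
  have e : I * (-I * Zeta m α₀ + Real.pi / (2 * ellK m) - I * κ) * (2 * ellK m) =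
      2 * ellK m * (Zeta m α₀ + κ) + Real.pi * I := by
    field_simp
    linear_combination (-(2 * ellK m * (Zeta m α₀ + κ))) * I_sq
  rw [hkFunJ_add_two_ellK hm1, e, Complex.exp_add, Complex.exp_pi_mul_I]
  ring

lemma Theta_add_two_ellK_ne {m : ℂ} (hm1 : m ≠ 1) {α : ℂ} (hα : Theta m α ≠ 0) :
    Theta m (α + 2 * ellK m) ≠ 0 := by
  rwa [Theta_add_two_ellK hm1]

lemma IsLameSolution.comp_neg {ℓ : ℕ} {m E : ℂ} (hm1 : m ≠ 1) {Ψ : ℂ → ℂ}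
    (h : IsLameSolution ℓ m E Ψ) : IsLameSolution ℓ m E (fun α => Ψ (-α)) := by
  have h1 : deriv (fun α => Ψ (-α)) = fun α => -deriv Ψ (-α) := funext fun α => deriv_comp_neg Ψ α
  refine ⟨fun α hα => ?_, fun α hα => ?_, ?_⟩
  · exact (h.analytic (-α) (by rwa [Theta_neg])).comp analyticAt_id.neg
  · have h2 := h.solves (-α) (by rwa [Theta_neg])
    rw [sn_neg hm1, neg_sq] at h2
    rw [h1, deriv.fun_neg, deriv_comp_neg, neg_neg]
    exact h2
  · obtain ⟨α, hα, hne⟩ := h.nonzero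
    exact ⟨-α, by rwa [Theta_neg], by rwa [neg_neg]⟩

lemma HasMomentum.comp_neg {m : ℂ} (hm1 : m ≠ 1) {Ψ : ℂ → ℂ} {k : ℂ} (h : HasMomentum m Ψ k) :
    HasMomentum m (fun α => Ψ (-α)) (-k) := by
  intro α hα
  have h1 := h (-(α + 2 * ellK m)) (by rw [Theta_neg]; exact Theta_add_two_ellK_ne hm1 hα)
  rw [show -(α + 2 * ellK m) + 2 * ellK m = -α by ring] at h1
  change Ψ (-(α + 2 * ellK m)) = _ * Ψ (-α)
  rw [h1, ← mul_assoc, ← Complex.exp_add]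
  ring_nf
  simp

lemma HasMomentum.deriv {m : ℂ} (hm0 : m ≠ 0) (hm1 : m ≠ 1) {Ψ : ℂ → ℂ} {k : ℂ}
    (h : HasMomentum m Ψ k) {α : ℂ} (hα : Theta m α ≠ 0) :
    deriv Ψ (α + 2 * ellK m) = exp (I * k * (2 * ellK m)) * deriv Ψ α := by
  rw [← deriv_comp_add_const, ← deriv_const_mul_field]
  exact (Filter.eventuallyEq_of_mem ((isOpen_Theta_ne hm0 hm1).mem_nhds hα) h).deriv_eq

/-- Two solutions of the same equation with crystal momenta `k` and `k'` are proportional, or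
`k + k'` is a multiple of `π/K`: their Wronskian is constant, and is multiplied by
`exp (2iK(k + k'))` under the translation by `2K`. -/
theorem momentum_eq_or_eq_neg {ℓ : ℕ} {m E : ℂ} (hm0 : m ≠ 0) (hm1 : m ≠ 1) {Ψ Ψ' : ℂ → ℂ}
    (hΨ : IsLameSolution ℓ m E Ψ) (hΨ' : IsLameSolution ℓ m E Ψ') {k k' : ℂ}
    (hk : HasMomentum m Ψ k) (hk' : HasMomentum m Ψ' k') :
    (∃ n : ℤ, k = k' + n * (Real.pi / ellK m)) ∨ ∃ n : ℤ, -k = k' + n * (Real.pi / ellK m) := by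
  have hU := isOpen_Theta_ne hm0 hm1
  have hc := isPreconnected_Theta_ne hm0 hm1
  set W : ℂ → ℂ := fun α => Ψ α * deriv Ψ' α - deriv Ψ α * Ψ' α with hW
  have hWd : ∀ α, Theta m α ≠ 0 → HasDerivAt W 0 α := by
    intro α hα
    have a := hΨ.analytic α hα
    have a' := hΨ'.analytic α hα
    refine ((a.differentiableAt.hasDerivAt.fun_mul a'.deriv.differentiableAt.hasDerivAt).fun_sub
      (a.deriv.differentiableAt.hasDerivAt.fun_mul
        a'.differentiableAt.hasDerivAt)).congr_deriv ?_
    linear_combination Ψ' α * hΨ.solves α hα - Ψ α * hΨ'.solves α hα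
  obtain ⟨w, hw⟩ := hU.exists_is_const_of_deriv_eq_zero hc
    (fun α hα => (hWd α hα).differentiableAt.differentiableWithinAt)
    (fun α hα => (hWd α hα).deriv)
  by_cases hw0 : w = 0
  · left
    obtain ⟨β, hβ, hne⟩ := hΨ'.nonzero
    -- the quotient of the two solutions is constant
    obtain ⟨r, hr, hball⟩ := Metric.mem_nhds_iff.1 (Filter.inter_mem (hU.mem_nhds hβ)
      ((hΨ'.analytic β hβ).continuousAt.eventually_ne hne))
    have hq : ∀ α ∈ Metric.ball β r, HasDerivAt (fun α => Ψ α / Ψ' α) 0 α := by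
      intro α hα
      obtain ⟨h1, h2⟩ := hball hα
      refine ((hΨ.analytic α h1).differentiableAt.hasDerivAt.fun_div
        (hΨ'.analytic α h1).differentiableAt.hasDerivAt h2).congr_deriv ?_
      have h3 := hw α h1
      rw [hw0] at h3
      rw [div_eq_zero_iff]
      left
      linear_combination -h3
    obtain ⟨c, hcq⟩ := Metric.isOpen_ball.exists_is_const_of_deriv_eq_zero
      (convex_ball β r).isPreconnected
      (fun α hα => (hq α hα).differentiableAt.differentiableWithinAt) (fun α hα => (hq α hα).deriv)
    have heq : ∀ α, Theta m α ≠ 0 → Ψ α = c * Ψ' α := by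
      refine AnalyticOnNhd.eqOn_of_preconnected_of_eventuallyEq hΨ.analytic
        (fun α hα => analyticAt_const.mul (hΨ'.analytic α hα)) hc hβ ?_
      filter_upwards [Metric.ball_mem_nhds β hr] with α hα
      rw [← hcq α hα, div_mul_cancel₀ _ (hball hα).2]
    have hc0 : c ≠ 0 := by
      rintro rfl
      obtain ⟨α, hα, h0⟩ := hΨ.nonzero
      exact h0 (by rw [heq α hα, zero_mul])
    rw [← exp_two_ellK_eq_iff hm1]
    have h1 := hk β hβ
    rw [heq β hβ, heq _ (Theta_add_two_ellK_ne hm1 hβ), hk' β hβ] at h1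
    exact mul_right_cancel₀ (mul_ne_zero hc0 hne) (by linear_combination -h1)
  · right
    rw [← exp_two_ellK_eq_iff hm1]
    have h0 := Theta_zero_ne hm0 hm1
    have h1 := hw 0 h0
    have h2 := hw _ (Theta_add_two_ellK_ne hm1 h0)
    simp only [hW] at h1 h2
    rw [hk 0 h0, hk' 0 h0, hk.deriv hm0 hm1 h0, hk'.deriv hm0 hm1 h0] at h2
    rw [show I * -k * (2 * ellK m) = -(I * k * (2 * ellK m)) by ring, Complex.exp_neg]
    refine inv_eq_of_mul_eq_one_right ?_
    refine mul_right_cancel₀ hw0 ?_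
    linear_combination h2 -
      exp (I * k * (2 * ellK m)) * exp (I * k' * (2 * ellK m)) * h1

lemma dn_sq_eq_redE_sub_iff {ℓ : ℕ} {m : ℂ} (hm0 : m ≠ 0) (hm1 : m ≠ 1) (Bmap : ℂ → ℂ → ℂ → ℂ)
    (E : ℂ) {α : ℂ} (hα : Theta m α ≠ 0) :
    dn m α ^ 2 = redE ℓ Bmap E m - m ↔ jX m α = Bmap (accB ℓ m E) (g2J m) (g3J m) := by
  have h := dn_sq_add hm0 hm1 hα
  rw [redE, jX]
  exact ⟨fun e => by linear_combination h - e, fun e => by linear_combination h - e⟩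

lemma eq_I_mul_redNu_iff {ℓ : ℕ} {m : ℂ} (νmap : ℂ → ℂ → ℂ → ℂ → ℂ) (E νt α : ℂ) :
    m * sn m α * cn m α * dn m α = I * redNu ℓ νmap E νt m ↔
      jY m α = 2 * νmap (accB ℓ m E) (I * νt) (g2J m) (g3J m) := by
  have h : I * redNu ℓ νmap E νt m = νmap (accB ℓ m E) (I * νt) (g2J m) (g3J m) := by
    rw [redNu]
    linear_combination (-νmap (accB ℓ m E) (I * νt) (g2J m) (g3J m)) * I_sq
  rw [h, jY]
  exact ⟨fun e => by linear_combination 2 * e, fun e => by linear_combination (1 / 2 : ℂ) * e⟩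

/-- A point `(E, ν̃)` of the Jacobi-form spectral curve corresponds to the point `(B, iν̃)`. -/
lemma OnSpectralCurveJ.onSpectralCurve {ℓ : ℕ} {m E νt : ℂ} (h : OnSpectralCurveJ ℓ m E νt) :
    OnSpectralCurve ℓ (g2J m) (g3J m) (accB ℓ m E) (I * νt) := by
  have e : νt ^ 2 = -(specFull ℓ (g2J m) (g3J m)).eval (accB ℓ m E) := by
    refine (show νt ^ 2 = _ from h).trans ?_
    simp only [specJ, eval_neg, eval_comp, eval_sub, eval_C, eval_X, accB]
    ring_nf
  rw [OnSpectralCurve, mul_pow, I_sq, e]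
  ring

/-- The multi-valued crystal momentum in terms of the zeta function at the parameters of the
point `(x₀, y₀)`. -/
lemma mem_kEll_iff {ℓ : ℕ} {m : ℂ} (hm0 : m ≠ 0) (hm1 : m ≠ 1) {Bmap : ℂ → ℂ}
    {νmap : ℂ → ℂ → ℂ} {κhat : ℂ → ℂ} {E νt : ℂ} {A₀ B₀ : ℂ[X]}
    (h : IsHKSolution ℓ (g2J m) (g3J m) (accB ℓ m E) (Bmap (accB ℓ m E))
      (2 * νmap (accB ℓ m E) (I * νt)) (κhat (accB ℓ m E) * (I * νt)) A₀ B₀) (z : ℂ) :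
    z ∈ kEll ℓ m Bmap νmap κhat E νt ↔ ∃ (α : ℂ) (n : ℤ), Theta m α ≠ 0 ∧
      jX m α = Bmap (accB ℓ m E) ∧ jY m α = 2 * νmap (accB ℓ m E) (I * νt) ∧
      z = -I * Zeta m α + Real.pi / (2 * ellK m) + κhat (accB ℓ m E) * νt +
        n * (Real.pi / ellK m) := by
  have e : ∀ α, -I * Zeta m α + Real.pi / (2 * ellK m) - I * (κhat (accB ℓ m E) * (I * νt)) =
      -I * Zeta m α + Real.pi / (2 * ellK m) + κhat (accB ℓ m E) * νt := fun α => by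
    linear_combination (-(κhat (accB ℓ m E) * νt)) * I_sq
  constructor
  · rintro ⟨Ψ, ⟨hΨ, α, A, B, hα, hX, hY, rfl⟩, hz⟩
    obtain ⟨n, hn⟩ := (hasMomentum_iff hm1 hΨ (hasMomentum_hkFunJ hm1 _ _ _ _) z).1 hz
    exact ⟨α, n, hα, hX.symm, hY.symm, by rw [hn, e]⟩
  · rintro ⟨α, n, hα, hX, hY, rfl⟩
    rw [← hX, ← hY] at h
    have hΨ := isLameSolution_hkFunJ hm0 hm1 hα h
    refine ⟨_, ⟨hΨ, α, _, _, hα, hX.symm, hY.symm, rfl⟩, ?_⟩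
    rw [hasMomentum_iff hm1 hΨ (hasMomentum_hkFunJ hm1 _ _ _ _), e]
    exact ⟨n, rfl⟩

end Lame

open Complex Lame

theorem mainTheorem8 (ℓ : ℕ) (hℓ : 1 ≤ ℓ) (m : ℂ) (hm0 : m ≠ 0) (hm1 : m ≠ 1)
    (Bmap : ℂ → ℂ → ℂ → ℂ) (νmap : ℂ → ℂ → ℂ → ℂ → ℂ) (κhat : ℂ → ℂ → ℂ → ℂ) (S : Finset ℂ)
    (hHK : Lame.HKIntegrates ℓ (Lame.g2J m) (Lame.g3J m)
      (fun B => Bmap B (Lame.g2J m) (Lame.g3J m))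
      (fun B ν => νmap B ν (Lame.g2J m) (Lame.g3J m))
      (fun B => κhat B (Lame.g2J m) (Lame.g3J m)) S)
    (k : ℂ → ℂ → Set ℂ)
    (hk : k = Lame.kEll ℓ m
      (fun B => Bmap B (Lame.g2J m) (Lame.g3J m))
      (fun B ν => νmap B ν (Lame.g2J m) (Lame.g3J m))
      (fun B => κhat B (Lame.g2J m) (Lame.g3J m))) :
    ∀ E νt : ℂ, Lame.OnSpectralCurveJ ℓ m E νt → Lame.accB ℓ m E ∉ S →
      -- the dispersion relation, as an equality of multi-valued quantities
      k E νt = {z | ∃ k₁ ∈ Lame.kOne m (Lame.redE ℓ Bmap E m) (Lame.redNu ℓ νmap E νt m),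
          z = k₁ + Lame.redKappa ℓ κhat E m * νt} ∧
      -- the multi-valuedness is exactly the addition of integer multiples of π/K(m)
      (∃ k₀ : ℂ, k E νt = {z | ∃ n : ℤ, z = k₀ + n * (Real.pi / Lame.ellK m)}) ∧
      -- up to sign, these are all the crystal momenta of solutions with energy E
      (∀ z : ℂ, (∃ Ψ, Lame.IsLameSolution ℓ m E Ψ ∧ Lame.HasMomentum m Ψ z) ↔
        z ∈ k E νt ∨ -z ∈ k E νt) := by
  intro E νt hE hS
  obtain ⟨A₀, B₀, h⟩ := hHK (accB ℓ m E) (I * νt) hS hE.onSpectralCurve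
  have hmem := fun z => mem_kEll_iff hm0 hm1 (νmap := fun B ν => νmap B ν (g2J m) (g3J m))
    (Bmap := fun B => Bmap B (g2J m) (g3J m)) (κhat := fun B => κhat B (g2J m) (g3J m)) h z
  rw [← hk] at hmem
  obtain ⟨α₀, hα₀, hX₀, hY₀⟩ := exists_jX_eq_jY_eq hm0 hm1 h.on_curve
  have hcoset : ∃ k₀ : ℂ, k E νt = {z | ∃ n : ℤ, z = k₀ + n * (Real.pi / ellK m)} := by
    refine ⟨-I * Zeta m α₀ + Real.pi / (2 * ellK m) + κhat (accB ℓ m E) (g2J m) (g3J m) * νt,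
      Set.ext fun z => (hmem z).trans ⟨?_, ?_⟩⟩
    · rintro ⟨α, n, hα, hX, hY, rfl⟩
      -- two parameters of the same point differ by a period, which changes `Z` accordingly
      obtain ⟨j, n', rfl⟩ := exists_int_of_jX_eq_jY_eq hm0 hm1 hα hα₀ (hX.trans hX₀.symm)
        (hY.trans hY₀.symm)
      refine ⟨n - n', ?_⟩
      rw [Zeta_add_lattice hm0 hm1 hα₀]
      push_cast
      linear_combination n' * (Real.pi / ellK m) * I_sq
    · rintro ⟨n, rfl⟩
      exact ⟨α₀, n, hα₀, hX₀, hY₀, rfl⟩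
  refine ⟨?_, hcoset, fun z => ⟨?_, ?_⟩⟩
  · ext z
    refine (hmem z).trans ⟨?_, ?_⟩
    · rintro ⟨α, n, hα, hX, hY, rfl⟩
      exact ⟨_, ⟨α, n, hα, (dn_sq_eq_redE_sub_iff hm0 hm1 Bmap E hα).2 hX,
        (eq_I_mul_redNu_iff νmap E νt α).2 hY, rfl⟩, by rw [redKappa]; ring⟩
    · rintro ⟨_, ⟨α, n, hα, hX, hY, rfl⟩, rfl⟩
      exact ⟨α, n, hα, (dn_sq_eq_redE_sub_iff hm0 hm1 Bmap E hα).1 hX,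
        (eq_I_mul_redNu_iff νmap E νt α).1 hY, by rw [redKappa]; ring⟩
  · rintro ⟨Ψ, hΨ, hz⟩
    obtain ⟨k₀, hk₀⟩ := hcoset
    have h₀ : k₀ ∈ k E νt := by rw [hk₀]; exact ⟨0, by simp⟩
    have h₁ := h₀
    rw [hk] at h₁
    obtain ⟨Ψ', ⟨hΨ', -⟩, hz'⟩ := h₁
    rw [hk₀]
    exact momentum_eq_or_eq_neg hm0 hm1 hΨ hΨ' hz hz'
  · rw [hk]
    rintro (⟨Ψ, ⟨hΨ, -⟩, hz⟩ | ⟨Ψ, ⟨hΨ, -⟩, hz⟩)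
    · exact ⟨Ψ, hΨ, hz⟩
    · exact ⟨_, hΨ.comp_neg hm1, by simpa using hz.comp_neg hm1⟩
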